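/- Let $\dot{\mathfrak g}$ be a finite-dimensional simple Lie algebra over $\mathbb C$ with Cartan subalgebra $\dot{\mathfrak h}$, a fixed base of its root system, the sum $\dot{\mathfrak g}_+$ of the positive root spaces, and a nondegenerate invariant symmetric bilinear form $(\cdot|\cdot)$. Let $\nu\ge 1$, $A=\mathbb C[t_0^{\pm1},\dots,t_\nu^{\pm1}]$, and let $\mathcal K$ be the vector space spanned by symbols $t^{\mathbf r}k_p$ ($\mathbf r\in\mathbb Z^{\nu+1}$, $0\le p\le\nu$) subject to $\sum_p r_p t^{\mathbf r}k_p=0$, and $\mathcal D$ the space of derivations of $A$, with basis $t^{\mathbf r}d_p=t^{\mathbf r}t_p\frac{\partial}{\partial t_p}$. For $c_1,c_2\in\mathbb C$ let $\tau=\dot{\mathfrak g}\otimes A\oplus\mathcal K\oplus\mathcal D$ be the full toroidal Lie algebra, with $$[x\otimes t^{\mathbf m},y\otimes t^{\mathbf n}]=[x,y]\otimes t^{\mathbf m+\mathbf n}+(x|y)\sum_p m_pt^{\mathbf m+\mathbf n}k_p,\qquad [t^{\mathbf m}d_a,y\otimes t^{\mathbf n}]=n_a\,y\otimes t^{\mathbf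 m+\mathbf n},$$ $$[t^{\mathbf m}d_a,t^{\mathbf n}k_b]=n_at^{\mathbf m+\mathbf n}k_b+\delta_{ab}\sum_pm_pt^{\mathbf m+\mathbf n}k_p,$$ $$[t^{\mathbf m}d_a,t^{\mathbf n}d_b]=n_at^{\mathbf m+\mathbf n}d_b-m_bt^{\mathbf m+\mathbf n}d_a+(-c_1n_am_b+c_2m_an_b)\sum_pm_pt^{\mathbf m+\mathbf n}k_p,$$ and $\mathcal K$ commuting with $\mathcal K$ and $\dot{\mathfrak g}\otimes A$. Let $B$ be a finitely generated commutative associative unital $\mathbb C$-algebra and $\tau(B)=\tau\otimes B$ with $[X\otimes b,Y\otimes b']=[X,Y]\otimes bb'$. Put $\mathfrak h=\dot{\mathfrak h}\oplus\bigoplus_{p=0}^{\nu}\mathbb Ck_p\oplus\bigoplus_{p=0}^{\nu}\mathbb Cd_p$. Let $V$ be an irreducible $\tau(B)$-module that is integrable with finite-dimensional weight spaces: $V$ is the direct sum of its weight spaces for $\mathfrak h\otimes1$, these are finite-dimensional, and $x\otimes t^{\mathbf m}\otimes b$ acts locally nilpotently on $V$ for every root vector $x$ of $\dot{\mathfrak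 g}$, every $\mathbf m\in\mathbb Z^{\nu+1}$ and $b\in B$. Suppose that all central charges are zero, i.e. $k_p\otimes1$ acts as $0$ on $V$ for $0\le p\le\nu$. Let $$T=\{v\in V:(\dot{\mathfrak g}_+\otimes A\otimes B)\cdot v=0\},$$ let $\Lambda\in\dot{\mathfrak h}^*$ be a weight of $T$ (there is $0\ne w\in T$ with $(h\otimes 1)\cdot w=\Lambda(h)w$ for all $h\in\dot{\mathfrak h}$), and let $h_0\in\dot{\mathfrak h}$ be such that $\Lambda(h_0)\neq0$. Then: 1. There is a (unital) algebra homomorphism $\psi:B\to\mathbb C$ such that for all $\mathbf m\in\mathbb Z^{\nu+1}$ and $b\in B$ $$h_0\otimes t^{\mathbf m}\otimes b=\psi(b)\,h_0\otimes t^{\mathbf m}\otimes1\quad\text{on }T.$$ 2. For all $\mathbf m,\mathbf n\in\mathbb Z^{\nu+1}$ and $b_1,b_2\in B$ $$(h_0\otimes t^{\mathbf m}\otimes b_1)\cdot(h_0\otimes t^{\mathbf n}\otimes b_2)=\Lambda(h_0)\,h_0\otimes t^{\mathbf m+\mathbf n}\otimes b_1b_2\quad\text{on }T.$$ -/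

import Mathlib

open scoped TensorProduct

noncomputable section

namespace MapToroidal

/-- The invariant symmetric nondegenerate bilinear form `(· | ·)` on the Lie algebra `g`
(on a simple Lie algebra it is unique up to a nonzero scalar). -/
structure InvForm (g : Type*) [LieRing g] [LieAlgebra ℂ g] where
  form : LinearMap.BilinForm ℂ g
  symm : form.IsSymm
  invariant : form.lieInvariant g
  nondegenerate : form.Nondegenerate

/-- Exponents `𝐦 = (m₀, …, m_ν)` of the Laurent monomials `t^𝐦`. -/
abbrev Exponent (ν : ℕ) : Type := Fin (ν + 1) → ℤ

/-- An exponent regarded as a complex vector. -/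
def vec {ν : ℕ} (m : Exponent ν) : Fin (ν + 1) → ℂ := fun i => (m i : ℂ)

/-- The space `g ⊕ ⨁ₚ ℂ kₚ ⊕ ⨁ₚ ℂ dₚ` of coefficients of a monomial `t^𝐦`:
the triple `(x, k, d)` at the monomial `t^𝐦` stands for
`x ⊗ t^𝐦 + ∑ₚ k p • t^𝐦 kₚ + ∑ₚ d p • t^𝐦 dₚ`. -/
abbrev Coeff (g : Type*) (ν : ℕ) : Type _ :=
  g × (Fin (ν + 1) → ℂ) × (Fin (ν + 1) → ℂ)

/-- Formal finite sums of elements `x ⊗ t^𝐦`, `t^𝐦 kₚ` and `t^𝐦 dₚ`. -/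
abbrev Formal (g : Type*) [AddCommGroup g] (ν : ℕ) : Type _ := Exponent ν →₀ Coeff g ν

section Construction

variable {g : Type*} [LieRing g] [LieAlgebra ℂ g] {ν : ℕ}

/-- The coefficient `-c₁ nₐ m_b + c₂ mₐ n_b` of `∑ₚ mₚ t^(𝐦+𝐧) kₚ` in
`(c₁ φ₁ + c₂ φ₂)(t^𝐦 dₐ, t^𝐧 d_b)`, extended bilinearly to `d = ∑ d a • dₐ` and
`e = ∑ e b • d_b`. -/
def cocycleCoeff (c₁ c₂ : ℂ) (m n : Exponent ν) (d e : Fin (ν + 1) → ℂ) : ℂ :=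
  -c₁ * ((d ⬝ᵥ vec n) * (e ⬝ᵥ vec m)) + c₂ * ((d ⬝ᵥ vec m) * (e ⬝ᵥ vec n))

/-- The coefficient at `t^(𝐦+𝐧)` of the bracket of `(x, k, d)` at `t^𝐦` and `(y, l, e)` at `t^𝐧`.
It is the bilinear extension of
* `[x ⊗ t^𝐦, y ⊗ t^𝐧] = [x, y] ⊗ t^(𝐦+𝐧) + (x | y) ∑ₚ mₚ t^(𝐦+𝐧) kₚ`,
* `[t^𝐦 dₐ, y ⊗ t^𝐧] = nₐ y ⊗ t^(𝐦+𝐧)`,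
* `[t^𝐦 dₐ, t^𝐧 k_b] = nₐ t^(𝐦+𝐧) k_b + δ_{ab} ∑ₚ mₚ t^(𝐦+𝐧) kₚ`,
* `[t^𝐦 dₐ, t^𝐧 d_b] = nₐ t^(𝐦+𝐧) d_b - m_b t^(𝐦+𝐧) dₐ + (c₁ φ₁ + c₂ φ₂)(t^𝐦 dₐ, t^𝐧 d_b)`,
all `t^𝐦 kₚ` commuting with each other and with all `y ⊗ t^𝐧`. -/
def coeffBracket (κ : InvForm g) (c₁ c₂ : ℂ) (m n : Exponent ν) :
    Coeff g ν →ₗ[ℂ] Coeff g ν →ₗ[ℂ] Coeff g ν :=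
  LinearMap.mk₂ ℂ
    (fun u v =>
      (⁅u.1, v.1⁆ + (u.2.2 ⬝ᵥ vec n) • v.1 - (v.2.2 ⬝ᵥ vec m) • u.1,
       κ.form u.1 v.1 • vec m
        + ((u.2.2 ⬝ᵥ vec n) • v.2.1 + (u.2.2 ⬝ᵥ v.2.1) • vec m)
        - ((v.2.2 ⬝ᵥ vec m) • u.2.1 + (v.2.2 ⬝ᵥ u.2.1) • vec n)
        + cocycleCoeff c₁ c₂ m n u.2.2 v.2.2 • vec m,
       (u.2.2 ⬝ᵥ vec n) • v.2.2 - (v.2.2 ⬝ᵥ vec m) • u.2.2))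
    (by
      intro u u' v
      refine Prod.ext ?_ (Prod.ext ?_ ?_) <;>
        simp [cocycleCoeff, add_dotProduct, dotProduct_add] <;> module)
    (by
      intro a u v
      refine Prod.ext ?_ (Prod.ext ?_ ?_) <;>
        simp [cocycleCoeff, smul_dotProduct, dotProduct_smul] <;> module)
    (by
      intro u v v'
      refine Prod.ext ?_ (Prod.ext ?_ ?_) <;>
        simp [cocycleCoeff, add_dotProduct, dotProduct_add] <;> module)
    (by
      intro a u v
      refine Prod.ext ?_ (Prod.ext ?_ ?_) <;>
        simp [cocycleCoeff, smul_dotProduct, dotProduct_smul] <;> module)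

/-- The bilinear bracket on formal sums. -/
def formalBracket (κ : InvForm g) (c₁ c₂ : ℂ) : Formal g ν →ₗ[ℂ] Formal g ν →ₗ[ℂ] Formal g ν :=
  Finsupp.lsum ℂ fun m => LinearMap.flip (Finsupp.lsum ℂ fun n =>
    LinearMap.flip ((coeffBracket κ c₁ c₂ m n).compr₂ (Finsupp.lsingle (m + n))))

theorem formalBracket_single (κ : InvForm g) (c₁ c₂ : ℂ) (m n : Exponent ν) (u v : Coeff g ν) :
    formalBracket κ c₁ c₂ (Finsupp.single m u) (Finsupp.single n v)
      = Finsupp.single (m + n) (coeffBracket κ c₁ c₂ m n u v) := by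
  simp [formalBracket]

variable (g ν) in
/-- The span of the relations `∑ₚ rₚ t^𝐫 kₚ = 0`. -/
def relations : Submodule ℂ (Formal g ν) :=
  Submodule.span ℂ (Set.range fun r : Exponent ν => Finsupp.single r ((0, vec r, 0) : Coeff g ν))

theorem single_mem_relations (r : Exponent ν) (c : ℂ) :
    Finsupp.single r ((0, c • vec r, 0) : Coeff g ν) ∈ relations g ν := by
  have h := (relations g ν).smul_mem c (Submodule.subset_span (Set.mem_range_self r))
  simpa using h

theorem vec_add (m n : Exponent ν) : vec (m + n) = vec m + vec n := by
  ext i; simp [vec]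

theorem formalBracket_skew (κ : InvForm g) (c₁ c₂ : ℂ) (P Q : Formal g ν) :
    formalBracket κ c₁ c₂ P Q + formalBracket κ c₁ c₂ Q P ∈ relations g ν := by
  induction P using Finsupp.induction_linear with
  | zero => simp
  | add P P' h h' =>
    have := add_mem h h'
    simp only [map_add, LinearMap.add_apply] at this ⊢
    convert this using 1; abel
  | single m u =>
    induction Q using Finsupp.induction_linear with
    | zero => simp
    | add Q Q' h h' =>
      have := add_mem h h'
      simp only [map_add, LinearMap.add_apply] at this ⊢
      convert this using 1; abel
    | single n v =>
      obtain ⟨x, k, d⟩ := u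
      obtain ⟨y, l, e⟩ := v
      convert single_mem_relations (g := g) (m + n)
        (κ.form x y + cocycleCoeff c₁ c₂ m n d e) using 1
      rw [formalBracket_single, formalBracket_single, add_comm n m, ← Finsupp.single_add]
      congr 1
      have hs : κ.form y x = κ.form x y := κ.symm.eq y x
      refine Prod.ext ?_ (Prod.ext ?_ ?_)
      · simp only [coeffBracket, LinearMap.mk₂_apply, Prod.fst_add, ← lie_skew x y]
        module
      · simp only [coeffBracket, LinearMap.mk₂_apply, Prod.fst_add, Prod.snd_add, vec_add, hs,
          cocycleCoeff]
        module
      · simp only [coeffBracket, LinearMap.mk₂_apply, Prod.snd_add]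
        module

theorem formalBracket_left_mem (κ : InvForm g) (c₁ c₂ : ℂ) {P : Formal g ν}
    (hP : P ∈ relations g ν) (Q : Formal g ν) :
    formalBracket κ c₁ c₂ P Q ∈ relations g ν := by
  induction hP using Submodule.span_induction with
  | zero => simp
  | add P P' _ _ h h' => simpa using add_mem h h'
  | smul a P _ h => simpa using (relations g ν).smul_mem a h
  | mem P hP =>
    obtain ⟨m, rfl⟩ := hP
    induction Q using Finsupp.induction_linear with
    | zero => simp
    | add Q Q' h h' => simpa using add_mem h h'
    | single n v =>
      obtain ⟨y, l, e⟩ := v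
      convert single_mem_relations (g := g) (m + n) (-(e ⬝ᵥ vec m)) using 1
      rw [formalBracket_single]
      congr 1
      refine Prod.ext ?_ (Prod.ext ?_ ?_)
      · simp [coeffBracket]
      · simp only [coeffBracket, LinearMap.mk₂_apply, cocycleCoeff, vec_add, zero_dotProduct,
          map_zero, LinearMap.zero_apply]
        module
      · simp [coeffBracket]

theorem formalBracket_right_mem (κ : InvForm g) (c₁ c₂ : ℂ) (P : Formal g ν) {Q : Formal g ν}
    (hQ : Q ∈ relations g ν) :
    formalBracket κ c₁ c₂ P Q ∈ relations g ν := by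
  have h := sub_mem (formalBracket_skew κ c₁ c₂ P Q) (formalBracket_left_mem κ c₁ c₂ hQ P)
  simpa using h

theorem formalBracket_jacobi (κ : InvForm g) (c₁ c₂ : ℂ) (P Q R : Formal g ν) :
    formalBracket κ c₁ c₂ P (formalBracket κ c₁ c₂ Q R)
      - (formalBracket κ c₁ c₂ (formalBracket κ c₁ c₂ P Q) R
        + formalBracket κ c₁ c₂ Q (formalBracket κ c₁ c₂ P R)) ∈ relations g ν := by
  induction P using Finsupp.induction_linear with
  | zero => simp
  | add P P' h h' =>
    have := add_mem h h'
    simp only [map_add, LinearMap.add_apply] at this ⊢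
    convert this using 1; abel
  | single m u =>
    induction Q using Finsupp.induction_linear with
    | zero => simp
    | add Q Q' h h' =>
      have := add_mem h h'
      simp only [map_add, LinearMap.add_apply] at this ⊢
      convert this using 1; abel
    | single n v =>
      induction R using Finsupp.induction_linear with
      | zero => simp
      | add R R' h h' =>
        have := add_mem h h'
        simp only [map_add] at this ⊢
        convert this using 1; abel
      | single r w =>
        obtain ⟨x, k, d⟩ := u
        obtain ⟨y, l, e⟩ := v
        obtain ⟨z, j, f⟩ := w
        convert single_mem_relations (g := g) (m + n + r)
          ((κ.form x y + cocycleCoeff c₁ c₂ m n d e) * (f ⬝ᵥ vec m)) using 1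
        simp only [formalBracket_single]
        rw [← add_assoc m n r, add_left_comm n m r, ← add_assoc m n r, ← Finsupp.single_add,
          ← Finsupp.single_sub]
        congr 1
        have h1 : κ.form ⁅x, y⁆ z = κ.form x ⁅y, z⁆ := by
          rw [← lie_skew, map_neg, LinearMap.neg_apply, κ.invariant, neg_neg]
        have h2 : κ.form y ⁅x, z⁆ = -κ.form x ⁅y, z⁆ := by
          rw [← h1, κ.invariant, neg_neg]
        have h3 : κ.form y x = κ.form x y := κ.symm.eq y x
        refine Prod.ext ?_ (Prod.ext ?_ ?_)
        · simp only [coeffBracket, LinearMap.mk₂_apply, Prod.fst_add, Prod.fst_sub, vec_add,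
            dotProduct_add, sub_dotProduct, smul_dotProduct, lie_add, lie_sub,
            lie_smul, add_lie, sub_lie, smul_lie, smul_eq_mul, leibniz_lie x y z,
            ← lie_skew y x]
          module
        · simp only [coeffBracket, LinearMap.mk₂_apply, Prod.fst_add, Prod.fst_sub, Prod.snd_add,
            Prod.snd_sub, vec_add, dotProduct_add, dotProduct_sub, dotProduct_smul,
            sub_dotProduct, smul_dotProduct, map_add, map_sub, map_smul, LinearMap.add_apply,
            LinearMap.sub_apply, LinearMap.smul_apply, smul_eq_mul, cocycleCoeff, h1, h2, h3]
          module
        · simp only [coeffBracket, LinearMap.mk₂_apply, Prod.snd_add, Prod.snd_sub, vec_add,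
            dotProduct_add, sub_dotProduct, smul_dotProduct, smul_eq_mul]
          module

/-- The full toroidal Lie algebra `τ = g ⊗ A ⊕ 𝒦 ⊕ 𝒟` with `A = ℂ[t₀^±1, …, t_ν^±1]` and cocycle
`φ = c₁ φ₁ + c₂ φ₂`. -/
def FullToroidal (_κ : InvForm g) (_c₁ _c₂ : ℂ) (ν : ℕ) : Type _ := Formal g ν ⧸ relations g ν

namespace FullToroidal

variable (κ : InvForm g) (c₁ c₂ : ℂ)

instance : AddCommGroup (FullToroidal κ c₁ c₂ ν) :=
  inferInstanceAs (AddCommGroup (Formal g ν ⧸ relations g ν))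

instance : Module ℂ (FullToroidal κ c₁ c₂ ν) :=
  inferInstanceAs (Module ℂ (Formal g ν ⧸ relations g ν))

/-- The class of a formal sum. -/
def mk : Formal g ν →ₗ[ℂ] FullToroidal κ c₁ c₂ ν := (relations g ν).mkQ

theorem mk_surjective : Function.Surjective (mk κ c₁ c₂ : Formal g ν → _) :=
  Submodule.mkQ_surjective _

theorem mk_eq_zero {P : Formal g ν} : mk κ c₁ c₂ P = 0 ↔ P ∈ relations g ν :=
  Submodule.Quotient.mk_eq_zero _

/-- The bracket of `τ`, induced by the bracket on formal sums. -/
def bracket :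
    FullToroidal κ c₁ c₂ ν →ₗ[ℂ] FullToroidal κ c₁ c₂ ν →ₗ[ℂ] FullToroidal κ c₁ c₂ ν :=
  (relations g ν).liftQ
    (LinearMap.flip ((relations g ν).liftQ
      (LinearMap.flip ((formalBracket κ c₁ c₂).compr₂ (mk κ c₁ c₂)))
      (fun Q hQ => LinearMap.ext fun P =>
        (mk_eq_zero κ c₁ c₂).2 (formalBracket_right_mem κ c₁ c₂ P hQ))))
    (fun P hP => LinearMap.ext fun X => by
      obtain ⟨Q, rfl⟩ := mk_surjective κ c₁ c₂ X
      exact (mk_eq_zero κ c₁ c₂).2 (formalBracket_left_mem κ c₁ c₂ hP Q))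

theorem bracket_mk (P Q : Formal g ν) :
    bracket κ c₁ c₂ (mk κ c₁ c₂ P) (mk κ c₁ c₂ Q) = mk κ c₁ c₂ (formalBracket κ c₁ c₂ P Q) :=
  rfl

instance : LieRing (FullToroidal κ c₁ c₂ ν) where
  bracket X Y := bracket κ c₁ c₂ X Y
  add_lie X Y Z := by
    change bracket κ c₁ c₂ (X + Y) Z = bracket κ c₁ c₂ X Z + bracket κ c₁ c₂ Y Z
    simp
  lie_add X Y Z := by
    change bracket κ c₁ c₂ X (Y + Z) = bracket κ c₁ c₂ X Y + bracket κ c₁ c₂ X Z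
    simp
  lie_self X := by
    obtain ⟨P, rfl⟩ := mk_surjective κ c₁ c₂ X
    have h := (mk_eq_zero κ c₁ c₂).2 (formalBracket_skew κ c₁ c₂ P P)
    rw [map_add, ← two_smul ℂ, smul_eq_zero] at h
    exact h.resolve_left two_ne_zero
  leibniz_lie X Y Z := by
    obtain ⟨P, rfl⟩ := mk_surjective κ c₁ c₂ X
    obtain ⟨Q, rfl⟩ := mk_surjective κ c₁ c₂ Y
    obtain ⟨R, rfl⟩ := mk_surjective κ c₁ c₂ Z
    have h := (mk_eq_zero κ c₁ c₂).2 (formalBracket_jacobi κ c₁ c₂ P Q R)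
    rw [map_sub, map_add, sub_eq_zero] at h
    exact h

instance : LieAlgebra ℂ (FullToroidal κ c₁ c₂ ν) where
  lie_smul a X Y := map_smul (bracket κ c₁ c₂ X) a Y

/-- The element `x ⊗ t^𝐦` of `τ`. -/
def loop (x : g) (m : Exponent ν) : FullToroidal κ c₁ c₂ ν :=
  mk κ c₁ c₂ (Finsupp.single m (x, 0, 0))

/-- The element `t^𝐦 kₚ` of `τ`. -/
def cen (m : Exponent ν) (p : Fin (ν + 1)) : FullToroidal κ c₁ c₂ ν :=
  mk κ c₁ c₂ (Finsupp.single m (0, Pi.single p 1, 0))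

/-- The element `t^𝐦 dₚ` of `τ`. -/
def der (m : Exponent ν) (p : Fin (ν + 1)) : FullToroidal κ c₁ c₂ ν :=
  mk κ c₁ c₂ (Finsupp.single m (0, 0, Pi.single p 1))

/-- The element `h + ∑ₚ a p • kₚ + ∑ₚ b p • dₚ` of `τ`, for `u = (h, a, b)`, where `h` lies in the
Cartan subalgebra `H` of `g`. These elements form the Cartan subalgebra `𝔥` of `τ`. -/
def cartan (H : LieSubalgebra ℂ g) (u : H × (Fin (ν + 1) → ℂ) × (Fin (ν + 1) → ℂ)) :
    FullToroidal κ c₁ c₂ ν :=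
  mk κ c₁ c₂ (Finsupp.single 0 ((u.1 : g), u.2.1, u.2.2))

end FullToroidal

/-- The map full toroidal Lie algebra `τ(B) = τ ⊗ B`, with `[X ⊗ b, Y ⊗ b'] = [X, Y] ⊗ b b'`
(the factor `B` is written on the left). -/
abbrev MapFullToroidal (κ : InvForm g) (c₁ c₂ : ℂ) (ν : ℕ)
    (B : Type*) [CommRing B] [Algebra ℂ B] : Type _ :=
  B ⊗[ℂ] FullToroidal κ c₁ c₂ ν

section Modules

variable (κ : InvForm g) (c₁ c₂ : ℂ) (ν : ℕ) (H : LieSubalgebra ℂ g)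
  (B : Type*) [CommRing B] [Algebra ℂ B]
  (V : Type*) [AddCommGroup V] [Module ℂ V] [LieRingModule (MapFullToroidal κ c₁ c₂ ν B) V]
  [LieModule ℂ (MapFullToroidal κ c₁ c₂ ν B) V]

/-- The operator by which `x ⊗ t^𝐦 ⊗ b` acts on the module `V`. -/
def loopOp {B : Type*} [CommRing B] [Algebra ℂ B]
    (V : Type*) [AddCommGroup V] [Module ℂ V] [LieRingModule (MapFullToroidal κ c₁ c₂ ν B) V]
    [LieModule ℂ (MapFullToroidal κ c₁ c₂ ν B) V]
    (x : g) (m : Exponent ν) (b : B) : Module.End ℂ V :=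
  LieModule.toEnd ℂ (MapFullToroidal κ c₁ c₂ ν B) V (b ⊗ₜ[ℂ] FullToroidal.loop κ c₁ c₂ x m)

/-- The weight space `V_μ = {v | (h ⊗ 1) v = μ(h) v for all h ∈ 𝔥}`. -/
def weightSpace (μ : Module.Dual ℂ (H × (Fin (ν + 1) → ℂ) × (Fin (ν + 1) → ℂ))) :
    Submodule ℂ V where
  carrier := {v | ∀ u, ⁅(1 : B) ⊗ₜ[ℂ] FullToroidal.cartan κ c₁ c₂ H u, v⁆ = μ u • v}
  zero_mem' := fun u => by simp
  add_mem' := fun hv hw u => by rw [lie_add, hv u, hw u, smul_add]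
  smul_mem' := fun a v hv u => by rw [lie_smul, hv u, smul_comm]

/-- Integrable modules: `V` is the sum (automatically direct) of its `𝔥`-weight spaces, and
`x ⊗ t^𝐦 ⊗ b` is locally nilpotent for every root vector `x` of `g`. -/
structure IsIntegrable [FiniteDimensional ℂ g] [LieAlgebra.IsSimple ℂ g]
    [H.IsCartanSubalgebra] : Prop where
  isWeightModule : ⨆ μ, weightSpace κ c₁ c₂ ν H B V μ = ⊤
  locallyNilpotent : ∀ (α : H.root) (x : g), x ∈ LieAlgebra.rootSpace H (α : LieModule.Weight ℂ H g) →
    ∀ (m : Exponent ν) (b : B) (v : V), ∃ N : ℕ, (loopOp κ c₁ c₂ ν V x m b ^ N) v = 0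

/-- Objects of `𝒞_fin`: integrable modules with finite-dimensional weight spaces. -/
structure InCfin [FiniteDimensional ℂ g] [LieAlgebra.IsSimple ℂ g]
    [H.IsCartanSubalgebra] : Prop where
  integrable : IsIntegrable κ c₁ c₂ ν H B V
  finite : ∀ μ, FiniteDimensional ℂ (weightSpace κ c₁ c₂ ν H B V μ)

/-- All central charges vanish: `kₚ ⊗ 1` acts as `0` for `p = 0, …, ν`. -/
def ZeroCentralCharge : Prop :=
  ∀ (p : Fin (ν + 1)) (v : V), ⁅(1 : B) ⊗ₜ[ℂ] FullToroidal.cen κ c₁ c₂ 0 p, v⁆ = 0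

/-- The space `T = {v | (g₊ ⊗ A ⊗ B) v = 0}`, where `g₊` is the sum of the root spaces of `g` for
the roots that are positive with respect to `base`. -/
def highestSpace [FiniteDimensional ℂ g] [LieAlgebra.IsSimple ℂ g] [H.IsCartanSubalgebra]
    (base : (LieAlgebra.IsKilling.rootSystem H).Base) : Submodule ℂ V :=
  ⨅ (α : H.root) (_ : base.IsPos α)
    (x : LieAlgebra.rootSpace H (α : LieModule.Weight ℂ H g)) (m : Exponent ν) (b : B),
    LinearMap.ker (loopOp κ c₁ c₂ ν V (x : g) m b)

end Modules

end Construction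
end MapToroidal
end

/-! Let ρ in the Cartan subalgebra take the value `height α` at each root α. Irreducibility of V
identifies T with the top ρ-eigenspace of V and makes T irreducible under the Cartan loops together
with 𝒦 ⊗ B and 𝒟 ⊗ B (`highestSpace_eq_eigenspace`, `eq_highestSpace_of_cartanStable`). Hence the
Cartan subalgebra acts on T by Λ. Some positive root has a coroot α^∨ with Λ(α^∨) ≠ 0, and
sl₂-theory shows that N = Λ(α^∨) is a positive integer and that (f ⊗ t^m)^(N+1) vanishes on T for
all m.

𝒦 ⊗ B acts by zero. For families e(l), f(l) translated by ±l in direction p, the expression e(l)^M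
f(l)^M w is polynomial in l with top coefficient a nonzero multiple of (t_q k_p)^M w, so t_q k_p is
nilpotent on T (`cenOp_pow_apply_eq_zero`). Commutators with t^m d_q ⊗ b, q ≠ p, spread the
nilpotency to all t^n k_p ⊗ c; a nonzero vector of T is then killed by 𝒦 ⊗ B, and irreducibility
finishes (`cenOp_apply_eq_zero`).

The Cartan loops on T therefore commute, and 𝒟 ⊗ B acts on the algebra they generate by derivations.
Two principles govern such a system. Generalised eigenspaces are stable under derivations, so an
element with one nonzero eigenvalue is invertible and an element with nonzero kernel is locally
nilpotent. Moreover, if s v = 0, then s^k X₁⋯X_k v is (-1)^k k! times the product of the commutators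
[X_i, s] applied to v; by nilpotency of s on finite-dimensional pieces, products of commutators of
total degree zero cannot be injective (`DiffSystem.not_injective`).

An sl₂ computation (`eq_zero_of_markedSpan`) and the second principle make every α^∨ ⊗ t_l
invertible (`exists_complement`). With U^n the monomials in these operators divided by N, h ⊗ t^n ⊗
c acts on a common eigenvector v as ε(h,n,c) U^n. The second principle applied to (h ⊗ t^n ⊗ c)
U^(-n) - ε yields functional equations which force ε to be independent of n and multiplicative in B
(`exists_evaluation`, `eval_eq_of_sign`). The resulting relations hold at v, their solutions form an
invariant subspace, and so they hold on T. -/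

noncomputable section
namespace MapToroidal

/-! ### Commutative algebras of operators with derivations -/

section Graded

open Module (End)

theorem mul_pow_succ_of_commutator {A : Type*} [Ring A] {X s y : A} (h : X * s = s * X + y)
    (hy : y * s = s * y) (n : ℕ) :
    X * s ^ (n + 1) = s ^ (n + 1) * X + (n + 1 : ℕ) • (y * s ^ n) := by
  induction n with
  | zero => simp [h]
  | succ n ih =>
    have hys : s * (y * s ^ n) = y * s ^ (n + 1) := by
      rw [← mul_assoc, ← hy, mul_assoc, ← pow_succ']
    rw [pow_succ' s (n + 1), ← mul_assoc, h, add_mul, mul_assoc, ih, mul_add, mul_smul_comm, hys,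
      ← mul_assoc, ← pow_succ', add_assoc, succ_nsmul _ (n + 1)]

variable {T : Type*} [AddCommGroup T] [Module ℂ T]

/-- Moving the first letter X past s^(n+1) leaves (n+1) y s^n. The term X s^(n+1) vanishes because
s^(n+1) already kills the remaining word of n letters, so each letter contributes a sign and one
factor of the factorial. -/
theorem pow_apply_word {s : End ℂ T} {v : T} (hv : s v = 0) (L : List (End ℂ T × End ℂ T))
    (hL : ∀ p ∈ L, p.1 * s = s * p.1 + p.2 ∧ p.2 * s = s * p.2) :
    (s ^ L.length) ((L.map Prod.fst).prod v)
      = ((-1) ^ L.length * (L.length.factorial : ℂ)) • (L.map Prod.snd).prod v := by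
  have hprod : ∀ L : List (End ℂ T × End ℂ T), (∀ p ∈ L, p.2 * s = s * p.2) →
      s ((L.map Prod.snd).prod v) = 0 := by
    intro L
    induction L with
    | nil => simpa using hv
    | cons p L ih =>
      intro h
      have h1 := LinearMap.congr_fun (h p (by simp)) ((L.map Prod.snd).prod v)
      simp only [Module.End.mul_apply] at h1
      rw [List.map_cons, List.prod_cons, Module.End.mul_apply, ← h1,
        ih fun q hq => h q (by simp [hq]), map_zero]
  induction L with
  | nil => simp
  | cons p L ih =>
    have ih := ih fun q hq => hL q (by simp [hq])
    obtain ⟨h1, h2⟩ := hL p (by simp)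
    have h3 := LinearMap.congr_fun (mul_pow_succ_of_commutator h1 h2 L.length)
      ((L.map Prod.fst).prod v)
    simp only [Module.End.mul_apply, LinearMap.add_apply, LinearMap.smul_apply] at h3
    have h4 : (s ^ (L.length + 1)) ((L.map Prod.fst).prod v) = 0 := by
      rw [pow_succ', Module.End.mul_apply, ih, map_smul,
        hprod L fun q hq => (hL q (by simp [hq])).2, smul_zero]
    rw [h4, map_zero, ih, map_smul] at h3
    simp only [List.length_cons, List.map_cons, List.prod_cons, Module.End.mul_apply]
    rw [eq_neg_of_add_eq_zero_left h3.symm, Nat.factorial_succ]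
    rw [← Nat.cast_smul_eq_nsmul ℂ, smul_smul, ← neg_smul]
    congr 1
    push_cast
    ring

/-- The operator `s` shifts the degree by `n`. -/
def IsHomog {G : Type*} [AddCommGroup G] (𝒯 : G → Submodule ℂ T) (s : End ℂ T) (n : G) : Prop :=
  ∀ j, ∀ v ∈ 𝒯 j, s v ∈ 𝒯 (j + n)

namespace IsHomog

variable {G : Type*} [AddCommGroup G] {𝒯 : G → Submodule ℂ T} {s t : End ℂ T} {m n : G}

theorem mul (hs : IsHomog 𝒯 s m) (ht : IsHomog 𝒯 t n) : IsHomog 𝒯 (s * t) (m + n) := by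
  intro j v hv
  have := hs _ _ (ht j v hv)
  rwa [add_assoc, add_comm n m] at this

theorem one : IsHomog 𝒯 1 (0 : G) := by
  intro j v hv
  simpa using hv

theorem pow (hs : IsHomog 𝒯 s m) (k : ℕ) : IsHomog 𝒯 (s ^ k) (k • m) := by
  induction k with
  | zero => simpa using one
  | succ k ih => rw [pow_succ, succ_nsmul]; exact ih.mul hs

theorem add (hs : IsHomog 𝒯 s m) (ht : IsHomog 𝒯 t m) : IsHomog 𝒯 (s + t) m :=
  fun j v hv => add_mem (hs j v hv) (ht j v hv)

theorem smul (hs : IsHomog 𝒯 s m) (c : ℂ) : IsHomog 𝒯 (c • s) m :=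
  fun j v hv => Submodule.smul_mem _ _ (hs j v hv)

theorem sub (hs : IsHomog 𝒯 s m) (ht : IsHomog 𝒯 t m) : IsHomog 𝒯 (s - t) m :=
  fun j v hv => sub_mem (hs j v hv) (ht j v hv)

end IsHomog

/-- Induction on the dimension: as soon as some s is not scalar on W, an eigenspace of s in W is
smaller and still stable. -/
theorem exists_common_eigenvector (𝒞 : Set (End ℂ T))
    (hcomm : ∀ s ∈ 𝒞, ∀ t ∈ 𝒞, s * t = t * s) (W : Submodule ℂ T) [FiniteDimensional ℂ W]
    (hW : W ≠ ⊥) (hstab : ∀ s ∈ 𝒞, ∀ v ∈ W, s v ∈ W) :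
    ∃ v ∈ W, v ≠ 0 ∧ ∀ s ∈ 𝒞, ∃ c : ℂ, s v = c • v := by
  induction hd : Module.finrank ℂ W using Nat.strong_induction_on generalizing W with
  | _ d ih =>
  obtain ⟨w, hw, hw0⟩ := Submodule.exists_mem_ne_zero_of_ne_bot hW
  by_cases hscal : ∀ s ∈ 𝒞, ∃ c : ℂ, ∀ v ∈ W, s v = c • v
  · exact ⟨w, hw, hw0, fun s hs => (hscal s hs).imp fun c hc => hc w hw⟩
  push Not at hscal
  obtain ⟨s, hs, hns⟩ := hscal
  have : Nontrivial W := Submodule.nontrivial_iff_ne_bot.2 hW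
  obtain ⟨c, hc⟩ := Module.End.exists_eigenvalue (s.restrict (hstab s hs))
  obtain ⟨u, hu⟩ := hc.exists_hasEigenvector
  let W' : Submodule ℂ T := W ⊓ LinearMap.ker (s - c • (1 : End ℂ T))
  have hW'le : W' ≤ W := inf_le_left
  have hmem : ∀ v, v ∈ W' ↔ v ∈ W ∧ s v = c • v := by
    intro v
    simp [W', Submodule.mem_inf, sub_eq_zero]
  have hfin : FiniteDimensional ℂ W' := Submodule.finiteDimensional_of_le hW'le
  have hW' : W' ≠ ⊥ := by
    rw [Submodule.ne_bot_iff]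
    refine ⟨u, (hmem _).2 ⟨u.2, ?_⟩, ?_⟩
    · simpa using congrArg Subtype.val hu.apply_eq_smul
    · simpa using hu.2
  have hlt : W' < W := by
    refine lt_of_le_of_ne hW'le fun h => ?_
    obtain ⟨v, hv, hne⟩ := hns c
    exact hne ((hmem v).1 (h ▸ hv)).2
  obtain ⟨v, hv, h⟩ := ih _ (hd ▸ Submodule.finrank_lt_finrank_of_lt hlt) W' hW'
    (fun t ht v hv => by
      obtain ⟨h1, h2⟩ := (hmem v).1 hv
      refine (hmem _).2 ⟨hstab t ht v h1, ?_⟩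
      have := LinearMap.congr_fun (hcomm s hs t ht) v
      simp only [Module.End.mul_apply] at this
      rw [this, h2, map_smul]) rfl
  exact ⟨v, hW'le hv, h⟩

/-- A commutative algebra `𝒮` of operators normalised by the operators in `𝒟`, which together
act irreducibly, on a space with a family of finite-dimensional pieces. -/
structure DiffSystem {G : Type*} [AddCommGroup G] (𝒯 : G → Submodule ℂ T)
    (𝒮 : Subalgebra ℂ (End ℂ T)) (𝒟 : Set (End ℂ T)) : Prop where
  comm : ∀ s ∈ 𝒮, ∀ t ∈ 𝒮, s * t = t * s
  der : ∀ X ∈ 𝒟, ∀ s ∈ 𝒮, X * s - s * X ∈ 𝒮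
  irr : ∀ W : Submodule ℂ T, W ≠ ⊥ → (∀ s ∈ 𝒮, ∀ v ∈ W, s v ∈ W) →
    (∀ X ∈ 𝒟, ∀ v ∈ W, X v ∈ W) → W = ⊤
  fin : ∀ n, FiniteDimensional ℂ (𝒯 n)

namespace DiffSystem

variable {G : Type*} [AddCommGroup G] {𝒯 : G → Submodule ℂ T} {𝒮 : Subalgebra ℂ (End ℂ T)}
  {𝒟 : Set (End ℂ T)}

theorem exists_eigenvector (hS : DiffSystem 𝒯 𝒮 𝒟) {n : G} (hn : 𝒯 n ≠ ⊥) :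
    ∃ v ∈ 𝒯 n, v ≠ 0 ∧ ∀ s ∈ 𝒮, IsHomog 𝒯 s 0 → ∃ c : ℂ, s v = c • v := by
  have := hS.fin n
  obtain ⟨v, hv, hv0, h⟩ := exists_common_eigenvector {s | s ∈ 𝒮 ∧ IsHomog 𝒯 s 0}
    (fun s hs t ht => hS.comm s hs.1 t ht.1) (𝒯 n) hn
    (fun s hs v hv => by simpa using hs.2 n v hv)
  exact ⟨v, hv, hv0, fun s hs hs0 => h s ⟨hs, hs0⟩⟩

/-- The generalised eigenspace of s is stable under 𝒮 by commutativity. It is stable under 𝒟 because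
a commutator costs only one more power of s - c. Irreducibility makes it everything. -/
theorem exists_pow_sub_apply_eq_zero (hS : DiffSystem 𝒯 𝒮 𝒟) {s : End ℂ T} (hs : s ∈ 𝒮) {c : ℂ}
    {v : T} (hv : v ≠ 0) (hsv : s v = c • v) (w : T) :
    ∃ k : ℕ, ((s - c • (1 : End ℂ T)) ^ k) w = 0 := by
  have hmem : s - c • (1 : End ℂ T) ∈ 𝒮 := 𝒮.sub_mem hs (𝒮.smul_mem 𝒮.one_mem c)
  set r := s - c • (1 : End ℂ T) with hr
  have htop : s.maxGenEigenspace c = ⊤ := by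
    apply hS.irr
    · rw [Submodule.ne_bot_iff]
      exact ⟨v, Module.End.mem_maxGenEigenspace _ _ _ |>.2 ⟨1, by simp [hsv]⟩, hv⟩
    · intro t ht u hu
      obtain ⟨k, hk⟩ := (Module.End.mem_maxGenEigenspace _ _ _).1 hu
      refine (Module.End.mem_maxGenEigenspace _ _ _).2 ⟨k, ?_⟩
      have := LinearMap.congr_fun (hS.comm _ (𝒮.pow_mem hmem k) t ht) u
      simp only [Module.End.mul_apply] at this
      rw [← hr, this, hr, hk, map_zero]
    · intro X hX u hu
      obtain ⟨k, hk⟩ := (Module.End.mem_maxGenEigenspace _ _ _).1 hu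
      refine (Module.End.mem_maxGenEigenspace _ _ _).2 ⟨k + 1, ?_⟩
      have h1 := LinearMap.congr_fun (mul_pow_succ_of_commutator (X := X) (s := r)
        (y := X * r - r * X) (by abel) (hS.comm _ (hS.der X hX r hmem) r hmem) k) u
      simp only [Module.End.mul_apply, LinearMap.add_apply, LinearMap.smul_apply] at h1
      have hk' : (r ^ k) u = 0 := hk
      rw [pow_succ' r k, Module.End.mul_apply, hk', map_zero, map_zero, map_zero, smul_zero,
        add_zero] at h1
      rw [← hr, pow_succ' r k]
      exact h1.symm
  have hw : w ∈ s.maxGenEigenspace c := htop ▸ Submodule.mem_top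
  exact (Module.End.mem_maxGenEigenspace _ _ _).1 hw

/-- Local nilpotency becomes uniform on a finite-dimensional piece: the maximal exponent over a
finite spanning set works. -/
theorem exists_pow_apply_eq_zero (hS : DiffSystem 𝒯 𝒮 𝒟) {s : End ℂ T} (hs : s ∈ 𝒮)
    {v : T} (hv : v ≠ 0) (hsv : s v = 0) (n : G) : ∃ K : ℕ, ∀ w ∈ 𝒯 n, (s ^ K) w = 0 := by
  have := hS.fin n
  have h := fun w => hS.exists_pow_sub_apply_eq_zero hs hv (c := 0) (by simpa using hsv) w
  simp only [zero_smul, sub_zero] at h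
  obtain ⟨F, hF⟩ := (Submodule.fg_iff_finiteDimensional (𝒯 n)).2 this
  choose k hk using h
  refine ⟨F.sup k, fun w hw => ?_⟩
  rw [← hF] at hw
  induction hw using Submodule.span_induction with
  | mem x hx =>
    obtain ⟨d, hd⟩ := Nat.exists_eq_add_of_le' (Finset.le_sup (f := k) hx)
    rw [hd, pow_add, Module.End.mul_apply, hk, map_zero]
  | zero => simp
  | add x y _ _ hx hy => rw [map_add, hx, hy, add_zero]
  | smul a x _ hx => rw [map_smul, hx, smul_zero]

theorem isUnit_of_apply_ne_zero (hS : DiffSystem 𝒯 𝒮 𝒟) {s : End ℂ T} (hs : s ∈ 𝒮) {c : ℂ}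
    {v : T} (hv : v ≠ 0) (hsv : s v = c • v) (hc : c ≠ 0) : Function.Bijective s := by
  have h := fun w => hS.exists_pow_sub_apply_eq_zero hs hv hsv w
  constructor
  · refine (injective_iff_map_eq_zero s).2 fun w hw => ?_
    obtain ⟨k, hk⟩ := h w
    have : ∀ j : ℕ, ((s - c • (1 : End ℂ T)) ^ j) w = (-c) ^ j • w := by
      intro j
      induction j with
      | zero => simp
      | succ j ih => rw [pow_succ', Module.End.mul_apply, ih]; simp [hw, smul_smul, pow_succ]
    rw [this, smul_eq_zero] at hk
    exact hk.resolve_left (pow_ne_zero _ (neg_ne_zero.2 hc))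
  · intro w
    obtain ⟨k, hk⟩ := h w
    have hcom : Commute (s - c • (1 : End ℂ T)) (-(c • (1 : End ℂ T))) :=
      (((Commute.one_right _).smul_right c)).neg_right
    -- With r = s - c, the element s = r - (-c) divides r^k - (-c)^k, and r^k w = 0; hence (-c)^k w
    -- lies in the image of s.
    obtain ⟨q, hq⟩ := hcom.sub_dvd_pow_sub_pow k
    have h1 := LinearMap.congr_fun hq w
    have h2 : ∀ j : ℕ, ((-(c • (1 : End ℂ T))) ^ j) w = (-c) ^ j • w := by
      intro j
      induction j with
      | zero => simp
      | succ j ih => rw [pow_succ', Module.End.mul_apply, ih]; simp [smul_smul, pow_succ]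
    simp only [LinearMap.sub_apply, hk, h2, sub_neg_eq_add, sub_add_cancel, Module.End.mul_apply,
      zero_sub] at h1
    have hck := pow_ne_zero k (neg_ne_zero.2 hc)
    refine ⟨-(((-c) ^ k)⁻¹ • q w), ?_⟩
    rw [map_neg, map_smul, ← h1, smul_neg, neg_neg, smul_smul, inv_mul_cancel₀ hck, one_smul]

end DiffSystem
end Graded
end MapToroidal
end

noncomputable section
namespace MapToroidal

/-! ### Loop systems and invertibility of the coordinate loops -/

section Loop

open Module (End)

variable {T : Type*} [AddCommGroup T] [Module ℂ T]

/-- If the product of commutators were injective, so would be its K-th power, which by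
`pow_apply_word` is, up to a nonzero scalar, what a power of s makes of a word in X, X' applied to
v. -/
theorem DiffSystem.not_injective {G : Type*} [AddCommGroup G] {𝒯 : G → Submodule ℂ T}
    {𝒮 : Subalgebra ℂ (End ℂ T)} {𝒟 : Set (End ℂ T)} (hS : DiffSystem 𝒯 𝒮 𝒟)
    {s X X' : End ℂ T} (hs : s ∈ 𝒮) (hX : X ∈ 𝒟) (hX' : X' ∈ 𝒟) {a a' : G}
    (ha : IsHomog 𝒯 X a) (ha' : IsHomog 𝒯 X' a') {k k' : ℕ} (hk : 0 < k)
    (hdeg : k • a + k' • a' = 0) {n : G} {v : T} (hv : v ∈ 𝒯 n) (hv0 : v ≠ 0) (hsv : s v = 0)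
    {K : ℕ} (hK : ∀ w ∈ 𝒯 n, (s ^ K) w = 0) :
    ¬ Function.Injective ((X * s - s * X) ^ k * (X' * s - s * X') ^ k' : End ℂ T) := by
  intro hinj
  set y := X * s - s * X with hy
  set y' := X' * s - s * X' with hy'
  -- Each of the K periods X^k X'^k' has degree zero, so the whole word carries v back to 𝒯 n, where
  -- s^K vanishes.
  let L : List (End ℂ T × End ℂ T) :=
    (List.replicate K (List.replicate k (X, y) ++ List.replicate k' (X', y'))).flatten
  have hL : ∀ p ∈ L, p.1 * s = s * p.1 + p.2 ∧ p.2 * s = s * p.2 := by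
    intro p hp
    have hp' : p = (X, y) ∨ p = (X', y') := by
      simp only [L, List.mem_flatten, List.mem_replicate] at hp
      obtain ⟨l, ⟨_, rfl⟩, hp⟩ := hp
      rw [List.mem_append, List.mem_replicate, List.mem_replicate] at hp
      exact hp.imp (·.2) (·.2)
    rcases hp' with rfl | rfl
    · exact ⟨(add_sub_cancel _ _).symm, hS.comm _ (hS.der X hX s hs) _ hs⟩
    · exact ⟨(add_sub_cancel _ _).symm, hS.comm _ (hS.der X' hX' s hs) _ hs⟩
  have hlen : L.length = K * (k + k') := by simp [L]
  have h1 : (L.map Prod.fst).prod = (X ^ k * X' ^ k') ^ K := by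
    simp [L, List.map_flatten, List.prod_flatten]
  have h2 : (L.map Prod.snd).prod = (y ^ k * y' ^ k') ^ K := by
    simp [L, List.map_flatten, List.prod_flatten]
  have h3 := pow_apply_word hsv L hL
  rw [h1, h2] at h3
  have h4 : ((X ^ k * X' ^ k') ^ K) v ∈ 𝒯 n := by
    have := ((((ha.pow k).mul (ha'.pow k')).pow K)) n v hv
    rwa [hdeg, smul_zero, add_zero] at this
  have h5 : (s ^ L.length) (((X ^ k * X' ^ k') ^ K) v) = 0 := by
    have hle : K ≤ L.length := by
      rw [hlen]; exact Nat.le_mul_of_pos_right _ (by omega)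
    obtain ⟨d, hd⟩ := Nat.exists_eq_add_of_le' hle
    rw [hd, pow_add, Module.End.mul_apply, hK _ h4, map_zero]
  rw [h5, eq_comm, smul_eq_zero] at h3
  have h6 : ((y ^ k * y' ^ k') ^ K) v = 0 := by
    refine h3.resolve_left (mul_ne_zero (pow_ne_zero _ (by norm_num)) ?_)
    exact_mod_cast Nat.factorial_ne_zero _
  have h7 : Function.Injective ((y ^ k * y' ^ k') ^ K : End ℂ T) := by
    rw [Module.End.coe_pow]; exact hinj.iterate K
  exact hv0 (h7 (h6.trans (map_zero _).symm))

theorem commute_of_mem_adjoin {A : Type*} [Ring A] [Algebra ℂ A] {S : Set A}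
    (h : ∀ a ∈ S, ∀ b ∈ S, a * b = b * a) {a b : A} (ha : a ∈ Algebra.adjoin ℂ S)
    (hb : b ∈ Algebra.adjoin ℂ S) : a * b = b * a := by
  refine Algebra.commute_of_mem_adjoin_of_forall_mem_commute hb fun b hb => ?_
  exact (Algebra.commute_of_mem_adjoin_of_forall_mem_commute ha fun a ha => h b hb a ha).symm

theorem commutator_mem_adjoin {A : Type*} [Ring A] [Algebra ℂ A] {S : Set A} {X : A}
    (h : ∀ a ∈ S, X * a - a * X ∈ Algebra.adjoin ℂ S) {a : A} (ha : a ∈ Algebra.adjoin ℂ S) :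
    X * a - a * X ∈ Algebra.adjoin ℂ S := by
  induction ha using Algebra.adjoin_induction with
  | mem x hx => exact h x hx
  | algebraMap r => rw [Algebra.commutes r X, sub_self]; exact zero_mem _
  | add x y _ _ hx hy =>
    convert add_mem hx hy using 1
    noncomm_ring
  | mul x y hx' hy' hx hy =>
    convert add_mem (mul_mem hx hy') (mul_mem hx' hy) using 1
    noncomm_ring

variable {ν : ℕ} {𝔥 : Type*} {B : Type*}

/-- The algebra generated by the operators `H h n c`. -/
abbrev loopAlgebra (H : 𝔥 → Exponent ν → B → End ℂ T) : Subalgebra ℂ (End ℂ T) :=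
  Algebra.adjoin ℂ {s | ∃ h n c, s = H h n c}

theorem mem_loopAlgebra (H : 𝔥 → Exponent ν → B → End ℂ T) (h : 𝔥) (n : Exponent ν) (c : B) :
    H h n c ∈ loopAlgebra H := Algebra.subset_adjoin ⟨h, n, c, rfl⟩

variable [CommRing B]

/-- The exponent of the coordinate `t_l`. -/
abbrev basisExp (l : Fin (ν + 1)) : Exponent ν := Pi.single l 1

/-- Commuting operators `H h n c` (the action of `h ⊗ t^n ⊗ c`) together with operators `D m q b`
(the action of `t^m d_q ⊗ b`) that act irreducibly on a space with finite-dimensional pieces. -/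
structure LoopSystem (𝒯 : Exponent ν → Submodule ℂ T) (H : 𝔥 → Exponent ν → B → End ℂ T)
    (D : Exponent ν → Fin (ν + 1) → B → End ℂ T) (Λ : 𝔥 → ℂ) : Prop where
  comm : ∀ h m b h' n c, H h m b * H h' n c = H h' n c * H h m b
  der : ∀ m q b h n c, D m q b * H h n c - H h n c * D m q b = (n q : ℂ) • H h (m + n) (b * c)
  irr : ∀ W : Submodule ℂ T, W ≠ ⊥ → (∀ h n c, ∀ v ∈ W, H h n c v ∈ W) →
    (∀ m q b, ∀ v ∈ W, D m q b v ∈ W) → W = ⊤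
  fin : ∀ n, FiniteDimensional ℂ (𝒯 n)
  ne_bot : 𝒯 0 ≠ ⊥
  homog_H : ∀ h n c, IsHomog 𝒯 (H h n c) n
  homog_D : ∀ m q b, IsHomog 𝒯 (D m q b) m
  weight : ∀ h, H h 0 1 = Λ h • (1 : End ℂ T)

namespace LoopSystem

variable {𝒯 : Exponent ν → Submodule ℂ T} {H : 𝔥 → Exponent ν → B → End ℂ T}
  {D : Exponent ν → Fin (ν + 1) → B → End ℂ T} {Λ : 𝔥 → ℂ}

/-- Adjoining inverses preserves commutativity, and the identity [D, j] = -j [D, H] j keeps the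
enlarged algebra stable under the derivations. -/
theorem diffSystem (hH : LoopSystem 𝒯 H D Λ) {J : Set (End ℂ T)}
    (hJ : ∀ j ∈ J, ∃ h n c, j * H h n c = 1 ∧ H h n c * j = 1) :
    DiffSystem 𝒯 (Algebra.adjoin ℂ ({s | ∃ h n c, s = H h n c} ∪ J))
      {X | ∃ m q b, X = D m q b} where
  comm s hs t ht := by
    refine commute_of_mem_adjoin ?_ hs ht
    have h1 : ∀ j ∈ J, ∀ h n c, j * H h n c = H h n c * j := by
      intro j hj h n c
      obtain ⟨h', n', c', h1, h2⟩ := hJ j hj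
      calc j * H h n c = j * (H h n c * H h' n' c') * j := by
            rw [mul_assoc, mul_assoc, h2, mul_one]
        _ = H h n c * j := by rw [hH.comm, ← mul_assoc, h1, one_mul]
    rintro a (⟨h, n, c, rfl⟩ | ha) b (⟨h', n', c', rfl⟩ | hb)
    · exact hH.comm ..
    · exact (h1 b hb ..).symm
    · exact h1 a ha ..
    · obtain ⟨h', n', c', h3, h4⟩ := hJ b hb
      calc a * b = b * (H h' n' c' * a) * b := by rw [← mul_assoc b, h3, one_mul]
        _ = b * a := by rw [← h1 a ha, mul_assoc, mul_assoc, h4, mul_one]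
  der X hX s hs := by
    obtain ⟨m, q, b, rfl⟩ := hX
    have h1 : ∀ h n c, H h n c ∈ Algebra.adjoin ℂ ({s | ∃ h n c, s = H h n c} ∪ J) :=
      fun h n c => Algebra.subset_adjoin (Or.inl ⟨h, n, c, rfl⟩)
    refine commutator_mem_adjoin ?_ hs
    rintro a (⟨h, n, c, rfl⟩ | ha)
    · rw [hH.der]
      exact Subalgebra.smul_mem _ (h1 _ _ _) _
    · obtain ⟨h', n', c', h3, h4⟩ := hJ a ha
      have haJ : a ∈ Algebra.adjoin ℂ ({s | ∃ h n c, s = H h n c} ∪ J) :=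
        Algebra.subset_adjoin (Or.inr ha)
      have h5 : D m q b * a - a * D m q b = -(a * (D m q b * H h' n' c' - H h' n' c' * D m q b) * a)
        := by
        calc D m q b * a - a * D m q b
            = (a * H h' n' c') * D m q b * a - a * D m q b * (H h' n' c' * a) := by
              rw [h3, h4, one_mul, mul_one]
          _ = _ := by noncomm_ring
      rw [h5, hH.der]
      exact neg_mem (mul_mem (mul_mem haJ (Subalgebra.smul_mem _ (h1 _ _ _) _)) haJ)
  irr W hW hs hX := hH.irr W hW
    (fun h n c => hs _ (Algebra.subset_adjoin (Or.inl ⟨h, n, c, rfl⟩)))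
    (fun m q b => hX _ ⟨m, q, b, rfl⟩)
  fin := hH.fin

theorem diffSystem_loopAlgebra (hH : LoopSystem 𝒯 H D Λ) :
    DiffSystem 𝒯 (loopAlgebra H) {X | ∃ m q b, X = D m q b} := by
  have := hH.diffSystem (J := ∅) (by simp)
  rwa [Set.union_empty] at this

/-- Passes from a nonvanishing product at the exponent a e_l to invertibility at e_l itself. The
degree-zero element s^a s' acts on v by a scalar; if that scalar were 0, s would kill a nonzero
homogeneous vector, and derivations turning s into z and into the scalar Λ α would contradict
`not_injective`. -/
theorem exists_complement (hH : LoopSystem 𝒯 H D Λ) {α : 𝔥} (hα : Λ α ≠ 0) (l : Fin (ν + 1))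
    {v : T} (hv : v ∈ 𝒯 0) (hv0 : v ≠ 0)
    (heig : ∀ s ∈ loopAlgebra H, IsHomog 𝒯 s 0 → ∃ c : ℂ, s v = c • v)
    {a : ℕ} (ha : 0 < a) {s' : End ℂ T} (hs' : s' ∈ loopAlgebra H)
    (hdeg : IsHomog 𝒯 s' (-(a • basisExp l))) (hne : H α (a • basisExp l) 1 (s' v) ≠ 0) :
    ∃ r ∈ loopAlgebra H, IsHomog 𝒯 r (-basisExp l) ∧
      Function.Bijective (H α (basisExp l) 1 * r : End ℂ T) := by
  have hS := hH.diffSystem_loopAlgebra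
  set s := H α (basisExp l) 1 with hs_def
  set z := H α (a • basisExp l) 1 with hz_def
  have hs : s ∈ loopAlgebra H := mem_loopAlgebra H _ _ _
  have hz : z ∈ loopAlgebra H := mem_loopAlgebra H _ _ _
  have hsdeg : IsHomog 𝒯 s (basisExp l) := hH.homog_H _ _ _
  have hzs' : Function.Bijective (z * s' : End ℂ T) := by
    obtain ⟨c, hc⟩ := heig (z * s') (mul_mem hz hs') (by
      have := (hH.homog_H α (a • basisExp l) 1).mul hdeg
      rwa [add_neg_cancel] at this)
    refine hS.isUnit_of_apply_ne_zero (mul_mem hz hs') hv0 hc ?_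
    rintro rfl
    exact hne (by simpa using hc)
  have hz_inj : Function.Injective z := by
    rw [hS.comm z hz s' hs'] at hzs'
    exact Function.Injective.of_comp hzs'.1
  have hs'_inj : Function.Injective s' := Function.Injective.of_comp hzs'.1
  -- From here on the exponent of z is (a + 1) e_l.
  obtain ⟨a, rfl⟩ := Nat.exists_eq_succ_of_ne_zero ha.ne'
  have hmem : s ^ (a + 1) * s' ∈ loopAlgebra H := mul_mem (pow_mem hs _) hs'
  have hmemdeg : IsHomog 𝒯 (s ^ (a + 1) * s') 0 := by
    have := (hsdeg.pow (a + 1)).mul hdeg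
    rwa [add_neg_cancel] at this
  obtain ⟨c, hc⟩ := heig _ hmem hmemdeg
  by_cases hc0 : c = 0
  · exfalso
    subst hc0
    rw [zero_smul] at hc
    have hpow : (s ^ (a + 1)) v = 0 := by
      -- The injective factor s' can be cancelled, leaving a power of s that kills v.
      rw [hS.comm _ (pow_mem hs _) _ hs', Module.End.mul_apply] at hc
      exact hs'_inj (hc.trans (map_zero _).symm)
    classical
    have hex : ∃ i, (s ^ i) v = 0 := ⟨_, hpow⟩
    obtain ⟨i, hi⟩ : ∃ i, Nat.find hex = i + 1 := by
      refine Nat.exists_eq_succ_of_ne_zero fun h => ?_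
      have := Nat.find_spec hex
      rw [h] at this
      exact hv0 (by simpa using this)
    have hw0 : (s ^ i) v ≠ 0 := Nat.find_min hex (by omega)
    have hsw : s ((s ^ i) v) = 0 := by
      have := Nat.find_spec hex
      rwa [hi, pow_succ', Module.End.mul_apply] at this
    have hw : (s ^ i) v ∈ 𝒯 (0 + i • basisExp l) := hsdeg.pow i 0 v hv
    obtain ⟨K, hK⟩ := hS.exists_pow_apply_eq_zero hmem hv0 hc (0 + i • basisExp l)
    have hK' : ∀ w ∈ 𝒯 (0 + i • basisExp l), (s ^ ((a + 1) * K)) w = 0 := by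
      intro w hw
      have hcom : Commute (s ^ (a + 1)) s' := hS.comm _ (pow_mem hs _) _ hs'
      have h1 := hK w hw
      rw [hcom.mul_pow, ← pow_mul, (hcom.pow_left K |>.pow_right K |> fun h => by
        rwa [← pow_mul] at h : Commute (s ^ ((a + 1) * K)) (s' ^ K)).eq,
        Module.End.mul_apply] at h1
      have h2 : Function.Injective (s' ^ K : End ℂ T) := by
        rw [Module.End.coe_pow]; exact hs'_inj.iterate K
      exact h2 (h1.trans (map_zero _).symm)
    have hsm : ∀ m : Exponent ν, D m l 1 * s - s * D m l 1 = H α (m + basisExp l) 1 := by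
      intro m
      rw [hs_def, hH.der]
      simp
    -- The commutator of s with D at a e_l is z, and with D at -e_l it is Λ α. One use of the first
    -- and a uses of the second have total degree zero, and the product Λ(α)^a z is injective.
    refine hS.not_injective hs (X := D (a • basisExp l) l 1) (X' := D (-basisExp l) l 1)
      ⟨_, _, _, rfl⟩ ⟨_, _, _, rfl⟩ (hH.homog_D _ _ _) (hH.homog_D _ _ _) (k := 1) (k' := a)
      one_pos ?_ hw hw0 hsw hK' ?_
    · simp
    · rw [hsm, hsm, ← succ_nsmul, neg_add_cancel, hH.weight, pow_one, smul_pow, one_pow]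
      intro x y hxy
      simp only [Module.End.mul_apply, LinearMap.smul_apply, Module.End.one_apply, map_smul] at hxy
      exact hz_inj (smul_right_injective _ (pow_ne_zero _ hα) hxy)
  · refine ⟨s ^ a * s', mul_mem (pow_mem hs _) hs', ?_, ?_⟩
    · have := (hsdeg.pow a).mul hdeg
      convert this using 1
      rw [succ_nsmul]
      abel
    · rw [← mul_assoc, ← pow_succ']
      exact hS.isUnit_of_apply_ne_zero hmem hv0 hc hc0

/-- The point is homogeneity of the inverse: s r has degree zero and is injective, hence onto on
each finite-dimensional piece, so a homogeneous v equals s (r w) with w in the same piece, and s⁻¹ v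
= r w. -/
theorem exists_inverse (hH : LoopSystem 𝒯 H D Λ) {α : 𝔥} {l : Fin (ν + 1)} {r : End ℂ T}
    (hr : r ∈ loopAlgebra H) (hdeg : IsHomog 𝒯 r (-basisExp l))
    (hbij : Function.Bijective (H α (basisExp l) 1 * r : End ℂ T)) :
    ∃ j : End ℂ T, j * H α (basisExp l) 1 = 1 ∧ H α (basisExp l) 1 * j = 1 ∧
      IsHomog 𝒯 j (-basisExp l) := by
  have hS := hH.diffSystem_loopAlgebra
  set s := H α (basisExp l) 1 with hs_def
  have hs : s ∈ loopAlgebra H := mem_loopAlgebra H _ _ _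
  have hsb : Function.Bijective s := by
    refine ⟨?_, Function.Surjective.of_comp hbij.2⟩
    rw [hS.comm s hs r hr] at hbij
    exact Function.Injective.of_comp hbij.1
  let e := LinearEquiv.ofBijective s hsb
  refine ⟨e.symm.toLinearMap, ?_, ?_, ?_⟩
  · ext v; exact e.symm_apply_apply v
  · ext v; exact e.apply_symm_apply v
  · intro j v hv
    have := hH.fin j
    have hmap : ∀ w ∈ 𝒯 j, (s * r) w ∈ 𝒯 j := fun w hw => by
      have := (hH.homog_H α (basisExp l) 1).mul hdeg j w hw
      rwa [add_neg_cancel, add_zero] at this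
    have hsurj : Function.Surjective ((s * r).restrict hmap) := by
      refine LinearMap.surjective_of_injective fun x y hxy => ?_
      exact Subtype.ext (hbij.1 (congrArg Subtype.val hxy))
    obtain ⟨w, hw⟩ := hsurj ⟨v, hv⟩
    have hw' : v = s (r w) := (congrArg Subtype.val hw).symm
    have : e.symm v = r w := by
      rw [hw']; exact e.symm_apply_apply _
    change e.symm v ∈ _
    rw [this]
    exact hdeg j w w.2

end LoopSystem
end Loop
end MapToroidal
end

noncomputable section
namespace MapToroidal

/-! ### Logarithmic derivatives and the functional equation for eigenvalues -/

section Evaluation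

open Module (End)

/-- The logarithmic derivative u ↦ u⁻¹ δ(u) is a homomorphism from units to the additive group. -/
theorem derivation_prod_zpow {S ι : Type*} [CommRing S] [Fintype ι] (δ : Derivation ℤ S S)
    (P : ι → Sˣ) (n : ι → ℤ) :
    δ (∏ l, P l ^ n l : Sˣ) = (∏ l, P l ^ n l : Sˣ) * ∑ l, n l • (((P l)⁻¹ : Sˣ) * δ (P l)) := by
  let lam : Sˣ →* Multiplicative S :=
    { toFun := fun u => Multiplicative.ofAdd ((u⁻¹ : Sˣ) * δ u)
      map_one' := by simp
      map_mul' := fun u v => by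
        rw [← ofAdd_add]
        congr 1
        have hu : (u : S) * (u⁻¹ : Sˣ) = 1 := u.mul_inv
        have hv : (v : S) * (v⁻¹ : Sˣ) = 1 := v.mul_inv
        simp only [Units.val_mul, Derivation.leibniz, smul_eq_mul, mul_inv]
        linear_combination (δ v * (v⁻¹ : Sˣ)) * hu + (δ u * (u⁻¹ : Sˣ)) * hv }
  have h : ∀ u : Sˣ, δ u = u * (lam u).toAdd := fun u => by
    change δ u = u * (((u⁻¹ : Sˣ) : S) * δ u)
    rw [← mul_assoc, Units.mul_inv, one_mul]
  rw [h, map_prod, toAdd_prod]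
  congr 1
  refine Finset.sum_congr rfl fun l _ => ?_
  rw [map_zpow, toAdd_zpow]
  rfl

variable {ν : ℕ} {𝔥 : Type*} {B : Type*} [CommRing B]

/-- The equation is known only for shifts of one sign, and the sign may depend on the data. What
makes it usable is that two sets of data share a sign: for two base points on opposite sides,
whichever sign holds, one of them sees the points of interest. -/
theorem eval_eq_of_sign {N : ℂ} (hN : N ≠ 0) {ε : 𝔥 → Exponent ν → B → ℂ} {α : 𝔥}
    (hsign : ∀ (k : Fin (ν + 1)) (h₁ : 𝔥) (n₁ : Exponent ν) (c₁ : B) (h₂ : 𝔥) (n₂ : Exponent ν)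
      (c₂ : B),
      (∀ j : ℤ, 0 < j → ∀ b : B,
        (n₁ k ≠ 0 → N * ε h₁ (n₁ + j • basisExp k) (b * c₁)
          = ε h₁ n₁ c₁ * ε α (basisExp k + j • basisExp k) b) ∧
        (n₂ k ≠ 0 → N * ε h₂ (n₂ + j • basisExp k) (b * c₂)
          = ε h₂ n₂ c₂ * ε α (basisExp k + j • basisExp k) b)) ∨
      (∀ j : ℤ, j < 0 → ∀ b : B,
        (n₁ k ≠ 0 → N * ε h₁ (n₁ + j • basisExp k) (b * c₁)
          = ε h₁ n₁ c₁ * ε α (basisExp k + j • basisExp k) b) ∧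
        (n₂ k ≠ 0 → N * ε h₂ (n₂ + j • basisExp k) (b * c₂)
          = ε h₂ n₂ c₂ * ε α (basisExp k + j • basisExp k) b)))
    (hzero : ε α 0 1 = N) (hone : ∀ k, ε α (basisExp k) 1 = N) :
    (∀ h n c, ε h n c = ε h 0 c) ∧ ∀ h b c, N * ε h 0 (b * c) = ε h 0 c * ε α 0 b := by
  -- The sequence L j = ε α (j e_k) 1 starts with L 0 = L 1 = N. The pair of base points 2, -1 gives
  -- L 2 = N and then one half-line; a pair ±y gives the rest.
  have hL : ∀ (k : Fin (ν + 1)) (j : ℤ), ε α (j • basisExp k) 1 = N := by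
    intro k
    set L : ℤ → ℂ := fun j => ε α (j • basisExp k) 1 with hLdef
    have hL0 : L 0 = N := by simpa [hLdef] using hzero
    have hL1 : L 1 = N := by simpa [hLdef] using hone k
    have hs : ∀ x y : ℤ, x ≠ 0 → y ≠ 0 →
        (∀ j : ℤ, 0 < j → N * L (x + j) = L x * L (1 + j) ∧ N * L (y + j) = L y * L (1 + j)) ∨
        (∀ j : ℤ, j < 0 → N * L (x + j) = L x * L (1 + j) ∧ N * L (y + j) = L y * L (1 + j)) := by
      intro x y hx hy
      have hx' : (x • basisExp k : Exponent ν) k ≠ 0 := by simpa using hx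
      have hy' : (y • basisExp k : Exponent ν) k ≠ 0 := by simpa using hy
      refine (hsign k α (x • basisExp k) 1 α (y • basisExp k) 1).imp ?_ ?_ <;>
      · intro h j hj
        obtain ⟨h1, h2⟩ := h j hj 1
        have h1 := h1 hx'
        have h2 := h2 hy'
        simp only [mul_one, ← add_smul] at h1 h2
        simp only [hLdef, add_smul, one_smul] at h1 h2 ⊢
        exact ⟨h1, h2⟩
    have hL2 : L 2 = N := by
      rcases hs 2 (-1) (by norm_num) (by norm_num) with h | h
      · have e1 := (h 1 one_pos).2
        have e2 := (h 2 two_pos).2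
        have e3 := (h 1 one_pos).1
        norm_num at e1 e2 e3
        rw [hL0] at e1
        rw [hL1] at e2
        have hm : L (-1) ≠ 0 := by
          intro h0; rw [h0, zero_mul] at e1; exact mul_ne_zero hN hN e1
        have h23 : L 2 = L 3 := mul_left_cancel₀ hm (e1.symm.trans e2)
        have h2 : L 2 ≠ 0 := by
          intro h0; rw [h0, mul_zero] at e1; exact mul_ne_zero hN hN e1
        rw [← h23] at e3
        exact (mul_right_cancel₀ h2 e3).symm
      · have e1 := (h (-1) (by norm_num)).1
        norm_num at e1
        rw [hL0, hL1] at e1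
        exact (mul_right_cancel₀ hN e1).symm
    have hL3 : (∀ j : ℤ, -1 ≤ j → L j = N) ∨ (∀ j : ℤ, j ≤ 1 → L j = N) := by
      refine (hs 2 (-1) (by norm_num) (by norm_num)).imp (fun h => ?_) (fun h => ?_)
      · have hm : L (-1) = N := by
          have e1 := (h 1 one_pos).2
          norm_num at e1
          rw [hL0, hL2] at e1
          exact (mul_right_cancel₀ hN e1).symm
        have hp : ∀ m : ℕ, L (1 + m) = N := by
          intro m
          induction m with
          | zero => simpa using hL1
          | succ m ih =>
            rcases Nat.eq_zero_or_pos m with rfl | hm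
            · simpa using hL2
            have e1 := (h m (by exact_mod_cast hm)).1
            rw [hL2, ih, show (2 : ℤ) + m = 1 + (m + 1 : ℕ) by push_cast; ring] at e1
            exact mul_left_cancel₀ hN e1
        intro j hj
        rcases eq_or_lt_of_le hj with rfl | hj
        · exact hm
        rcases eq_or_lt_of_le (Int.add_one_le_of_lt hj) with rfl | hj
        · simpa using hL0
        have := hp (j - 1).toNat
        rwa [Int.toNat_of_nonneg (by omega), add_sub_cancel] at this
      · have hp : ∀ m : ℕ, L (1 - m) = N := by
          intro m
          induction m with
          | zero => simpa using hL1
          | succ m ih =>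
            have e1 := (h (-(m + 1)) (by omega)).1
            rw [hL2, show (2 : ℤ) + -(m + 1) = 1 - m by ring, ih,
              show (1 : ℤ) + -(m + 1) = 1 - (m + 1 : ℕ) by push_cast; ring] at e1
            exact (mul_left_cancel₀ hN e1).symm
        intro j hj
        have := hp (1 - j).toNat
        rwa [Int.toNat_of_nonneg (by omega), sub_sub_cancel] at this
    intro j
    change L j = N
    rcases hL3 with h3 | h3
    · by_cases hj : -1 ≤ j
      · exact h3 j hj
      obtain ⟨y, rfl⟩ : ∃ y, j = -y := ⟨-j, by ring⟩
      rcases hs (-y) y (by omega) (by omega) with h | h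
      · have e := (h y (by omega)).1
        rw [neg_add_cancel, hL0, h3 (1 + y) (by omega)] at e
        exact (mul_right_cancel₀ hN e).symm
      · have e := (h (-y - 1) (by omega)).2
        rw [h3 y (by omega), show y + (-y - 1) = -1 by ring, h3 (-1) le_rfl,
          show 1 + (-y - 1) = -y by ring] at e
        exact (mul_left_cancel₀ hN e).symm
    · by_cases hj : j ≤ 1
      · exact h3 j hj
      rcases hs (-j) j (by omega) (by omega) with h | h
      · have e := (h (j - 1) (by omega)).1
        rw [h3 (-j) (by omega), show -j + (j - 1) = -1 by ring, h3 (-1) (by norm_num),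
          add_sub_cancel] at e
        exact (mul_left_cancel₀ hN e).symm
      · have e := (h (-j) (by omega)).2
        rw [add_neg_cancel, hL0, h3 (1 + -j) (by omega)] at e
        exact (mul_right_cancel₀ hN e).symm
  have hshift : ∀ (h : 𝔥) (n : Exponent ν) (c : B) (k : Fin (ν + 1)) (x : ℤ),
      ε h (n + x • basisExp k) c = ε h n c := by
    intro h n c k x
    set g : ℤ → ℂ := fun y => ε h (n + y • basisExp k) c with hg
    -- X is so large that n ± X e_k have nonzero k-th coordinate and that both 0 and x lie strictly
    -- between -X and X.
    set X : ℤ := |n k| + |x| + 1 with hX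
    have hXpos : 0 < X := by positivity
    have hx1 := le_abs_self x
    have hx2 := neg_abs_le x
    have hn1 := le_abs_self (n k)
    have hn2 := neg_abs_le (n k)
    have hx0 := abs_nonneg x
    have hn0 := abs_nonneg (n k)
    have hval : ∀ y : ℤ, (n + y • basisExp k) k = n k + y := by simp
    have hgx : g x = g 0 := by
      rcases hsign k h (n + X • basisExp k) c h (n + (-X) • basisExp k) c with h1 | h1
      · have e : ∀ j : ℤ, 0 < j → g (-X + j) = g (-X) := by
          intro j hj
          have h2 := (h1 j hj 1).2 (by rw [hval]; omega)
          rw [show (basisExp k + j • basisExp k : Exponent ν) = (1 + j) • basisExp k by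
            rw [add_smul, one_smul], hL, one_mul, add_assoc, ← add_smul, mul_comm] at h2
          exact mul_right_cancel₀ hN h2
        have e1 := e (X + x) (by omega)
        have e2 := e X (by omega)
        rw [neg_add_cancel_left] at e1
        rw [neg_add_cancel] at e2
        rw [e1, e2]
      · have e : ∀ j : ℤ, j < 0 → g (X + j) = g X := by
          intro j hj
          have h2 := (h1 j hj 1).1 (by rw [hval]; omega)
          rw [show (basisExp k + j • basisExp k : Exponent ν) = (1 + j) • basisExp k by
            rw [add_smul, one_smul], hL, one_mul, add_assoc, ← add_smul, mul_comm] at h2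
          exact mul_right_cancel₀ hN h2
        have e1 := e (-X + x) (by omega)
        have e2 := e (-X) (by omega)
        rw [add_neg_cancel_left] at e1
        rw [add_neg_cancel] at e2
        rw [e1, e2]
    simpa [hg] using hgx
  have hconst : ∀ h n c, ε h n c = ε h 0 c := by
    intro h n c
    have : ∀ F : Finset (Fin (ν + 1)), ε h (∑ k ∈ F, n k • basisExp k) c = ε h 0 c := by
      intro F
      induction F using Finset.induction_on with
      | empty => simp
      | insert k F hk ih => rw [Finset.sum_insert hk, add_comm, hshift, ih]
    have h2 := this Finset.univ
    rwa [show ∑ k, n k • basisExp k = n by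
      ext i; simp [Finset.sum_apply, Pi.single_apply]] at h2
  refine ⟨hconst, fun h b c => ?_⟩
  have h1 : ∀ j : ℤ, N * ε h (basisExp 0 + j • basisExp 0) (b * c)
      = ε h (basisExp 0) c * ε α (basisExp 0 + j • basisExp 0) b →
      N * ε h 0 (b * c) = ε h 0 c * ε α 0 b := by
    intro j hj
    rwa [hconst h, hconst h (basisExp 0), hconst α] at hj
  rcases hsign 0 h (basisExp 0) c h (basisExp 0) c with h2 | h2
  · exact h1 1 ((h2 1 one_pos b).1 (by simp))
  · exact h1 (-1) ((h2 (-1) (by norm_num) b).1 (by simp))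

end Evaluation
end MapToroidal
end

noncomputable section
namespace MapToroidal

/-! ### Evaluation at a common eigenvector and the product formula -/

section Product

open Module (End)

variable {T : Type*} [AddCommGroup T] [Module ℂ T]

/-- A commutative subalgebra as a commutative ring. -/
abbrev commRingOfComm {A : Type*} [Ring A] [Algebra ℂ A] (𝒮 : Subalgebra ℂ A)
    (h : ∀ s ∈ 𝒮, ∀ t ∈ 𝒮, s * t = t * s) : CommRing 𝒮 :=
  { (inferInstance : Ring 𝒮) with mul_comm := fun s t => Subtype.ext (h s s.2 t t.2) }

/-- The commutator with an operator normalising a commutative subalgebra. -/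
def commutatorDerivation {A : Type*} [Ring A] [Algebra ℂ A] (𝒮 : Subalgebra ℂ A)
    (h : ∀ s ∈ 𝒮, ∀ t ∈ 𝒮, s * t = t * s) (X : A) (hX : ∀ s ∈ 𝒮, X * s - s * X ∈ 𝒮) :
    letI := commRingOfComm 𝒮 h
    Derivation ℤ 𝒮 𝒮 :=
  letI := commRingOfComm 𝒮 h
  Derivation.mk' (AddMonoidHom.toIntLinearMap
    { toFun := fun s => ⟨X * s - s * X, hX s s.2⟩
      map_zero' := by ext; simp
      map_add' := fun s t => by ext; simp [mul_add, add_mul]; abel })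
    (fun s t => by
      have h1 := h _ (hX s s.2) t t.2
      ext
      simp only [AddMonoidHom.coe_toIntLinearMap, AddMonoidHom.coe_mk, ZeroHom.coe_mk, smul_eq_mul,
        Subalgebra.coe_mul, Subalgebra.coe_add]
      rw [← h1]
      noncomm_ring)

namespace LoopSystem

variable {ν : ℕ} {𝔥 : Type*} {B : Type*} [CommRing B]
  {𝒯 : Exponent ν → Submodule ℂ T} {H : 𝔥 → Exponent ν → B → End ℂ T}
  {D : Exponent ν → Fin (ν + 1) → B → End ℂ T} {Λ : 𝔥 → ℂ}

/-- Merges two defects into a single operator whose derivatives are nonzero in both directions. -/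
theorem exists_linear_combination_ne_zero {a₁ a₂ b₁ b₂ : ℂ} (ha : a₁ ≠ 0 ∨ a₂ ≠ 0)
    (hb : b₁ ≠ 0 ∨ b₂ ≠ 0) : ∃ x y : ℂ, x * a₁ + y * a₂ ≠ 0 ∧ x * b₁ + y * b₂ ≠ 0 := by
  by_cases e1 : a₁ ≠ 0 ∧ b₁ ≠ 0
  · exact ⟨1, 0, by simpa using e1⟩
  by_cases e2 : a₂ ≠ 0 ∧ b₂ ≠ 0
  · exact ⟨0, 1, by simpa using e2⟩
  refine ⟨1, 1, ?_⟩
  rw [one_mul, one_mul, one_mul, one_mul]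
  grind

set_option maxHeartbeats 1000000 in
-- With the coordinate loops inverted, each loop operator is compared with a monomial U^n of the
-- same degree; the quotient has degree zero and so has an eigenvalue ε on v. Differentiating
-- quotient minus eigenvalue measures the failure of the functional equation, and `not_injective`
-- forbids failures in both directions.
theorem exists_evaluation (hH : LoopSystem 𝒯 H D Λ) {α : 𝔥} (hα : Λ α ≠ 0)
    {J : Fin (ν + 1) → End ℂ T} (hJ₁ : ∀ l, J l * H α (basisExp l) 1 = 1)
    (hJ₂ : ∀ l, H α (basisExp l) 1 * J l = 1) (hJ : ∀ l, IsHomog 𝒯 (J l) (-basisExp l)) :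
    ∃ (v : T) (U : Exponent ν → End ℂ T) (ε : 𝔥 → Exponent ν → B → ℂ), v ≠ 0 ∧
      (∀ h n c, H h n c v = ε h n c • U n v) ∧ (∀ m n, U (m + n) = U m * U n) ∧
      (∀ h n c m, H h n c * U m = U m * H h n c) ∧ (∀ h, ε h 0 1 = Λ h) ∧
      (∀ h n c, ε h n c = ε h 0 c) ∧ ∀ h b c, Λ α * ε h 0 (b * c) = ε h 0 c * ε α 0 b := by
  set N := Λ α with hN
  set 𝒮 := Algebra.adjoin ℂ ({s | ∃ h n c, s = H h n c} ∪ Set.range J) with h𝒮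
  have hS : DiffSystem 𝒯 𝒮 {X | ∃ m q b, X = D m q b} := hH.diffSystem (by
    rintro _ ⟨l, rfl⟩
    exact ⟨α, basisExp l, 1, hJ₁ l, hJ₂ l⟩)
  let _ : CommRing 𝒮 := commRingOfComm 𝒮 hS.comm
  have hHmem : ∀ h n c, H h n c ∈ 𝒮 := fun h n c => Algebra.subset_adjoin (Or.inl ⟨h, n, c, rfl⟩)
  have hJmem : ∀ l, J l ∈ 𝒮 := fun l => Algebra.subset_adjoin (Or.inr ⟨l, rfl⟩)
  -- Dividing by N gives ε α e_l 1 = N, the same value as at exponent 0.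
  let P : Fin (ν + 1) → 𝒮ˣ := fun l =>
    ⟨⟨N⁻¹ • H α (basisExp l) 1, 𝒮.smul_mem (hHmem _ _ _) _⟩, ⟨N • J l, 𝒮.smul_mem (hJmem l) _⟩,
      Subtype.ext (by simp [hJ₂, smul_smul, hα]), Subtype.ext (by simp [hJ₁, smul_smul, hα])⟩
  let U : Exponent ν → 𝒮ˣ := fun n => ∏ l, P l ^ n l
  have hUadd : ∀ m n, U (m + n) = U m * U n := fun m n => by
    simp [U, zpow_add, Finset.prod_mul_distrib]
  have hU0 : U 0 = 1 := by simp [U]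
  have hUneg : ∀ n, U n * U (-n) = 1 := fun n => by rw [← hUadd, add_neg_cancel, hU0]
  have hUneg' : ∀ n, ((U n : 𝒮ˣ) : 𝒮) * (U (-n) : 𝒮ˣ) = 1 := fun n => by
    rw [← Units.val_mul, hUneg, Units.val_one]
  have hUnsmul : ∀ (k : ℕ) n, U (k • n) = U n ^ k := fun k n => by
    induction k with
    | zero => simpa using hU0
    | succ k ih => rw [succ_nsmul, hUadd, ih, pow_succ]
  have hUbasis : ∀ l, U (basisExp l) = P l := fun l => by
    simp only [U]
    rw [Finset.prod_eq_single l]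
    · simp
    · intro b _ hb; simp [hb]
    · simp
  have hUhom : ∀ n, IsHomog 𝒯 ((U n : 𝒮) : End ℂ T) n := by
    have hz : ∀ l (z : ℤ), IsHomog 𝒯 (((P l ^ z : 𝒮ˣ) : 𝒮) : End ℂ T) (z • basisExp l) := by
      intro l z
      cases z with
      | ofNat k =>
        have := ((hH.homog_H α (basisExp l) 1).smul N⁻¹).pow k
        simpa [P] using this
      | negSucc k =>
        have := ((hJ l).smul N).pow (k + 1)
        rw [zpow_negSucc, ← inv_pow, negSucc_zsmul, ← smul_neg]
        simpa [P] using this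
    have hF : ∀ (F : Finset (Fin (ν + 1))) (n : Exponent ν),
        IsHomog 𝒯 (((∏ l ∈ F, P l ^ n l : 𝒮ˣ) : 𝒮) : End ℂ T) (∑ l ∈ F, n l • basisExp l) := by
      intro F n
      induction F using Finset.induction_on with
      | empty => simpa using IsHomog.one
      | insert l F hl ih =>
        rw [Finset.prod_insert hl, Finset.sum_insert hl]
        simpa using (hz l (n l)).mul ih
    intro n
    have := hF Finset.univ n
    rwa [show ∑ k, n k • basisExp k = n by
      ext i; simp [Finset.sum_apply, Pi.single_apply]] at this
  obtain ⟨v, hv, hv0, heig⟩ := hS.exists_eigenvector hH.ne_bot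
  let Hs : 𝔥 → Exponent ν → B → 𝒮 := fun h n c => ⟨H h n c, hHmem h n c⟩
  have hE : ∀ h n c, ∃ e : ℂ, ((Hs h n c * U (-n) : 𝒮) : End ℂ T) v = e • v := by
    intro h n c
    refine heig _ (Subtype.mem _) ?_
    have := (hH.homog_H h n c).mul (hUhom (-n))
    rwa [add_neg_cancel] at this
  choose ε hε using hE
  have hεval : ∀ h n c, H h n c v = ε h n c • ((U n : 𝒮) : End ℂ T) v := by
    intro h n c
    have h1 : Hs h n c = U n * (Hs h n c * U (-n)) := by
      linear_combination -(Hs h n c) * hUneg' n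
    have h2 := LinearMap.congr_fun (congrArg Subtype.val h1) v
    rw [Subalgebra.coe_mul, Module.End.mul_apply, hε, map_smul] at h2
    exact h2
  have hEunique : ∀ {a b : ℂ}, a • v = b • v → a = b := fun h => smul_left_injective ℂ hv0 h
  have hε01 : ∀ h, ε h 0 1 = Λ h := by
    intro h
    apply hEunique
    rw [← hε]
    have : ((Hs h 0 1 * U (-0) : 𝒮) : End ℂ T) = Λ h • (1 : End ℂ T) := by
      rw [neg_zero, hU0, Units.val_one, mul_one]
      exact hH.weight h
    rw [this]; simp
  have hεb : ∀ k, ε α (basisExp k) 1 = N := by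
    intro k
    apply hEunique
    rw [← hε]
    have h1 : Hs α (basisExp k) 1 = N • ((P k : 𝒮ˣ) : 𝒮) := by
      ext1
      simp [P, Hs, smul_smul, hα]
    rw [h1, ← hUbasis, smul_mul_assoc, hUneg']
    simp
  let δ : Exponent ν → Fin (ν + 1) → B → Derivation ℤ 𝒮 𝒮 := fun m q b =>
    commutatorDerivation 𝒮 hS.comm (D m q b) (hS.der _ ⟨m, q, b, rfl⟩)
  have hδ : ∀ m q b (s : 𝒮), ((δ m q b s : 𝒮) : End ℂ T) = D m q b * s - s * D m q b :=
    fun m q b s => rfl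
  have hδH : ∀ m q b h n c, δ m q b (Hs h n c) = (n q : ℂ) • Hs h (m + n) (b * c) := by
    intro m q b h n c
    ext1
    rw [hδ]
    exact hH.der ..
  have hδP : ∀ m q b l, δ m q b (P l) = if l = q then N⁻¹ • Hs α (m + basisExp l) b else 0 := by
    intro m q b l
    have h1 : ((P l : 𝒮ˣ) : 𝒮) = N⁻¹ • Hs α (basisExp l) 1 := rfl
    ext1
    rw [hδ, h1, Subalgebra.coe_smul, mul_smul_comm, smul_mul_assoc, ← smul_sub]
    change N⁻¹ • (D m q b * H α (basisExp l) 1 - H α (basisExp l) 1 * D m q b) = _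
    rw [hH.der]
    by_cases hlq : l = q
    · subst hlq
      simp [Hs]
    · simp [hlq, Ne.symm hlq]
  have hδU : ∀ m q b n, δ m q b (U n)
      = U n * ((n q : ℂ) • ((U (-basisExp q) : 𝒮ˣ) * N⁻¹ • Hs α (m + basisExp q) b)) := by
    intro m q b n
    rw [derivation_prod_zpow]
    congr 1
    rw [Finset.sum_eq_single q]
    · rw [hδP, if_pos rfl, ← Int.cast_smul_eq_zsmul ℂ]
      congr 3
      rw [← hUbasis, inv_eq_iff_mul_eq_one, hUneg]
    · intro l _ hl
      rw [hδP, if_neg hl, mul_zero, smul_zero]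
    · simp
  -- The shifts j e_k and -j' e_k, used j' and j times, cancel in degree. If both derivatives of s
  -- had nonzero eigenvalue on v after removal of their degree by U, the product of their powers
  -- would be injective.
  have hno : ∀ (k : Fin (ν + 1)) (j j' : ℕ), 0 < j → 0 < j' → ∀ (b b' : B) (s : 𝒮),
      (s : End ℂ T) v = 0 → IsHomog 𝒯 (s : End ℂ T) 0 → ∀ A A' : ℂ,
      ((δ (j • basisExp k) k b s * U (-(j • basisExp k)) : 𝒮) : End ℂ T) v = A • v →
      ((δ (-(j' • basisExp k)) k b' s * U (j' • basisExp k) : 𝒮) : End ℂ T) v = A' • v →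
      A ≠ 0 → A' ≠ 0 → False := by
    intro k j j' hj hj' b b' s hs hs0 A A' hA hA' hA0 hA0'
    obtain ⟨K, hK⟩ := hS.exists_pow_apply_eq_zero s.2 hv0 hs 0
    refine hS.not_injective s.2 (X := D (j • basisExp k) k b) (X' := D (-(j' • basisExp k)) k b')
      ⟨_, _, _, rfl⟩ ⟨_, _, _, rfl⟩ (hH.homog_D _ _ _) (hH.homog_D _ _ _) (k := j') (k' := j) hj'
      (by rw [smul_neg, smul_smul, smul_smul, mul_comm, add_neg_cancel]) hv hv0 hs hK ?_
    set y := δ (j • basisExp k) k b s with hy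
    set y' := δ (-(j' • basisExp k)) k b' s with hy'
    change Function.Injective (((y ^ j' * y' ^ j : 𝒮)) : End ℂ T)
    have h1 : y ^ j' * y' ^ j
        = (y * U (-(j • basisExp k))) ^ j' * (y' * U (j' • basisExp k)) ^ j := by
      have h2 : ((U (-(j • basisExp k)) : 𝒮ˣ) : 𝒮) ^ j' * (U (j' • basisExp k) : 𝒮ˣ) ^ j = 1 := by
        rw [← Units.val_pow_eq_pow_val, ← Units.val_pow_eq_pow_val, ← Units.val_mul, ← hUnsmul,
          ← hUnsmul, ← hUadd, smul_neg, smul_smul, smul_smul, mul_comm, neg_add_cancel, hU0,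
          Units.val_one]
      rw [mul_pow, mul_pow]
      linear_combination -(y ^ j' * y' ^ j) * h2
    have hpow : ∀ (t : 𝒮) (a : ℂ) (i : ℕ), (t : End ℂ T) v = a • v →
        ((t ^ i : 𝒮) : End ℂ T) v = a ^ i • v := by
      intro t a i ht
      induction i with
      | zero => simp
      | succ i ih =>
        rw [pow_succ', Subalgebra.coe_mul, Module.End.mul_apply, ih, map_smul, ht, smul_smul,
          pow_succ]
    refine (hS.isUnit_of_apply_ne_zero (Subtype.mem _) hv0 (c := A ^ j' * A' ^ j) ?_
      (mul_ne_zero (pow_ne_zero _ hA0) (pow_ne_zero _ hA0'))).1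
    rw [h1, Subalgebra.coe_mul, Module.End.mul_apply, hpow _ _ _ hA', map_smul, hpow _ _ _ hA,
      smul_smul, mul_comm]
  let r : 𝔥 → Exponent ν → B → 𝒮 := fun h n c => Hs h n c * U (-n) - ε h n c • (1 : 𝒮)
  have hr : ∀ h n c, (r h n c : End ℂ T) v = 0 := by
    intro h n c
    have : (r h n c : End ℂ T) = ((Hs h n c * U (-n) : 𝒮) : End ℂ T) - ε h n c • 1 := rfl
    rw [this, LinearMap.sub_apply, hε]
    simp
  have hr0 : ∀ h n c, IsHomog 𝒯 (r h n c : End ℂ T) 0 := by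
    intro h n c
    have h1 := (hH.homog_H h n c).mul (hUhom (-n))
    rw [add_neg_cancel] at h1
    exact h1.sub (IsHomog.one.smul _)
  -- Quotient rule: differentiating the loop operator gives ε at n + m, and differentiating U^(-n)
  -- gives the product of eigenvalues, because U has logarithmic derivative N⁻¹ H α (m + e_k) b
  -- U^(-e_k) times its exponent.
  have hδr : ∀ (k : Fin (ν + 1)) (m : Exponent ν) (b : B) h n c,
      ((δ m k b (r h n c) * U (-m) : 𝒮) : End ℂ T) v
        = ((n k : ℂ) * (ε h (n + m) (b * c) - N⁻¹ * (ε h n c * ε α (basisExp k + m) b))) • v := by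
    intro k m b h n c
    have h1 : δ m k b (ε h n c • (1 : 𝒮)) = 0 := by
      ext1
      rw [hδ]
      simp
    have h2 : δ m k b (r h n c) * U (-m)
        = (n k : ℂ) • (Hs h (n + m) (b * c) * U (-(n + m)))
          - (n k : ℂ) • N⁻¹ • ((Hs h n c * U (-n))
            * (Hs α (basisExp k + m) b * U (-(basisExp k + m)))) := by
      have e1 : ((U (-(n + m)) : 𝒮ˣ) : 𝒮) = U (-n) * U (-m) := by
        rw [neg_add, hUadd, Units.val_mul]
      have e2 : ((U (-(basisExp k + m)) : 𝒮ˣ) : 𝒮) = U (-basisExp k) * U (-m) := by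
        rw [neg_add, hUadd, Units.val_mul]
      simp only [r, map_sub, h1, sub_zero, Derivation.leibniz, hδH, hδU, smul_eq_mul, e1, e2,
        add_comm m, Pi.neg_apply, Int.cast_neg, neg_smul, mul_smul_comm]
      have e3 : Hs h n c * ((U (-n) : 𝒮) * -((n k : ℂ) • N⁻¹ • ((U (-basisExp k) : 𝒮)
          * Hs α (basisExp k + m) b))) = -((n k : ℂ) • N⁻¹ • (Hs h n c * (U (-n) : 𝒮)
            * ((U (-basisExp k) : 𝒮) * Hs α (basisExp k + m) b))) := by
        rw [mul_neg, mul_neg, mul_smul_comm, mul_smul_comm, mul_smul_comm, mul_smul_comm, mul_assoc]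
      rw [e3, add_mul, neg_mul, smul_mul_assoc, smul_mul_assoc, smul_mul_assoc, add_comm,
        ← sub_eq_add_neg]
      congr 2
      · ring
      · congr 1
        ring
    rw [h2]
    have h3 : ((((n k : ℂ) • (Hs h (n + m) (b * c) * U (-(n + m)))
          - (n k : ℂ) • N⁻¹ • ((Hs h n c * U (-n))
            * (Hs α (basisExp k + m) b * U (-(basisExp k + m)))) : 𝒮)) : End ℂ T) v
        = (n k : ℂ) • ((Hs h (n + m) (b * c) * U (-(n + m)) : 𝒮) : End ℂ T) v
          - (n k : ℂ) • N⁻¹ • ((Hs h n c * U (-n) : 𝒮) : End ℂ T)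
            (((Hs α (basisExp k + m) b * U (-(basisExp k + m)) : 𝒮) : End ℂ T) v) := rfl
    rw [h3, hε, hε, map_smul, hε]
    simp only [smul_smul, ← sub_smul]
    congr 1
    ring
  have hsign : ∀ (k : Fin (ν + 1)) (h₁ : 𝔥) (n₁ : Exponent ν) (c₁ : B) (h₂ : 𝔥) (n₂ : Exponent ν)
      (c₂ : B),
      (∀ j : ℤ, 0 < j → ∀ b : B,
        (n₁ k ≠ 0 → N * ε h₁ (n₁ + j • basisExp k) (b * c₁)
          = ε h₁ n₁ c₁ * ε α (basisExp k + j • basisExp k) b) ∧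
        (n₂ k ≠ 0 → N * ε h₂ (n₂ + j • basisExp k) (b * c₂)
          = ε h₂ n₂ c₂ * ε α (basisExp k + j • basisExp k) b)) ∨
      (∀ j : ℤ, j < 0 → ∀ b : B,
        (n₁ k ≠ 0 → N * ε h₁ (n₁ + j • basisExp k) (b * c₁)
          = ε h₁ n₁ c₁ * ε α (basisExp k + j • basisExp k) b) ∧
        (n₂ k ≠ 0 → N * ε h₂ (n₂ + j • basisExp k) (b * c₂)
          = ε h₂ n₂ c₂ * ε α (basisExp k + j • basisExp k) b)) := by
    intro k h₁ n₁ c₁ h₂ n₂ c₂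
    let F : 𝔥 → Exponent ν → B → Exponent ν → B → ℂ := fun h n c m b =>
      (n k : ℂ) * (ε h (n + m) (b * c) - N⁻¹ * (ε h n c * ε α (basisExp k + m) b))
    have hF : ∀ h n c m b, F h n c m b = 0 → n k ≠ 0 →
        N * ε h (n + m) (b * c) = ε h n c * ε α (basisExp k + m) b := by
      intro h n c m b h0 hn
      have h1 := (mul_eq_zero.1 h0).resolve_left (by exact_mod_cast hn)
      rw [sub_eq_zero] at h1
      rw [h1, ← mul_assoc, mul_inv_cancel₀ hα, one_mul]
    -- Failure for one positive shift and one negative shift, possibly at different data, yields one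
    -- combination of the two defects whose derivative is nonzero at both shifts.
    by_contra hcon
    push Not at hcon
    obtain ⟨⟨j, hj, b, hfail⟩, j', hj', b', hfail'⟩ := hcon
    have hA : F h₁ n₁ c₁ (j • basisExp k) b ≠ 0 ∨ F h₂ n₂ c₂ (j • basisExp k) b ≠ 0 := by
      by_contra! h0
      obtain ⟨hx, hy⟩ := hfail (hF _ _ _ _ _ h0.1)
      exact hy (hF _ _ _ _ _ h0.2 hx)
    have hA' : F h₁ n₁ c₁ (j' • basisExp k) b' ≠ 0 ∨ F h₂ n₂ c₂ (j' • basisExp k) b' ≠ 0 := by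
      by_contra! h0
      obtain ⟨hx, hy⟩ := hfail' (hF _ _ _ _ _ h0.1)
      exact hy (hF _ _ _ _ _ h0.2 hx)
    obtain ⟨x, y, hxy, hxy'⟩ : ∃ x y : ℂ,
        x * F h₁ n₁ c₁ (j • basisExp k) b + y * F h₂ n₂ c₂ (j • basisExp k) b ≠ 0 ∧
        x * F h₁ n₁ c₁ (j' • basisExp k) b' + y * F h₂ n₂ c₂ (j' • basisExp k) b' ≠ 0 :=
      exists_linear_combination_ne_zero hA hA'
    obtain ⟨i, rfl⟩ := Int.eq_ofNat_of_zero_le hj.le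
    obtain ⟨i', rfl⟩ := Int.exists_eq_neg_ofNat hj'.le
    have hlin : ∀ (m : Exponent ν) (b : B),
        ((δ m k b (x • r h₁ n₁ c₁ + y • r h₂ n₂ c₂) * U (-m) : 𝒮) : End ℂ T) v
          = (x * F h₁ n₁ c₁ m b + y * F h₂ n₂ c₂ m b) • v := by
      intro m b
      have hsm : ∀ (x : ℂ) (s : 𝒮), δ m k b (x • s) = x • δ m k b s := by
        intro x s
        ext1
        rw [Subalgebra.coe_smul, hδ, hδ, Subalgebra.coe_smul, mul_smul_comm, smul_mul_assoc,
          smul_sub]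
      rw [map_add, hsm, hsm, add_mul, smul_mul_assoc, smul_mul_assoc, Subalgebra.coe_add,
        Subalgebra.coe_smul, Subalgebra.coe_smul, LinearMap.add_apply, LinearMap.smul_apply,
        LinearMap.smul_apply, hδr, hδr, smul_smul, smul_smul, ← add_smul]
    refine hno k i i' (by omega) (by omega) b b' (x • r h₁ n₁ c₁ + y • r h₂ n₂ c₂) ?_ ?_ _ _
      (hlin _ _) ?_ (by simpa using hxy) hxy'
    · rw [Subalgebra.coe_add, Subalgebra.coe_smul, Subalgebra.coe_smul, LinearMap.add_apply,
        LinearMap.smul_apply, LinearMap.smul_apply, hr, hr]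
      simp
    · exact ((hr0 _ _ _).smul x).add ((hr0 _ _ _).smul y)
    · have := hlin (-(i' • basisExp k)) b'
      rw [neg_neg] at this
      rw [this]
      simp
  obtain ⟨hc1, hc2⟩ := eval_eq_of_sign hα hsign (hε01 α) hεb
  refine ⟨v, fun n => ((U n : 𝒮) : End ℂ T), ε, hv0, hεval, fun m n => ?_, fun h n c m => ?_, hε01,
    hc1, hc2⟩
  · simp only [hUadd, Units.val_mul, Subalgebra.coe_mul]
  · exact hS.comm _ (hHmem _ _ _) _ (Subtype.mem _)

/-- Both relations are verified at the eigenvector v. Their defects commute with the loops and are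
permuted, up to scalars, by the derivations, so their common kernel is invariant and nonzero, hence
everything. -/
theorem exists_evaluation_of_complement (hH : LoopSystem 𝒯 H D Λ) {α : 𝔥} (hα : Λ α ≠ 0)
    (hα' : ∀ (l : Fin (ν + 1)) (v : T), v ∈ 𝒯 0 → v ≠ 0 →
      (∀ s ∈ loopAlgebra H, IsHomog 𝒯 s 0 → ∃ c : ℂ, s v = c • v) →
      ∃ a : ℕ, 0 < a ∧ ∃ s ∈ loopAlgebra H, IsHomog 𝒯 s (-(a • basisExp l)) ∧
        H α (a • basisExp l) 1 (s v) ≠ 0) :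
    (∀ h m b h' n c, H h m b * H h' n c = Λ h • H h' (m + n) (b * c)) ∧
      ∀ h b, ∃ e : ℂ, H h 0 b = e • (1 : End ℂ T) := by
  have hinv : ∀ l : Fin (ν + 1), ∃ j : End ℂ T, j * H α (basisExp l) 1 = 1 ∧
      H α (basisExp l) 1 * j = 1 ∧ IsHomog 𝒯 j (-basisExp l) := by
    intro l
    obtain ⟨v, hv, hv0, heig⟩ := hH.diffSystem_loopAlgebra.exists_eigenvector hH.ne_bot
    obtain ⟨a, ha, s, hs, hdeg, hne⟩ := hα' l v hv hv0 heig
    obtain ⟨r, hr, hrdeg, hbij⟩ := hH.exists_complement hα l hv hv0 heig ha hs hdeg hne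
    exact hH.exists_inverse hr hrdeg hbij
  choose J hJ₁ hJ₂ hJ using hinv
  obtain ⟨v, U, ε, hv0, hval, hUadd, hUcomm, hε1, hεc, hεm⟩ :=
    hH.exists_evaluation hα hJ₁ hJ₂ hJ
  set N := Λ α with hN
  have hψ : ∀ h b, N * ε h 0 b = Λ h * ε α 0 b := fun h b => by
    rw [← hε1 h, ← hεm h b 1, mul_one]
  constructor
  · let Q : 𝔥 → Exponent ν → B → 𝔥 → Exponent ν → B → End ℂ T := fun h m b h' n c =>
      H h m b * H h' n c - Λ h • H h' (m + n) (b * c)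
    have hQdef : ∀ h m b h' n c, Q h m b h' n c
      = H h m b * H h' n c - Λ h • H h' (m + n) (b * c) := fun _ _ _ _ _ _ => rfl
    let W : Submodule ℂ T := ⨅ h, ⨅ m, ⨅ b, ⨅ h', ⨅ n, ⨅ c, LinearMap.ker (Q h m b h' n c)
    have hW : ∀ w, w ∈ W ↔ ∀ h m b h' n c, Q h m b h' n c w = 0 := by
      intro w
      simp [W, Submodule.mem_iInf]
    have htop : W = ⊤ := by
      apply hH.irr
      · rw [Submodule.ne_bot_iff]
        refine ⟨v, (hW v).2 fun h m b h' n c => ?_, hv0⟩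
        rw [hQdef, LinearMap.sub_apply, Module.End.mul_apply, hval, map_smul,
          ← Module.End.mul_apply, hUcomm, Module.End.mul_apply, hval, map_smul,
          LinearMap.smul_apply, hval, add_comm m n, hUadd, Module.End.mul_apply, hεc h' n, hεc h,
          hεc h' (n + m), smul_smul, smul_smul, ← sub_smul]
        convert zero_smul ℂ _
        rw [sub_eq_zero]
        apply mul_left_cancel₀ hα
        apply mul_left_cancel₀ hα
        linear_combination (N * ε h' 0 c) * hψ h b - N * Λ h * hεm h' b c
      · intro h n c w hw
        rw [hW] at hw ⊢
        intro h₁ m₁ b₁ h₂ m₂ b₂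
        have : Q h₁ m₁ b₁ h₂ m₂ b₂ * H h n c = H h n c * Q h₁ m₁ b₁ h₂ m₂ b₂ := by
          rw [hQdef, sub_mul, mul_sub, mul_assoc, hH.comm h₂, ← mul_assoc, hH.comm h₁, mul_assoc,
            smul_mul_assoc, mul_smul_comm, hH.comm h₂]
        rw [← Module.End.mul_apply, this, Module.End.mul_apply, hw, map_zero]
      · intro a q d w hw
        rw [hW] at hw ⊢
        intro h m b h' n c
        -- Leibniz rule: the commutator with D is a combination of defects with shifted exponents,
        -- which is why the kernel is taken over all defects at once.
        have : Q h m b h' n c * D a q d = D a q d * Q h m b h' n c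
            - ((m q : ℂ) • Q h (a + m) (d * b) h' n c
              + (n q : ℂ) • Q h m b h' (a + n) (d * c)) := by
          have h1 := hH.der a q d h m b
          have h2 := hH.der a q d h' n c
          have h3 := hH.der a q d h' (m + n) (b * c)
          have e1 : D a q d * (H h m b * H h' n c) - (H h m b * H h' n c) * D a q d
              = (m q : ℂ) • (H h (a + m) (d * b) * H h' n c)
                + (n q : ℂ) • (H h m b * H h' (a + n) (d * c)) := by
            rw [← smul_mul_assoc, ← mul_smul_comm, ← h1, ← h2]
            noncomm_ring
          have e2 : D a q d * (H h m b * H h' n c)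
              = (H h m b * H h' n c) * D a q d + ((m q : ℂ) • (H h (a + m) (d * b) * H h' n c)
                + (n q : ℂ) • (H h m b * H h' (a + n) (d * c))) := by
            rw [← e1]; noncomm_ring
          have e3 : D a q d * H h' (m + n) (b * c) = H h' (m + n) (b * c) * D a q d
              + ((m + n) q : ℂ) • H h' (a + (m + n)) (d * (b * c)) := by
            have := h3
            rw [sub_eq_iff_eq_add] at this
            rw [this, add_comm]
          rw [hQdef, hQdef, hQdef, mul_sub, sub_mul, e2, mul_smul_comm, e3, smul_mul_assoc,
            show a + m + n = a + (m + n) by abel, show m + (a + n) = a + (m + n) by abel,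
            mul_assoc d, mul_left_comm b d c]
          push_cast [Pi.add_apply]
          module
        rw [← Module.End.mul_apply, this]
        simp [hw]
    intro h m b h' n c
    ext w
    have hw : w ∈ W := htop ▸ Submodule.mem_top
    have := (hW w).1 hw h m b h' n c
    rw [hQdef, LinearMap.sub_apply, sub_eq_zero] at this
    exact this
  · intro h b
    refine ⟨ε h 0 b, ?_⟩
    have hU0 : U 0 v = v := by
      have h1 := hval α 0 1
      rw [hH.weight, hε1] at h1
      exact (smul_right_injective _ hα h1).symm
    have htop : LinearMap.ker (H h 0 b - ε h 0 b • (1 : End ℂ T)) = ⊤ := by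
      apply hH.irr
      · rw [Submodule.ne_bot_iff]
        refine ⟨v, ?_, hv0⟩
        rw [LinearMap.mem_ker, LinearMap.sub_apply, hval, hU0]
        simp
      · intro h' n c w hw
        rw [LinearMap.mem_ker, LinearMap.sub_apply, sub_eq_zero] at hw ⊢
        rw [← Module.End.mul_apply, hH.comm, Module.End.mul_apply, hw]
        simp
      · intro m q d w hw
        rw [LinearMap.mem_ker, LinearMap.sub_apply, sub_eq_zero] at hw ⊢
        have h1 := hH.der m q d h 0 b
        rw [Pi.zero_apply, Int.cast_zero, zero_smul, sub_eq_zero] at h1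
        rw [← Module.End.mul_apply, ← h1, Module.End.mul_apply, hw]
        simp
    rw [LinearMap.ker_eq_top, sub_eq_zero] at htop
    exact htop

end LoopSystem
end Product
end MapToroidal
end

noncomputable section
namespace MapToroidal

/-! ### Commutation relations of the operators on V -/

section Operators

open Module (End)

variable {g : Type*} [LieRing g] [LieAlgebra ℂ g] {ν : ℕ}

namespace FullToroidal

variable (κ : InvForm g) (c₁ c₂ : ℂ)

/-- The element `∑ₚ k p • t^𝐧 kₚ` of `τ`. -/
def cenVec (n : Exponent ν) : (Fin (ν + 1) → ℂ) →ₗ[ℂ] FullToroidal κ c₁ c₂ ν :=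
  mk κ c₁ c₂ ∘ₗ Finsupp.lsingle n ∘ₗ LinearMap.inr ℂ g _ ∘ₗ LinearMap.inl ℂ _ _

theorem cenVec_apply (n : Exponent ν) (k : Fin (ν + 1) → ℂ) :
    cenVec κ c₁ c₂ n k = mk κ c₁ c₂ (Finsupp.single n (0, k, 0)) := rfl

theorem cenVec_vec (n : Exponent ν) : cenVec κ c₁ c₂ n (vec n) = 0 :=
  (mk_eq_zero κ c₁ c₂).2 (Submodule.subset_span ⟨n, rfl⟩)

theorem lie_mk (P Q : Formal g ν) :
    ⁅mk κ c₁ c₂ P, mk κ c₁ c₂ Q⁆ = mk κ c₁ c₂ (formalBracket κ c₁ c₂ P Q) := rfl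

theorem lie_loop_loop (x y : g) (m n : Exponent ν) :
    ⁅loop κ c₁ c₂ x m, loop κ c₁ c₂ y n⁆
      = loop κ c₁ c₂ ⁅x, y⁆ (m + n) + κ.form x y • cenVec κ c₁ c₂ (m + n) (vec m) := by
  rw [cenVec_apply, loop, loop, loop, lie_mk, formalBracket_single, ← map_smul, ← map_add,
    Finsupp.smul_single, ← Finsupp.single_add]
  simp [coeffBracket, cocycleCoeff]

theorem lie_der_loop (m : Exponent ν) (q : Fin (ν + 1)) (y : g) (n : Exponent ν) :
    ⁅der κ c₁ c₂ m q, loop κ c₁ c₂ y n⁆ = (n q : ℂ) • loop κ c₁ c₂ y (m + n) := by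
  rw [der, loop, loop, lie_mk, formalBracket_single, ← map_smul, Finsupp.smul_single]
  simp [coeffBracket, cocycleCoeff, vec]

theorem lie_der_cenVec (m : Exponent ν) (q : Fin (ν + 1)) (n : Exponent ν)
    (k : Fin (ν + 1) → ℂ) :
    ⁅der κ c₁ c₂ m q, cenVec κ c₁ c₂ n k⁆
      = (n q : ℂ) • cenVec κ c₁ c₂ (m + n) k + k q • cenVec κ c₁ c₂ (m + n) (vec m) := by
  simp only [cenVec_apply, der]
  rw [lie_mk, formalBracket_single, ← map_smul, ← map_smul, ← map_add,
    Finsupp.smul_single, Finsupp.smul_single, ← Finsupp.single_add]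
  simp [coeffBracket, cocycleCoeff, vec]

theorem lie_cenVec_loop (n : Exponent ν) (k : Fin (ν + 1) → ℂ) (x : g) (m : Exponent ν) :
    ⁅cenVec κ c₁ c₂ n k, loop κ c₁ c₂ x m⁆ = 0 := by
  rw [cenVec_apply, loop, lie_mk, formalBracket_single,
    show coeffBracket κ c₁ c₂ n m (0, k, 0) (x, 0, 0) = 0 by simp [coeffBracket, cocycleCoeff],
    Finsupp.single_zero, map_zero]

theorem lie_cenVec_cenVec (n m : Exponent ν) (k l : Fin (ν + 1) → ℂ) :
    ⁅cenVec κ c₁ c₂ n k, cenVec κ c₁ c₂ m l⁆ = 0 := by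
  rw [cenVec_apply, cenVec_apply, lie_mk, formalBracket_single,
    show coeffBracket κ c₁ c₂ n m ((0, k, 0) : Coeff g ν) (0, l, 0) = 0 by
      simp [coeffBracket, cocycleCoeff], Finsupp.single_zero, map_zero]

theorem mk_induction {p : FullToroidal κ c₁ c₂ ν → Prop} (hadd : ∀ X Y, p X → p Y → p (X + Y))
    (hloop : ∀ x m, p (loop κ c₁ c₂ x m)) (hcen : ∀ n k, p (cenVec κ c₁ c₂ n k))
    (hder : ∀ m q (a : ℂ), p (a • der κ c₁ c₂ m q)) (X : FullToroidal κ c₁ c₂ ν) : p X := by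
  obtain ⟨P, rfl⟩ := mk_surjective κ c₁ c₂ X
  have h0 : p 0 := by simpa using hcen 0 0
  induction P using Finsupp.induction_linear with
  | zero => simpa using h0
  | add P Q hP hQ => rw [map_add]; exact hadd _ _ hP hQ
  | single m u =>
    obtain ⟨x, k, d⟩ := u
    have h1 : Finsupp.single m ((x, k, d) : Coeff g ν) = Finsupp.single m ((x, 0, 0) : Coeff g ν)
        + Finsupp.single m ((0, k, 0) : Coeff g ν)
        + ∑ q, d q • Finsupp.single m ((0, 0, Pi.single q 1) : Coeff g ν) := by
      simp only [Finsupp.smul_single]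
      rw [← Finsupp.single_finsetSum, ← Finsupp.single_add, ← Finsupp.single_add]
      congr 1
      refine Prod.ext ?_ (Prod.ext ?_ ?_)
      · simp [Prod.fst_sum]
      · simp [Prod.fst_sum, Prod.snd_sum]
      · ext i
        simp [Prod.snd_sum, Finset.sum_apply, Pi.single_apply]
    rw [h1, map_add, map_add, map_sum]
    refine hadd _ _ (hadd _ _ (hloop x m) (hcen m k)) ?_
    refine Finset.sum_induction _ p hadd h0 fun q _ => ?_
    rw [map_smul]
    exact hder m q (d q)

end FullToroidal

variable (κ : InvForm g) (c₁ c₂ : ℂ) {B : Type*} [CommRing B] [Algebra ℂ B]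
  (V : Type*) [AddCommGroup V] [Module ℂ V] [LieRingModule (MapFullToroidal κ c₁ c₂ ν B) V]
  [LieModule ℂ (MapFullToroidal κ c₁ c₂ ν B) V]

/-- The operator by which `∑ₚ k p • t^𝐧 kₚ ⊗ b` acts on `V`. -/
def cenOp (n : Exponent ν) (k : Fin (ν + 1) → ℂ) (b : B) : End ℂ V :=
  LieModule.toEnd ℂ (MapFullToroidal κ c₁ c₂ ν B) V (b ⊗ₜ[ℂ] FullToroidal.cenVec κ c₁ c₂ n k)

/-- The operator by which `t^𝐦 d_q ⊗ b` acts on `V`. -/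
def derOp (m : Exponent ν) (q : Fin (ν + 1)) (b : B) : End ℂ V :=
  LieModule.toEnd ℂ (MapFullToroidal κ c₁ c₂ ν B) V (b ⊗ₜ[ℂ] FullToroidal.der κ c₁ c₂ m q)

variable {V}

theorem toEnd_tmul_mul (b c : B) (X Y : FullToroidal κ c₁ c₂ ν) :
    LieModule.toEnd ℂ (MapFullToroidal κ c₁ c₂ ν B) V (b ⊗ₜ[ℂ] X)
        * LieModule.toEnd ℂ (MapFullToroidal κ c₁ c₂ ν B) V (c ⊗ₜ[ℂ] Y)
      = LieModule.toEnd ℂ (MapFullToroidal κ c₁ c₂ ν B) V (c ⊗ₜ[ℂ] Y)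
        * LieModule.toEnd ℂ (MapFullToroidal κ c₁ c₂ ν B) V (b ⊗ₜ[ℂ] X)
      + LieModule.toEnd ℂ (MapFullToroidal κ c₁ c₂ ν B) V ((b * c) ⊗ₜ[ℂ] ⁅X, Y⁆) := by
  ext v
  rw [← LieAlgebra.ExtendScalars.bracket_tmul]
  simp only [Module.End.mul_apply, LinearMap.add_apply, LieModule.toEnd_apply_apply]
  rw [leibniz_lie, add_comm]

local notation "𝐋" => loopOp κ c₁ c₂ ν V
local notation "𝐊" => cenOp κ c₁ c₂ V
local notation "𝐃" => derOp κ c₁ c₂ V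

theorem loopOp_mul_loopOp (x y : g) (m n : Exponent ν) (b c : B) :
    𝐋 x m b * 𝐋 y n c = 𝐋 y n c * 𝐋 x m b + 𝐋 ⁅x, y⁆ (m + n) (b * c)
      + κ.form x y • 𝐊 (m + n) (vec m) (b * c) := by
  rw [loopOp, loopOp, toEnd_tmul_mul, FullToroidal.lie_loop_loop, TensorProduct.tmul_add, map_add,
    TensorProduct.tmul_smul, map_smul, ← add_assoc]
  rfl

theorem derOp_mul_loopOp (m : Exponent ν) (q : Fin (ν + 1)) (y : g) (n : Exponent ν) (b c : B) :
    𝐃 m q b * 𝐋 y n c = 𝐋 y n c * 𝐃 m q b + (n q : ℂ) • 𝐋 y (m + n) (b * c) := by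
  rw [loopOp, derOp, toEnd_tmul_mul, FullToroidal.lie_der_loop, TensorProduct.tmul_smul, map_smul]
  rfl

theorem derOp_mul_cenOp (m : Exponent ν) (q : Fin (ν + 1)) (n : Exponent ν)
    (k : Fin (ν + 1) → ℂ) (b c : B) :
    𝐃 m q b * 𝐊 n k c = 𝐊 n k c * 𝐃 m q b + (n q : ℂ) • 𝐊 (m + n) k (b * c)
      + k q • 𝐊 (m + n) (vec m) (b * c) := by
  rw [cenOp, derOp, toEnd_tmul_mul, FullToroidal.lie_der_cenVec, TensorProduct.tmul_add, map_add,
    TensorProduct.tmul_smul, TensorProduct.tmul_smul, map_smul, map_smul, ← add_assoc]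
  rfl

theorem cenOp_mul_loopOp (n : Exponent ν) (k : Fin (ν + 1) → ℂ) (x : g) (m : Exponent ν)
    (b c : B) : 𝐊 n k b * 𝐋 x m c = 𝐋 x m c * 𝐊 n k b := by
  rw [cenOp, loopOp, toEnd_tmul_mul, FullToroidal.lie_cenVec_loop, TensorProduct.tmul_zero,
    map_zero, add_zero]

theorem cenOp_mul_cenOp (n m : Exponent ν) (k l : Fin (ν + 1) → ℂ) (b c : B) :
    𝐊 n k b * 𝐊 m l c = 𝐊 m l c * 𝐊 n k b := by
  rw [cenOp, cenOp, toEnd_tmul_mul, FullToroidal.lie_cenVec_cenVec, TensorProduct.tmul_zero,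
    map_zero, add_zero]

theorem cenOp_vec (n : Exponent ν) (b : B) : 𝐊 n (vec n) b = 0 := by
  rw [cenOp, FullToroidal.cenVec_vec, TensorProduct.tmul_zero, map_zero]

theorem cenOp_add (n : Exponent ν) (k l : Fin (ν + 1) → ℂ) (b : B) :
    𝐊 n (k + l) b = 𝐊 n k b + 𝐊 n l b := by
  rw [cenOp, map_add, TensorProduct.tmul_add, map_add]; rfl

theorem cenOp_smul (n : Exponent ν) (a : ℂ) (k : Fin (ν + 1) → ℂ) (b : B) :
    𝐊 n (a • k) b = a • 𝐊 n k b := by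
  rw [cenOp, map_smul, TensorProduct.tmul_smul, map_smul]; rfl

theorem cenOp_zero (n : Exponent ν) (b : B) : 𝐊 n 0 b = 0 := by
  rw [cenOp, map_zero, TensorProduct.tmul_zero, map_zero]

theorem cenOp_eq_sum (n : Exponent ν) (k : Fin (ν + 1) → ℂ) (b : B) :
    𝐊 n k b = ∑ p, k p • 𝐊 n (Pi.single p 1) b := by
  have h : ∀ F : Finset (Fin (ν + 1)), 𝐊 n (∑ p ∈ F, k p • Pi.single p 1) b
      = ∑ p ∈ F, k p • 𝐊 n (Pi.single p 1) b := by
    intro F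
    induction F using Finset.induction_on with
    | empty => simpa using cenOp_zero κ c₁ c₂ n b
    | insert p F hp ih => rw [Finset.sum_insert hp, Finset.sum_insert hp, cenOp_add, cenOp_smul, ih]
  rw [← h]
  congr 1
  ext i
  simp [Finset.sum_apply, Pi.single_apply]

theorem loopOp_add (x y : g) (m : Exponent ν) (b : B) : 𝐋 (x + y) m b = 𝐋 x m b + 𝐋 y m b := by
  have h : FullToroidal.loop κ c₁ c₂ (x + y) m
      = FullToroidal.loop κ c₁ c₂ x m + FullToroidal.loop κ c₁ c₂ y m := by
    rw [FullToroidal.loop, FullToroidal.loop, FullToroidal.loop, ← map_add, ← Finsupp.single_add]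
    simp
  rw [loopOp, h, TensorProduct.tmul_add, map_add]; rfl

theorem loopOp_smul (a : ℂ) (x : g) (m : Exponent ν) (b : B) : 𝐋 (a • x) m b = a • 𝐋 x m b := by
  have h : FullToroidal.loop κ c₁ c₂ (a • x) m = a • FullToroidal.loop κ c₁ c₂ x m := by
    rw [FullToroidal.loop, FullToroidal.loop, ← map_smul, Finsupp.smul_single]
    simp
  rw [loopOp, h, TensorProduct.tmul_smul, map_smul]; rfl

theorem loopOp_zero (m : Exponent ν) (b : B) : 𝐋 (0 : g) m b = 0 := by
  simpa using loopOp_smul κ c₁ c₂ (V := V) 0 (0 : g) m b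

theorem loopOp_smul_right (x : g) (m : Exponent ν) (a : ℂ) (b : B) :
    𝐋 x m (a • b) = a • 𝐋 x m b := by
  rw [loopOp, ← TensorProduct.smul_tmul', map_smul]; rfl

theorem loopOp_add_right (x : g) (m : Exponent ν) (b c : B) :
    𝐋 x m (b + c) = 𝐋 x m b + 𝐋 x m c := by
  rw [loopOp, TensorProduct.add_tmul, map_add]; rfl

/-- Reduces invariance under τ(B) to the three families of generating operators. -/
theorem lie_mem_of_forall {W : Submodule ℂ V} {v : V}
    (hL : ∀ x (m : Exponent ν) (b : B), 𝐋 x m b v ∈ W)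
    (hK : ∀ (n : Exponent ν) k (b : B), 𝐊 n k b v ∈ W)
    (hD : ∀ (m : Exponent ν) q (b : B), 𝐃 m q b v ∈ W)
    (X : MapFullToroidal κ c₁ c₂ ν B) : ⁅X, v⁆ ∈ W := by
  induction X using TensorProduct.induction_on with
  | zero => simp
  | add X Y hX hY => rw [add_lie]; exact add_mem hX hY
  | tmul b X =>
    induction X using FullToroidal.mk_induction with
    | hadd X Y hX hY => rw [TensorProduct.tmul_add, add_lie]; exact add_mem hX hY
    | hloop x m => exact hL x m b
    | hcen n k => exact hK n k b
    | hder m q a =>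
      rw [TensorProduct.tmul_smul, ← LieModule.toEnd_apply_apply ℂ, map_smul]
      exact W.smul_mem _ (hD m q b)

end Operators
end MapToroidal
end

noncomputable section
namespace MapToroidal

/-! ### Roots, heights and the invariant form -/

section Roots

open LieAlgebra LieAlgebra.IsKilling

variable {g : Type*} [LieRing g] [LieAlgebra ℂ g]

theorem InvForm.apply_lie (κ : InvForm g) (x y z : g) : κ.form ⁅x, y⁆ z = κ.form x ⁅y, z⁆ := by
  rw [← lie_skew, map_neg, LinearMap.neg_apply, κ.invariant, neg_neg]

variable [FiniteDimensional ℂ g] {H : LieSubalgebra ℂ g} [H.IsCartanSubalgebra]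

theorem eq_top_of_rootSpaces_le {W : Submodule ℂ g} (hH : H.toSubmodule ≤ W)
    (hroot : ∀ α : H.root, (rootSpace H (α : LieModule.Weight ℂ H g)).toSubmodule ≤ W) : W = ⊤ := by
  have h := LieModule.iSup_genWeightSpace_eq_top' ℂ H g
  have h' : (⨆ χ : LieModule.Weight ℂ H g, (rootSpace H χ).toSubmodule) = ⊤ := by
    rw [← LieSubmodule.iSup_toSubmodule]
    exact (congrArg _ h).trans LieSubmodule.top_toSubmodule
  rw [eq_top_iff, ← h']
  refine iSup_le fun χ => ?_
  by_cases hχ : χ.IsZero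
  · have : rootSpace H χ = H.toLieSubmodule := by
      rw [show (χ : H → ℂ) = 0 from hχ]; exact rootSpace_zero_eq ℂ g H
    rw [this]
    exact hH
  · exact hroot ⟨χ, by simpa using hχ⟩

variable [LieAlgebra.IsSimple ℂ g]

/-- ρ is dual to the base, with value 1 on every simple root. It serves to grade V by height. -/
theorem exists_height_element (base : (rootSystem H).Base) :
    ∃ ρ : H, ∀ α : H.root, (α : LieModule.Weight ℂ H g) ρ = (base.height α : ℂ) := by
  let φ : Module.Dual ℂ (Module.Dual ℂ H) := base.toWeightBasis.constr ℂ fun _ => (1 : ℂ)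
  refine ⟨(Module.evalEquiv ℂ H).symm φ, fun α => ?_⟩
  have h1 : ∀ f : Module.Dual ℂ H, f ((Module.evalEquiv ℂ H).symm φ) = φ f := by
    intro f
    have := LinearMap.congr_fun ((Module.evalEquiv ℂ H).apply_symm_apply φ) f
    exact this
  obtain ⟨f, -, -, hf⟩ := base.exists_root_eq_sum_int α
  have h2 : ∀ j ∈ base.support, φ ((rootSystem H).root j) = 1 := by
    intro j hj
    have := base.toWeightBasis.constr_basis ℂ (fun _ => (1 : ℂ)) ⟨j, hj⟩
    simpa [φ] using this
  have h3 : (α : LieModule.Weight ℂ H g) ((Module.evalEquiv ℂ H).symm φ)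
      = φ ((rootSystem H).root α) := by
    rw [← h1]; rfl
  rw [h3, RootPairing.Base.height_eq_sum hf, hf, map_sum, Int.cast_sum]
  refine Finset.sum_congr rfl fun j hj => ?_
  rw [map_zsmul, h2 j hj]
  simp

theorem lie_eq_neg_smul_of_mem_rootSpace {α : H → ℂ} {x : g} (hx : x ∈ rootSpace H α) (h : H) :
    ⁅x, (h : g)⁆ = -(α h • x) := by
  rw [← lie_skew]
  exact congrArg _ (lie_eq_smul_of_mem_rootSpace hx h)

theorem lie_cartan_eq_zero (h h' : H) : ⁅(h : g), (h' : g)⁆ = 0 := by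
  have := trivial_lie_zero H H h h'
  exact congrArg Subtype.val this

/-- Invariance gives α(h') (x | h) = 0 for all h' in the Cartan subalgebra, since that subalgebra is
abelian. -/
theorem form_rootSpace_cartan (κ : InvForm g) {α : H.root} {x : g}
    (hx : x ∈ rootSpace H (α : LieModule.Weight ℂ H g)) (h : H) : κ.form x h = 0 := by
  have hα : (α : LieModule.Weight ℂ H g).IsNonZero := H.isNonZero_coe_root α
  obtain ⟨h', hh'⟩ := Function.ne_iff.1 hα
  have h1 := κ.apply_lie x h' h
  rw [lie_eq_neg_smul_of_mem_rootSpace hx, lie_cartan_eq_zero, map_zero, map_neg,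
    LinearMap.neg_apply, neg_eq_zero, map_smul, LinearMap.smul_apply, smul_eq_mul] at h1
  exact (mul_eq_zero.1 h1).resolve_left hh'

/-- The coroots span the Cartan subalgebra, and passing from α to -α only changes a sign. -/
theorem exists_isPos_apply_coroot_ne_zero (base : (rootSystem H).Base) {Λ : Module.Dual ℂ H}
    (hΛ : Λ ≠ 0) : ∃ α : H.root, base.IsPos α ∧ Λ (coroot (α : LieModule.Weight ℂ H g)) ≠ 0 := by
  have h1 : ∃ α : H.root, Λ (coroot (α : LieModule.Weight ℂ H g)) ≠ 0 := by
    by_contra! h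
    apply hΛ
    have hspan : Submodule.span ℂ (Set.range (rootSystem H).coroot) = ⊤ :=
      RootPairing.IsRootSystem.span_coroot_eq_top
    refine LinearMap.ext_on_range (v := (rootSystem H).coroot) hspan fun α => ?_
    simpa using h α
  obtain ⟨α, hα⟩ := h1
  let := (rootSystem H).indexNeg
  rcases RootPairing.Base.IsPos.or_neg base α with h | h
  · exact ⟨α, h, hα⟩
  · refine ⟨-α, h, ?_⟩
    have : (rootSystem H).coroot (-α) = -(rootSystem H).coroot α := by
      simpa using (rootSystem H).coreflection_apply_self α
    rw [rootSystem_coroot_apply, rootSystem_coroot_apply] at this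
    rw [this, map_neg, neg_ne_zero]
    exact hα

/-- The elements of an `sl₂`-triple attached to a root are paired as in `sl₂` by every invariant
form. -/
structure IsFormTriple (κ : InvForm g) (h e f : g) : Prop where
  triple : IsSl2Triple h e f
  form_e_f : κ.form e f ≠ 0
  form_h_f : κ.form h f = 0

theorem exists_isFormTriple (κ : InvForm g) (α : H.root) :
    ∃ e ∈ rootSpace H (α : LieModule.Weight ℂ H g),
      ∃ f ∈ rootSpace H (-(α : LieModule.Weight ℂ H g)),
        IsFormTriple κ (coroot (α : LieModule.Weight ℂ H g) : g) e f := by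
  have hα : (α : LieModule.Weight ℂ H g).IsNonZero := H.isNonZero_coe_root α
  obtain ⟨h, e, f, ht, he, hf⟩ := exists_isSl2Triple_of_weight_isNonZero hα
  obtain rfl := ht.h_eq_coroot hα he hf
  set h : H := coroot (α : LieModule.Weight ℂ H g)
  have hhf : κ.form h f = 0 := by
    have h1 := κ.apply_lie (h : g) h f
    rw [ht.lie_h_f_nsmul, lie_self, map_zero, LinearMap.zero_apply, map_neg, map_nsmul, eq_comm,
      neg_eq_zero, nsmul_eq_mul] at h1
    exact (mul_eq_zero.1 h1).resolve_left (by norm_num)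
  refine ⟨e, he, f, hf, ht, fun h0 => ht.h_ne_zero ?_, hhf⟩
  -- If (e | f) = 0, the coroot [e, f] is orthogonal to the Cartan subalgebra by invariance and to
  -- every root space, against nondegeneracy.
  · have h1 : κ.form (h : g) = 0 := by
      rw [← LinearMap.ker_eq_top]
      refine eq_top_of_rootSpaces_le (H := H) ?_ ?_
      · intro h' hh'
        rw [LinearMap.mem_ker, ← ht.lie_e_f, κ.apply_lie]
        rw [lie_eq_neg_smul_of_mem_rootSpace hf ⟨h', hh'⟩, map_neg, map_smul, h0, smul_zero,
          neg_zero]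
      · intro β x hx
        rw [LinearMap.mem_ker, κ.symm.eq]
        exact form_rootSpace_cartan κ hx h
    by_contra hne
    exact hne (κ.nondegenerate.1 _ fun y => by rw [h1]; rfl)

end Roots
end MapToroidal
end

noncomputable section
namespace MapToroidal

/-! ### The highest space as top eigenspace of the height element -/

section Highest

open Module (End)
open LieAlgebra LieAlgebra.IsKilling

/-- A product of factors f - y i kills v. Applied one at a time, they stay in p, and the last
nonzero vector is an eigenvector. -/
theorem exists_eigenvector_of_mem_iSup {V : Type*} [AddCommGroup V] [Module ℂ V] {f : End ℂ V}
    {p : Submodule ℂ V} (hp : ∀ v ∈ p, f v ∈ p) {ι : Type*} {y : ι → ℂ} {v : V} (hv : v ∈ p)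
    (hv0 : v ≠ 0) (hvy : v ∈ ⨆ i, f.eigenspace (y i)) :
    ∃ i, ∃ w ∈ p, w ≠ 0 ∧ w ∈ f.eigenspace (y i) := by
  have h1 : ∃ L : List ι,
      Polynomial.aeval f (L.map fun i => Polynomial.X - Polynomial.C (y i)).prod v = 0 := by
    clear hv hv0
    induction hvy using Submodule.iSup_induction' with
    | mem i x hx =>
      refine ⟨[i], ?_⟩
      rw [Module.End.mem_eigenspace_iff] at hx
      simp [hx, Module.algebraMap_end_apply]
    | zero => exact ⟨[], by simp⟩
    | add x z _ _ hx hz =>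
      obtain ⟨L, hL⟩ := hx
      obtain ⟨L', hL'⟩ := hz
      refine ⟨L ++ L', ?_⟩
      rw [List.map_append, List.prod_append, map_add]
      nth_rewrite 1 [mul_comm]
      rw [map_mul, map_mul, Module.End.mul_apply, Module.End.mul_apply, hL, hL', map_zero, map_zero,
        add_zero]
  obtain ⟨L, hL⟩ := h1
  clear hvy
  induction L generalizing v with
  | nil => simp [hv0] at hL
  | cons i L ih =>
    by_cases h : f v - y i • v = 0
    · exact ⟨i, v, hv, hv0, Module.End.mem_eigenspace_iff.2 (sub_eq_zero.1 h)⟩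
    · refine ih (p.sub_mem (hp v hv) (p.smul_mem _ hv)) h ?_
      rw [List.map_cons, List.prod_cons, mul_comm, map_mul, Module.End.mul_apply] at hL
      simpa [Module.algebraMap_end_apply] using hL

variable {g : Type*} [LieRing g] [LieAlgebra ℂ g]
  (H : LieSubalgebra ℂ g) (κ : InvForm g) (c₁ c₂ : ℂ) (ν : ℕ)
  {B : Type*} [CommRing B] [Algebra ℂ B]
  {V : Type*} [AddCommGroup V] [Module ℂ V] [LieRingModule (MapFullToroidal κ c₁ c₂ ν B) V]
  [LieModule ℂ (MapFullToroidal κ c₁ c₂ ν B) V]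

local notation "𝐋" => loopOp κ c₁ c₂ ν V
local notation "𝐊" => cenOp κ c₁ c₂ (ν := ν) V
local notation "𝐃" => derOp κ c₁ c₂ (ν := ν) V

/-- Stability of a subspace under `(H ⊗ A ⊕ 𝒦 ⊕ 𝒟) ⊗ B`. -/
structure CartanStable (B : Type*) [CommRing B] [Algebra ℂ B]
    [LieRingModule (MapFullToroidal κ c₁ c₂ ν B) V]
    [LieModule ℂ (MapFullToroidal κ c₁ c₂ ν B) V] (U : Submodule ℂ V) : Prop where
  loop : ∀ (h : H) (m : Exponent ν) (b : B), ∀ v ∈ U, 𝐋 (h : g) m b v ∈ U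
  cen : ∀ (n : Exponent ν) k (b : B), ∀ v ∈ U, 𝐊 n k b v ∈ U
  der : ∀ (m : Exponent ν) q (b : B), ∀ v ∈ U, 𝐃 m q b v ∈ U

variable {H κ c₁ c₂ ν}

theorem CartanStable.inf {U U' : Submodule ℂ V} (hU : CartanStable H κ c₁ c₂ ν B U)
    (hU' : CartanStable H κ c₁ c₂ ν B U') : CartanStable H κ c₁ c₂ ν B (U ⊓ U') where
  loop h m b v hv := ⟨hU.loop h m b v hv.1, hU'.loop h m b v hv.2⟩
  cen n k b v hv := ⟨hU.cen n k b v hv.1, hU'.cen n k b v hv.2⟩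
  der m q b v hv := ⟨hU.der m q b v hv.1, hU'.der m q b v hv.2⟩

variable [FiniteDimensional ℂ g] [LieAlgebra.IsSimple ℂ g] [H.IsCartanSubalgebra]
  {base : (rootSystem H).Base}

local notation "𝐓" => highestSpace κ c₁ c₂ ν H B V base

theorem mem_highestSpace {v : V} : v ∈ 𝐓 ↔ ∀ α : H.root, base.IsPos α →
    ∀ x ∈ rootSpace H (α : LieModule.Weight ℂ H g), ∀ (m : Exponent ν) (b : B), 𝐋 x m b v = 0 := by
  simp [highestSpace, Submodule.mem_iInf]

theorem loopOp_cartan_comm_zero (h ρ : H) (m : Exponent ν) (b : B) :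
    𝐋 (h : g) m b * 𝐋 (ρ : g) 0 (1 : B) = 𝐋 (ρ : g) 0 (1 : B) * 𝐋 (h : g) m b := by
  rw [loopOp_mul_loopOp κ c₁ c₂ (ρ : g) (h : g) 0 m 1 b, lie_cartan_eq_zero, loopOp_zero,
    show vec (0 : Exponent ν) = 0 by ext; simp [vec], cenOp_zero, smul_zero, add_zero, add_zero]

theorem loopOp_rho_mul_loopOp (ρ : H) {α : H.root} {x : g}
    (hx : x ∈ rootSpace H (α : LieModule.Weight ℂ H g)) (m : Exponent ν) (b : B) :
    𝐋 (ρ : g) 0 (1 : B) * 𝐋 x m b = 𝐋 x m b * 𝐋 (ρ : g) 0 (1 : B)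
      + (α : LieModule.Weight ℂ H g) ρ • 𝐋 x m b := by
  have h1 : ⁅(ρ : g), x⁆ = (α : LieModule.Weight ℂ H g) ρ • x := lie_eq_smul_of_mem_rootSpace hx ρ
  rw [loopOp_mul_loopOp κ c₁ c₂ (ρ : g) x 0 m 1 b, h1, loopOp_smul,
    show vec (0 : Exponent ν) = 0 by ext; simp [vec], cenOp_zero, smul_zero, add_zero, zero_add,
    one_mul]

theorem cartanStable_eigenspace (ρ : H) (a : ℂ) :
    CartanStable H κ c₁ c₂ ν B ((𝐋 (ρ : g) 0 (1 : B)).eigenspace a) where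
  loop h m b v hv := by
    rw [Module.End.mem_eigenspace_iff] at hv ⊢
    rw [← Module.End.mul_apply, ← loopOp_cartan_comm_zero, Module.End.mul_apply, hv, map_smul]
  cen n k b v hv := by
    rw [Module.End.mem_eigenspace_iff] at hv ⊢
    rw [← Module.End.mul_apply, ← cenOp_mul_loopOp, Module.End.mul_apply, hv, map_smul]
  der m q b v hv := by
    rw [Module.End.mem_eigenspace_iff] at hv ⊢
    have h1 := derOp_mul_loopOp κ c₁ c₂ (V := V) m q (ρ : g) 0 b (1 : B)
    rw [Pi.zero_apply, Int.cast_zero, zero_smul, add_zero] at h1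
    rw [← Module.End.mul_apply, ← h1, Module.End.mul_apply, hv, map_smul]

theorem cartanStable_highestSpace : CartanStable H κ c₁ c₂ ν B 𝐓 where
  loop h m b v hv := by
    rw [mem_highestSpace] at hv ⊢
    intro α hα x hx n c
    rw [← Module.End.mul_apply, loopOp_mul_loopOp, lie_eq_neg_smul_of_mem_rootSpace hx, ← neg_smul,
      loopOp_smul, form_rootSpace_cartan κ hx]
    simp [hv α hα x hx]
  cen n k b v hv := by
    rw [mem_highestSpace] at hv ⊢
    intro α hα x hx m c
    rw [← Module.End.mul_apply, ← cenOp_mul_loopOp, Module.End.mul_apply, hv α hα x hx, map_zero]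
  der m q b v hv := by
    rw [mem_highestSpace] at hv ⊢
    intro α hα x hx n c
    have h1 := LinearMap.congr_fun (derOp_mul_loopOp κ c₁ c₂ (V := V) m q x n b c) v
    simp only [Module.End.mul_apply, LinearMap.add_apply, LinearMap.smul_apply, hv α hα x hx,
      map_zero, smul_zero, add_zero] at h1
    exact h1.symm

/-- A triangular decomposition argument: what U generates under the negative root operators alone is
already a submodule, hence V, and negative root operators strictly lower the ρ-eigenvalue by
integers. -/
theorem top_le_of_cartanStable
    (hirr : LieModule.IsIrreducible ℂ (MapFullToroidal κ c₁ c₂ ν B) V) {ρ : H}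
    (hρ : ∀ α : H.root, (α : LieModule.Weight ℂ H g) ρ = (base.height α : ℂ))
    {U : Submodule ℂ V} (hU0 : U ≠ ⊥) (hUT : U ≤ 𝐓) (hU : CartanStable H κ c₁ c₂ ν B U) {a : ℂ}
    (hUa : U ≤ (𝐋 (ρ : g) 0 (1 : B)).eigenspace a) :
    ⊤ ≤ U ⊔ ⨆ j : ℕ, (𝐋 (ρ : g) 0 (1 : B)).eigenspace (a - (j + 1)) := by
  let 𝒲 : Set (Submodule ℂ V) := {W | U ≤ W ∧ ∀ α : H.root, ¬ base.IsPos α →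
    ∀ x ∈ rootSpace H (α : LieModule.Weight ℂ H g), ∀ (m : Exponent ν) (b : B), ∀ v ∈ W,
      𝐋 x m b v ∈ W}
  let M := sInf 𝒲
  have hUM : U ≤ M := le_sInf fun W hW => hW.1
  have hMstab : ∀ α : H.root, ¬ base.IsPos α →
      ∀ x ∈ rootSpace H (α : LieModule.Weight ℂ H g), ∀ (m : Exponent ν) (b : B), ∀ v ∈ M,
      𝐋 x m b v ∈ M := by
    intro α hα x hx m b v hv
    rw [Submodule.mem_sInf] at hv ⊢
    exact fun W hW => hW.2 α hα x hx m b v (hv W hW)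
  -- The vectors of M that τ(B) sends into M. That M' has the defining properties of M follows from
  -- X f v = [X, f] v + f X v, so minimality gives M ≤ M'.
  let M' : Submodule ℂ V :=
    { carrier := {v | v ∈ M ∧ ∀ X : MapFullToroidal κ c₁ c₂ ν B, ⁅X, v⁆ ∈ M}
      zero_mem' := ⟨zero_mem _, fun X => by simp⟩
      add_mem' := fun hv hw => ⟨add_mem hv.1 hw.1, fun X => by
        rw [lie_add]; exact add_mem (hv.2 X) (hw.2 X)⟩
      smul_mem' := fun c v hv => ⟨M.smul_mem c hv.1, fun X => by
        rw [← LieModule.toEnd_apply_apply ℂ, map_smul]; exact M.smul_mem c (hv.2 X)⟩ }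
  have hMM' : M ≤ M' := by
    refine sInf_le ⟨fun v hv => ⟨hUM hv, ?_⟩, fun α hα x hx m b v hv => ⟨?_, fun X => ?_⟩⟩
    · refine lie_mem_of_forall κ c₁ c₂ (fun x m b => ?_) (fun n k b => hUM (hU.cen n k b v hv))
        (fun m q b => hUM (hU.der m q b v hv))
      let S : Submodule ℂ g :=
        { carrier := {x | 𝐋 x m b v ∈ M}
          zero_mem' := by
            change 𝐋 (0 : g) m b v ∈ M
            rw [loopOp_zero]; exact zero_mem M
          add_mem' := fun {x y} hx hy => by
            change 𝐋 (x + y) m b v ∈ M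
            rw [loopOp_add]; exact add_mem hx hy
          smul_mem' := fun c x hx => by
            change 𝐋 (c • x) m b v ∈ M
            rw [loopOp_smul]; exact M.smul_mem c hx }
      have hS : S = ⊤ := by
        refine eq_top_of_rootSpaces_le (H := H) (fun h hh => hUM (hU.loop ⟨h, hh⟩ m b v hv))
          fun α x hx => ?_
        by_cases hα : base.IsPos α
        · change 𝐋 x m b v ∈ M
          rw [mem_highestSpace.1 (hUT hv) α hα x hx]
          exact zero_mem M
        · exact hMstab α hα x hx m b v (hUM hv)
      have : x ∈ S := hS ▸ Submodule.mem_top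
      exact this
    · exact hMstab α hα x hx m b v hv.1
    · have h1 : ⁅X, 𝐋 x m b v⁆ = ⁅⁅X, b ⊗ₜ[ℂ] FullToroidal.loop κ c₁ c₂ x m⁆, v⁆
          + 𝐋 x m b ⁅X, v⁆ := by
        rw [loopOp, LieModule.toEnd_apply_apply, LieModule.toEnd_apply_apply]
        exact leibniz_lie ..
      rw [h1]
      exact add_mem (hv.2 _) (hMstab α hα x hx m b _ (hv.2 X))
  let N : LieSubmodule ℂ (MapFullToroidal κ c₁ c₂ ν B) V :=
    { M with lie_mem := fun {X v} hv => (hMM' hv).2 X }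
  have hN : N = ⊤ := by
    refine (hirr.eq_bot_or_eq_top N).resolve_left fun h => ?_
    obtain ⟨u, hu, hu0⟩ := Submodule.exists_mem_ne_zero_of_ne_bot hU0
    have : u ∈ N := hUM hu
    rw [h, LieSubmodule.mem_bot] at this
    exact hu0 this
  have hM : M = ⊤ := by
    have := congrArg LieSubmodule.toSubmodule hN
    rwa [LieSubmodule.top_toSubmodule] at this
  rw [← hM]
  refine sInf_le ⟨le_sup_left, fun α hα x hx m b v hv => ?_⟩
  -- A root that is not positive has height at most -1.
  have hneg : ∃ k : ℕ, (α : LieModule.Weight ℂ H g) ρ = -(k + 1 : ℂ) := by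
    rw [base.isPos_iff', not_le] at hα
    obtain ⟨k, hk⟩ := Int.eq_ofNat_of_zero_le (show 0 ≤ -base.height α - 1 by omega)
    refine ⟨k, ?_⟩
    rw [hρ, show base.height α = -((k : ℤ) + 1) by omega]
    push_cast
    ring
  obtain ⟨k, hk⟩ := hneg
  have hshift : ∀ (y : ℂ) (w : V), w ∈ (𝐋 (ρ : g) 0 (1 : B)).eigenspace y →
      𝐋 x m b w ∈ (𝐋 (ρ : g) 0 (1 : B)).eigenspace (y - (k + 1)) := by
    intro y w hw
    rw [Module.End.mem_eigenspace_iff] at hw ⊢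
    rw [← Module.End.mul_apply, loopOp_rho_mul_loopOp ρ hx, LinearMap.add_apply,
      Module.End.mul_apply, hw, map_smul, LinearMap.smul_apply, hk, ← add_smul, ← sub_eq_add_neg]
  refine Submodule.mem_sup_right ?_
  rw [Submodule.mem_sup] at hv
  obtain ⟨u, hu, w, hw, rfl⟩ := hv
  rw [map_add]
  refine add_mem (Submodule.mem_iSup_of_mem k (hshift a u (hUa hu))) ?_
  induction hw using Submodule.iSup_induction' with
  | mem j y hy =>
    refine Submodule.mem_iSup_of_mem (j + k + 1) ?_
    have := hshift _ y hy
    convert this using 2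
    push_cast
    ring
  | zero => simp
  | add y z _ _ hy hz => rw [map_add]; exact add_mem hy hz

theorem eigenspace_le_of_cartanStable
    (hirr : LieModule.IsIrreducible ℂ (MapFullToroidal κ c₁ c₂ ν B) V) {ρ : H}
    (hρ : ∀ α : H.root, (α : LieModule.Weight ℂ H g) ρ = (base.height α : ℂ))
    {U : Submodule ℂ V} (hU0 : U ≠ ⊥) (hUT : U ≤ 𝐓) (hU : CartanStable H κ c₁ c₂ ν B U) {a : ℂ}
    (hUa : U ≤ (𝐋 (ρ : g) 0 (1 : B)).eigenspace a) :
    (𝐋 (ρ : g) 0 (1 : B)).eigenspace a ≤ U := by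
  intro v hv
  have h1 : v ∈ (⊤ : Submodule ℂ V) := Submodule.mem_top
  obtain ⟨u, hu, w, hw, rfl⟩ := Submodule.mem_sup.1 (top_le_of_cartanStable hirr hρ hU0 hUT hU hUa h1)
  have hdis := (Module.End.eigenspaces_iSupIndep (𝐋 (ρ : g) 0 (1 : B))) a
  have hw1 : w ∈ (𝐋 (ρ : g) 0 (1 : B)).eigenspace a := by
    have := sub_mem hv (hUa hu)
    rwa [add_sub_cancel_left] at this
  have hw2 : w ∈ ⨆ y, ⨆ (_ : y ≠ a), (𝐋 (ρ : g) 0 (1 : B)).eigenspace y := by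
    refine (iSup_le fun j => ?_ : (⨆ j : ℕ, (𝐋 (ρ : g) 0 (1 : B)).eigenspace (a - (j + 1))) ≤ _) hw
    refine le_iSup₂_of_le (a - (j + 1)) (fun h => ?_) le_rfl
    rw [sub_eq_self] at h
    exact Nat.cast_add_one_ne_zero j h
  have : w = 0 := Submodule.disjoint_def.1 hdis w hw1 hw2
  rwa [this, add_zero]

/-- A component of T below c would contain an eigenvector in T for some c - (j + 1). Generating V
from that eigenspace of T puts all of V strictly below c, which excludes w. -/
theorem highestSpace_eq_eigenspace
    (hirr : LieModule.IsIrreducible ℂ (MapFullToroidal κ c₁ c₂ ν B) V) {ρ : H}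
    (hρ : ∀ α : H.root, (α : LieModule.Weight ℂ H g) ρ = (base.height α : ℂ)) {c : ℂ} {w : V}
    (hw : w ∈ 𝐓) (hw0 : w ≠ 0) (hwc : w ∈ (𝐋 (ρ : g) 0 (1 : B)).eigenspace c) :
    𝐓 = (𝐋 (ρ : g) 0 (1 : B)).eigenspace c := by
  have hst : ∀ a, CartanStable H κ c₁ c₂ ν B (𝐓 ⊓ (𝐋 (ρ : g) 0 (1 : B)).eigenspace a) :=
    fun a => cartanStable_highestSpace.inf (cartanStable_eigenspace ρ a)
  have hne : (𝐓 ⊓ (𝐋 (ρ : g) 0 (1 : B)).eigenspace c) ≠ ⊥ :=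
    (Submodule.ne_bot_iff _).2 ⟨w, ⟨hw, hwc⟩, hw0⟩
  refine le_antisymm (fun v hv => ?_) ?_
  · have h1 : v ∈ (⊤ : Submodule ℂ V) := Submodule.mem_top
    obtain ⟨u, hu, z, hz, rfl⟩ := Submodule.mem_sup.1
      (top_le_of_cartanStable hirr hρ hne inf_le_left (hst c) inf_le_right h1)
    have hzT : z ∈ 𝐓 := by
      have := sub_mem hv hu.1
      rwa [add_sub_cancel_left] at this
    by_cases hz0 : z = 0
    · rw [hz0, add_zero]; exact hu.2
    exfalso
    obtain ⟨j, y, hy, hy0, hyj⟩ := exists_eigenvector_of_mem_iSup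
      (fun v hv => cartanStable_highestSpace.loop ρ 0 1 v hv) hzT hz0 hz
    have hne' : (𝐓 ⊓ (𝐋 (ρ : g) 0 (1 : B)).eigenspace (c - (j + 1))) ≠ ⊥ :=
      (Submodule.ne_bot_iff _).2 ⟨y, ⟨hy, hyj⟩, hy0⟩
    have h2 := top_le_of_cartanStable hirr hρ hne' inf_le_left (hst _) inf_le_right
    have hdis := (Module.End.eigenspaces_iSupIndep (𝐋 (ρ : g) 0 (1 : B))) c
    refine hw0 (Submodule.disjoint_def.1 hdis w hwc ?_)
    have h3 : w ∈ (⊤ : Submodule ℂ V) := Submodule.mem_top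
    refine (show _ ≤ ⨆ y, ⨆ (_ : y ≠ c), (𝐋 (ρ : g) 0 (1 : B)).eigenspace y from
      sup_le ?_ (iSup_le fun i => ?_)) (h2 h3)
    · refine inf_le_right.trans (le_iSup₂_of_le (c - (j + 1)) (fun h => ?_) le_rfl)
      rw [sub_eq_self] at h
      exact Nat.cast_add_one_ne_zero j h
    · refine le_iSup₂_of_le _ (fun h => ?_) le_rfl
      rw [sub_sub, sub_eq_self] at h
      have : ((j + i + 1 : ℕ) : ℂ) + 1 = 0 := by
        push_cast
        linear_combination h
      exact Nat.cast_add_one_ne_zero _ this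
  · exact (eigenspace_le_of_cartanStable hirr hρ hne inf_le_left (hst c) inf_le_right).trans
      inf_le_left

end Highest
end MapToroidal
end

noncomputable section
namespace MapToroidal

/-! ### The weight grading on the highest space -/

section Graded

open Module (End)
open LieAlgebra LieAlgebra.IsKilling

variable {g : Type*} [LieRing g] [LieAlgebra ℂ g]
  {H : LieSubalgebra ℂ g} {κ : InvForm g} {c₁ c₂ : ℂ} {ν : ℕ}
  {B : Type*} [CommRing B] [Algebra ℂ B]
  {V : Type*} [AddCommGroup V] [Module ℂ V] [LieRingModule (MapFullToroidal κ c₁ c₂ ν B) V]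
  [LieModule ℂ (MapFullToroidal κ c₁ c₂ ν B) V]

local notation "𝐋" => loopOp κ c₁ c₂ ν V
local notation "𝐊" => cenOp κ c₁ c₂ (ν := ν) V
local notation "𝐃" => derOp κ c₁ c₂ (ν := ν) V

namespace FullToroidal

theorem lie_cartan_loop {h : g} (hH : ∀ u : H, ⁅(u : g), h⁆ = 0)
    (u : H × (Fin (ν + 1) → ℂ) × (Fin (ν + 1) → ℂ)) (n : Exponent ν) :
    ⁅cartan κ c₁ c₂ H u, loop κ c₁ c₂ h n⁆ = (u.2.2 ⬝ᵥ vec n) • loop κ c₁ c₂ h n := by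
  rw [cartan, loop, lie_mk, formalBracket_single, ← map_smul, Finsupp.smul_single]
  have : vec (0 : Exponent ν) = 0 := by ext; simp [vec]
  simp [coeffBracket, cocycleCoeff, hH, this]

theorem lie_cartan_der (u : H × (Fin (ν + 1) → ℂ) × (Fin (ν + 1) → ℂ)) (m : Exponent ν)
    (q : Fin (ν + 1)) :
    ⁅cartan κ c₁ c₂ H u, der κ c₁ c₂ m q⁆ = (u.2.2 ⬝ᵥ vec m) • der κ c₁ c₂ m q := by
  have h0 : vec (0 : Exponent ν) = 0 := by ext; simp [vec]
  -- The central part of u contributes a multiple of ∑ mₚ t^m kₚ, which vanishes only modulo the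
  -- relations; it is added here so that representatives match.
  have h1 : (u.2.2 ⬝ᵥ vec m) • der κ c₁ c₂ m q = (u.2.2 ⬝ᵥ vec m) • der κ c₁ c₂ m q
      + (-u.2.1 q) • cenVec κ c₁ c₂ m (vec m) := by
    rw [cenVec_vec, smul_zero, add_zero]
  rw [h1, cenVec_apply, cartan, der, lie_mk, formalBracket_single, ← map_smul, ← map_smul,
    ← map_add, Finsupp.smul_single, Finsupp.smul_single, ← Finsupp.single_add]
  simp [coeffBracket, cocycleCoeff, h0]

end FullToroidal

/-- The functional `(h, a, b) ↦ ∑ₚ b p nₚ`, by which `t^𝐧` shifts weights. -/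
def degreeShift (H : LieSubalgebra ℂ g) (n : Exponent ν) :
    Module.Dual ℂ (H × (Fin (ν + 1) → ℂ) × (Fin (ν + 1) → ℂ)) :=
  (LinearMap.flip (dotProductBilin ℂ ℂ) (vec n)) ∘ₗ LinearMap.snd ℂ _ _ ∘ₗ LinearMap.snd ℂ _ _

theorem degreeShift_apply (n : Exponent ν) (u : H × (Fin (ν + 1) → ℂ) × (Fin (ν + 1) → ℂ)) :
    degreeShift H n u = u.2.2 ⬝ᵥ vec n := rfl

theorem degreeShift_add (m n : Exponent ν) :
    degreeShift H (m + n) = degreeShift H m + degreeShift H n := by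
  ext u <;> simp [degreeShift_apply, vec_add]

theorem mem_weightSpace {μ : Module.Dual ℂ (H × (Fin (ν + 1) → ℂ) × (Fin (ν + 1) → ℂ))} {v : V} :
    v ∈ weightSpace κ c₁ c₂ ν H B V μ
      ↔ ∀ u, ⁅(1 : B) ⊗ₜ[ℂ] FullToroidal.cartan κ c₁ c₂ H u, v⁆ = μ u • v := Iff.rfl

theorem toEnd_mem_weightSpace {X : FullToroidal κ c₁ c₂ ν} {m : Exponent ν}
    (hX : ∀ u, ⁅FullToroidal.cartan κ c₁ c₂ H u, X⁆ = (u.2.2 ⬝ᵥ vec m) • X) (b : B)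
    {μ : Module.Dual ℂ (H × (Fin (ν + 1) → ℂ) × (Fin (ν + 1) → ℂ))} {v : V}
    (hv : v ∈ weightSpace κ c₁ c₂ ν H B V μ) :
    LieModule.toEnd ℂ (MapFullToroidal κ c₁ c₂ ν B) V (b ⊗ₜ[ℂ] X) v
      ∈ weightSpace κ c₁ c₂ ν H B V (μ + degreeShift H m) := by
  rw [mem_weightSpace] at hv ⊢
  intro u
  have h1 := LinearMap.congr_fun
    (toEnd_tmul_mul κ c₁ c₂ (V := V) 1 b (FullToroidal.cartan κ c₁ c₂ H u) X) v
  rw [hX, one_mul, TensorProduct.tmul_smul, map_smul] at h1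
  simp only [Module.End.mul_apply, LinearMap.add_apply, LinearMap.smul_apply] at h1
  rw [← LieModule.toEnd_apply_apply ℂ, h1, LieModule.toEnd_apply_apply ℂ _ V (1 ⊗ₜ _) v, hv u,
    map_smul, LinearMap.add_apply, add_smul, degreeShift_apply]

theorem weightSpace_le_eigenspace
    (μ : Module.Dual ℂ (H × (Fin (ν + 1) → ℂ) × (Fin (ν + 1) → ℂ))) (ρ : H) :
    weightSpace κ c₁ c₂ ν H B V μ ≤ (𝐋 (ρ : g) 0 (1 : B)).eigenspace (μ (ρ, 0, 0)) := by
  intro v hv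
  rw [Module.End.mem_eigenspace_iff, ← mem_weightSpace.1 hv (ρ, 0, 0)]
  rfl

theorem derOp_mem_weightSpace (m : Exponent ν) (q : Fin (ν + 1)) (b : B)
    {μ : Module.Dual ℂ (H × (Fin (ν + 1) → ℂ) × (Fin (ν + 1) → ℂ))} {v : V}
    (hv : v ∈ weightSpace κ c₁ c₂ ν H B V μ) :
    𝐃 m q b v ∈ weightSpace κ c₁ c₂ ν H B V (μ + degreeShift H m) :=
  toEnd_mem_weightSpace (FullToroidal.lie_cartan_der · m q) b hv

variable [FiniteDimensional ℂ g] [LieAlgebra.IsSimple ℂ g] [H.IsCartanSubalgebra]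
  {base : (rootSystem H).Base}

local notation "𝐓" => highestSpace κ c₁ c₂ ν H B V base

theorem loopOp_cartan_mem_weightSpace (h : H) (n : Exponent ν) (b : B)
    {μ : Module.Dual ℂ (H × (Fin (ν + 1) → ℂ) × (Fin (ν + 1) → ℂ))} {v : V}
    (hv : v ∈ weightSpace κ c₁ c₂ ν H B V μ) :
    𝐋 (h : g) n b v ∈ weightSpace κ c₁ c₂ ν H B V (μ + degreeShift H n) :=
  toEnd_mem_weightSpace (FullToroidal.lie_cartan_loop (fun u => lie_cartan_eq_zero u h) · n) b hv

theorem exists_highestSpace_eq_eigenspace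
    (hirr : LieModule.IsIrreducible ℂ (MapFullToroidal κ c₁ c₂ ν B) V) {Λ : Module.Dual ℂ H}
    (hΛ : ∃ w ∈ 𝐓, w ≠ 0 ∧ ∀ h : H, 𝐋 (h : g) 0 (1 : B) w = Λ h • w) :
    ∃ ρ : H, 𝐓 = (𝐋 (ρ : g) 0 (1 : B)).eigenspace (Λ ρ) ∧
      ∀ U ≤ 𝐓, U ≠ ⊥ → CartanStable H κ c₁ c₂ ν B U → U = 𝐓 := by
  obtain ⟨ρ, hρ⟩ := exists_height_element base
  obtain ⟨w, hw, hw0, hwΛ⟩ := hΛ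
  have hT := highestSpace_eq_eigenspace hirr hρ hw hw0 (Module.End.mem_eigenspace_iff.2 (hwΛ ρ))
  refine ⟨ρ, hT, fun U hU hU0 hst => le_antisymm hU ?_⟩
  have h1 := eigenspace_le_of_cartanStable hirr hρ hU0 hU hst (hU.trans hT.le)
  exact hT.le.trans h1

theorem eq_highestSpace_of_cartanStable
    (hirr : LieModule.IsIrreducible ℂ (MapFullToroidal κ c₁ c₂ ν B) V) {Λ : Module.Dual ℂ H}
    (hΛ : ∃ w ∈ 𝐓, w ≠ 0 ∧ ∀ h : H, 𝐋 (h : g) 0 (1 : B) w = Λ h • w) {U : Submodule ℂ V}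
    (hU : U ≤ 𝐓) (hU0 : U ≠ ⊥) (hst : CartanStable H κ c₁ c₂ ν B U) : U = 𝐓 :=
  let ⟨_, _, h⟩ := exists_highestSpace_eq_eigenspace hirr hΛ
  h U hU hU0 hst

/-- The Λ(h)-eigenspace in T is stable and contains w, so it is T. -/
theorem loopOp_cartan_apply_of_mem
    (hirr : LieModule.IsIrreducible ℂ (MapFullToroidal κ c₁ c₂ ν B) V) {Λ : Module.Dual ℂ H}
    (hΛ : ∃ w ∈ 𝐓, w ≠ 0 ∧ ∀ h : H, 𝐋 (h : g) 0 (1 : B) w = Λ h • w) (h : H) {v : V}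
    (hv : v ∈ 𝐓) : 𝐋 (h : g) 0 (1 : B) v = Λ h • v := by
  have h1 : 𝐓 ⊓ (𝐋 (h : g) 0 (1 : B)).eigenspace (Λ h) = 𝐓 := by
    refine eq_highestSpace_of_cartanStable hirr hΛ inf_le_left ?_
      (cartanStable_highestSpace.inf (cartanStable_eigenspace h (Λ h)))
    obtain ⟨w, hw, hw0, hwΛ⟩ := hΛ
    exact (Submodule.ne_bot_iff _).2 ⟨w, ⟨hw, Module.End.mem_eigenspace_iff.2 (hwΛ h)⟩, hw0⟩
  rw [← h1] at hv
  exact Module.End.mem_eigenspace_iff.1 hv.2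

/-- Some nonzero weight space must have ρ-eigenvalue Λ ρ, otherwise independence of eigenspaces
would give w = 0. Degree shifts do not change the value at ρ, so all translates lie in T. -/
theorem exists_weightSpace_le_highestSpace
    (hirr : LieModule.IsIrreducible ℂ (MapFullToroidal κ c₁ c₂ ν B) V)
    (hV : ⨆ μ, weightSpace κ c₁ c₂ ν H B V μ = ⊤) {Λ : Module.Dual ℂ H}
    (hΛ : ∃ w ∈ 𝐓, w ≠ 0 ∧ ∀ h : H, 𝐋 (h : g) 0 (1 : B) w = Λ h • w) :
    ∃ μ, weightSpace κ c₁ c₂ ν H B V μ ≠ ⊥ ∧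
      ∀ n, weightSpace κ c₁ c₂ ν H B V (μ + degreeShift H n) ≤ 𝐓 := by
  obtain ⟨ρ, hT, -⟩ := exists_highestSpace_eq_eigenspace hirr hΛ
  obtain ⟨w, hw, hw0, hwΛ⟩ := hΛ
  by_contra! hcon
  have h1 : ⊤ ≤ ⨆ y, ⨆ (_ : y ≠ Λ ρ), (𝐋 (ρ : g) 0 (1 : B)).eigenspace y := by
    rw [← hV]
    refine iSup_le fun μ => ?_
    by_cases hμ : weightSpace κ c₁ c₂ ν H B V μ = ⊥
    · rw [hμ]; exact bot_le
    refine (weightSpace_le_eigenspace μ ρ).trans (le_iSup₂_of_le (μ (ρ, 0, 0)) (fun h => ?_) le_rfl)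
    obtain ⟨n, hn⟩ := hcon μ hμ
    refine hn ((weightSpace_le_eigenspace _ ρ).trans ?_)
    rw [LinearMap.add_apply, degreeShift_apply, zero_dotProduct, add_zero, h, hT]
  exact hw0 (Submodule.disjoint_def.1
    ((Module.End.eigenspaces_iSupIndep (𝐋 (ρ : g) 0 (1 : B))) (Λ ρ)) w (hT ▸ hw)
    (h1 Submodule.mem_top))

end Graded
end MapToroidal
end

noncomputable section
namespace MapToroidal

/-! ### Leading terms in a commuting parameter X -/

section LeadingTerm

variable {R Φ : Type*} [Ring R] [AddCommGroup Φ] [Module R Φ]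

/-- The span of the vectors `F a₁ ⋯ F aₘ Xⁱ w` with `i < d` and `w ∈ T`. -/
def wordSpan (X : R) (F : ℤ → R) (T : AddSubgroup Φ) : ℕ → ℕ → AddSubgroup Φ
  | 0, d => AddSubgroup.closure {φ | ∃ i < d, ∃ w ∈ T, φ = X ^ i • w}
  | M + 1, d => AddSubgroup.closure {φ | ∃ a, ∃ ψ ∈ wordSpan X F T M d, φ = F a • ψ}

variable {X E : R} {F G K H : ℤ → R} {T : AddSubgroup Φ}

theorem wordSpan_mono (M : ℕ) {d d' : ℕ} (h : d ≤ d') :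
    wordSpan X F T M d ≤ wordSpan X F T M d' := by
  induction M with
  | zero =>
    refine AddSubgroup.closure_mono ?_
    rintro φ ⟨i, hi, w, hw, rfl⟩
    exact ⟨i, hi.trans_le h, w, hw, rfl⟩
  | succ M ih =>
    refine AddSubgroup.closure_mono ?_
    rintro φ ⟨a, ψ, hψ, rfl⟩
    exact ⟨a, ψ, ih hψ, rfl⟩

theorem smul_mem_wordSpan (a : ℤ) {M d : ℕ} {φ : Φ} (hφ : φ ∈ wordSpan X F T M d) :
    F a • φ ∈ wordSpan X F T (M + 1) d :=
  AddSubgroup.subset_closure ⟨a, φ, hφ, rfl⟩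

theorem pow_smul_mem_wordSpan {i d : ℕ} (hi : i < d) {w : Φ} (hw : w ∈ T) :
    X ^ i • w ∈ wordSpan X F T 0 d :=
  AddSubgroup.subset_closure ⟨i, hi, w, hw, rfl⟩

theorem smul_mem_of_closure {S : Set Φ} {U : AddSubgroup Φ} {r : R} (h : ∀ φ ∈ S, r • φ ∈ U)
    {φ : Φ} (hφ : φ ∈ AddSubgroup.closure S) : r • φ ∈ U := by
  have : AddSubgroup.closure S ≤ U.comap (DistribSMul.toAddMonoidHom Φ r) :=
    (AddSubgroup.closure_le _).2 h
  exact this hφ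

/-- Moving G j to the right only shifts indices of the F's; acting on T it costs at most one power
of X, through X K j. -/
theorem cartan_smul_mem_wordSpan (hXK : ∀ j, Commute X (K j)) (hXH : ∀ j, Commute X (H j))
    (hG : ∀ j, G j = H j + X * K j) (hGF : ∀ j a, G j * F a = F a * G j - 2 • F (a + j))
    (hH : ∀ j, ∀ w ∈ T, H j • w ∈ T) (hK : ∀ j, ∀ w ∈ T, K j • w ∈ T) (j : ℤ) {M d : ℕ} {φ : Φ}
    (hφ : φ ∈ wordSpan X F T M d) : G j • φ ∈ wordSpan X F T M (d + 1) := by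
  induction M generalizing φ with
  | zero =>
    refine smul_mem_of_closure ?_ hφ
    rintro _ ⟨i, hi, w, hw, rfl⟩
    rw [hG, add_smul, mul_smul, smul_smul (H j), ← ((hXH j).pow_left i).eq, smul_smul (K j),
      ← ((hXK j).pow_left i).eq, mul_smul, mul_smul, smul_smul X, ← pow_succ']
    exact add_mem (pow_smul_mem_wordSpan (by omega) (hH j w hw))
      (pow_smul_mem_wordSpan (by omega) (hK j w hw))
  | succ M ih =>
    refine smul_mem_of_closure ?_ hφ
    rintro _ ⟨a, ψ, hψ, rfl⟩
    rw [smul_smul, hGF, sub_smul, mul_smul, smul_assoc]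
    exact sub_mem (smul_mem_wordSpan a (ih hψ))
      (nsmul_mem (smul_mem_wordSpan _ (wordSpan_mono M (Nat.le_succ d) hψ)) 2)

theorem raise_smul_zero (hXE : Commute X E) (hE : ∀ w ∈ T, E • w = 0) {d : ℕ} {φ : Φ}
    (hφ : φ ∈ wordSpan X F T 0 d) : E • φ = 0 := by
  rw [← AddSubgroup.mem_bot]
  refine smul_mem_of_closure ?_ hφ
  rintro _ ⟨i, hi, w, hw, rfl⟩
  rw [AddSubgroup.mem_bot, smul_smul, ← (hXE.pow_left i).eq, mul_smul, hE w hw, smul_zero]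

/-- E removes one F and leaves a G in its place, so it trades one F for at most one X. -/
theorem raise_smul_mem_wordSpan (hXE : Commute X E) (hE : ∀ w ∈ T, E • w = 0)
    (hEF : ∀ a, E * F a = F a * E + G (a + 1))
    (hGmem : ∀ (j : ℤ) (M d : ℕ), ∀ φ ∈ wordSpan X F T M d, G j • φ ∈ wordSpan X F T M (d + 1))
    {M d : ℕ} {φ : Φ} (hφ : φ ∈ wordSpan X F T (M + 1) d) :
    E • φ ∈ wordSpan X F T M (d + 1) := by
  induction M generalizing φ with
  | zero =>
    refine smul_mem_of_closure ?_ hφ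
    rintro _ ⟨a, ψ, hψ, rfl⟩
    rw [smul_smul, hEF, add_smul, mul_smul, raise_smul_zero hXE hE hψ, smul_zero, zero_add]
    exact hGmem _ _ _ _ hψ
  | succ M ih =>
    refine smul_mem_of_closure ?_ hφ
    rintro _ ⟨a, ψ, hψ, rfl⟩
    rw [smul_smul, hEF, add_smul, mul_smul]
    exact add_mem (smul_mem_wordSpan a (ih hψ)) (hGmem _ _ _ _ hψ)

theorem pow_lower_smul_mem_wordSpan (r : ℕ) {M d : ℕ} {φ : Φ} (hφ : φ ∈ wordSpan X F T M d) :
    F 0 ^ r • φ ∈ wordSpan X F T (r + M) d := by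
  induction r with
  | zero => simpa using hφ
  | succ r ih =>
    rw [pow_succ', mul_smul, add_right_comm]
    exact smul_mem_wordSpan 0 ih

/-- Only the summand X K 1, carried unchanged to the end, raises the power of X; the commutators
with F do not. -/
theorem cartan_smul_pow_sub_mem (hXK : ∀ j, Commute X (K j)) (hXH : ∀ j, Commute X (H j))
    (hG : ∀ j, G j = H j + X * K j) (hGF : ∀ j a, G j * F a = F a * G j - 2 • F (a + j))
    (hH : ∀ j, ∀ w ∈ T, H j • w ∈ T) (r i : ℕ) {w : Φ} (hw : w ∈ T) :
    G 1 • F 0 ^ r • X ^ i • w - F 0 ^ r • X ^ (i + 1) • K 1 • w ∈ wordSpan X F T r (i + 1) := by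
  induction r with
  | zero =>
    rw [pow_zero, one_smul, one_smul, hG, add_smul, mul_smul, smul_smul (H 1),
      ← ((hXH 1).pow_left i).eq, smul_smul (K 1), ← ((hXK 1).pow_left i).eq, mul_smul, mul_smul,
      smul_smul X, ← pow_succ', add_sub_cancel_right]
    exact pow_smul_mem_wordSpan (by omega) (hH 1 w hw)
  | succ r ih =>
    have h1 : G 1 • F 0 ^ (r + 1) • X ^ i • w - F 0 ^ (r + 1) • X ^ (i + 1) • K 1 • w
        = F 0 • (G 1 • F 0 ^ r • X ^ i • w - F 0 ^ r • X ^ (i + 1) • K 1 • w)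
          - 2 • F (0 + 1) • F 0 ^ r • X ^ i • w := by
      rw [pow_succ' (F 0) r, mul_smul, mul_smul, smul_smul (G 1), hGF, sub_smul, mul_smul,
        smul_assoc, smul_sub]
      abel
    rw [h1]
    exact sub_mem (smul_mem_wordSpan 0 ih) (nsmul_mem (smul_mem_wordSpan _
      (pow_lower_smul_mem_wordSpan r (pow_smul_mem_wordSpan (Nat.lt_succ_self i) hw))) 2)

/-- Each of the M + 1 positions at which E can meet F 0 contributes the same leading term. -/
theorem raise_smul_pow_sub_mem (hXE : Commute X E) (hE : ∀ w ∈ T, E • w = 0)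
    (hEF : ∀ a, E * F a = F a * E + G (a + 1))
    (hXK : ∀ j, Commute X (K j)) (hXH : ∀ j, Commute X (H j))
    (hG : ∀ j, G j = H j + X * K j) (hGF : ∀ j a, G j * F a = F a * G j - 2 • F (a + j))
    (hH : ∀ j, ∀ w ∈ T, H j • w ∈ T) (M i : ℕ) {w : Φ} (hw : w ∈ T) :
    E • F 0 ^ (M + 1) • X ^ i • w - (M + 1) • F 0 ^ M • X ^ (i + 1) • K 1 • w
      ∈ wordSpan X F T M (i + 1) := by
  induction M with
  | zero =>
    have h1 := cartan_smul_pow_sub_mem hXK hXH hG hGF hH 0 i hw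
    rw [pow_zero, one_smul, one_smul] at h1
    have h2 := raise_smul_zero (F := F) hXE hE (pow_smul_mem_wordSpan (Nat.lt_succ_self i) hw)
    rw [pow_zero, zero_add, pow_one, one_smul, one_smul, smul_smul, hEF, add_smul, mul_smul,
      h2, smul_zero, zero_add, zero_add]
    exact h1
  | succ M ih =>
    have h1 := cartan_smul_pow_sub_mem hXK hXH hG hGF hH (M + 1) i hw
    have h2 : E • F 0 ^ (M + 1 + 1) • X ^ i • w
          - (M + 1 + 1) • F 0 ^ (M + 1) • X ^ (i + 1) • K 1 • w
        = F 0 • (E • F 0 ^ (M + 1) • X ^ i • w - (M + 1) • F 0 ^ M • X ^ (i + 1) • K 1 • w)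
          + (G 1 • F 0 ^ (M + 1) • X ^ i • w - F 0 ^ (M + 1) • X ^ (i + 1) • K 1 • w) := by
      rw [pow_succ' (F 0) (M + 1), mul_smul, smul_smul E, hEF, zero_add, add_smul, mul_smul,
        smul_sub, smul_comm (F 0) (M + 1), smul_smul (F 0) (F 0 ^ M), ← pow_succ',
        succ_nsmul _ (M + 1)]
      abel
    rw [h2]
    exact add_mem (smul_mem_wordSpan 0 ih) h1

/-- Iteration multiplies the factors M, M - 1, …, 1, and lower-order errors remain lower-order under
every further E. -/
theorem pow_raise_smul_pow_sub_mem (hXE : Commute X E) (hE : ∀ w ∈ T, E • w = 0)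
    (hEF : ∀ a, E * F a = F a * E + G (a + 1))
    (hXK : ∀ j, Commute X (K j)) (hXH : ∀ j, Commute X (H j))
    (hG : ∀ j, G j = H j + X * K j) (hGF : ∀ j a, G j * F a = F a * G j - 2 • F (a + j))
    (hH : ∀ j, ∀ w ∈ T, H j • w ∈ T) (hK : ∀ j, ∀ w ∈ T, K j • w ∈ T) (M i : ℕ) {w : Φ}
    (hw : w ∈ T) :
    E ^ M • F 0 ^ M • X ^ i • w - M.factorial • X ^ (M + i) • K 1 ^ M • w
      ∈ wordSpan X F T 0 (M + i) := by
  have hpow : ∀ (M d : ℕ), ∀ φ ∈ wordSpan X F T M d, E ^ M • φ ∈ wordSpan X F T 0 (M + d) := by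
    intro M
    induction M with
    | zero => intro d φ hφ; simpa using hφ
    | succ M ih =>
      intro d φ hφ
      have := ih _ _ (raise_smul_mem_wordSpan hXE hE hEF
        (fun j M d φ hφ => cartan_smul_mem_wordSpan hXK hXH hG hGF hH hK j hφ) hφ)
      rwa [smul_smul, ← pow_succ, ← add_assoc, add_right_comm] at this
  induction M generalizing i w with
  | zero => simp
  | succ M ih =>
    have h1 := hpow _ _ _ (raise_smul_pow_sub_mem hXE hE hEF hXK hXH hG hGF hH M i hw)
    have h2 := nsmul_mem (ih (i + 1) (hK 1 w hw)) (M + 1)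
    have h3 : E ^ (M + 1) • F 0 ^ (M + 1) • X ^ i • w
          - (M + 1).factorial • X ^ (M + 1 + i) • K 1 ^ (M + 1) • w
        = E ^ M • (E • F 0 ^ (M + 1) • X ^ i • w - (M + 1) • F 0 ^ M • X ^ (i + 1) • K 1 • w)
          + (M + 1) • (E ^ M • F 0 ^ M • X ^ (i + 1) • K 1 • w
            - M.factorial • X ^ (M + (i + 1)) • K 1 ^ M • K 1 • w) := by
      rw [smul_sub, smul_smul (E ^ M) E, ← pow_succ, smul_comm (E ^ M) (M + 1), smul_sub,
        smul_smul (K 1 ^ M), ← pow_succ, smul_smul (M + 1) M.factorial, ← Nat.factorial_succ,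
        show M + (i + 1) = M + 1 + i by ring]
      abel
    rw [h3]
    refine add_mem ?_ ?_
    · rwa [show M + 1 + i = M + (i + 1) by ring]
    · rwa [show M + 1 + i = M + (i + 1) by ring]

end LeadingTerm

/-! ### From leading terms to nilpotency -/

section Specialisation

open Module (End)

variable {V : Type*} [AddCommGroup V] [Module ℂ V]

/-- A nilpotency criterion: the coefficient of the top power of `l` in `E(l) ^ M F(l) ^ M w`. -/
theorem pow_apply_eq_zero_of_family {E : ℤ → End ℂ V} {F : ℤ → ℤ → End ℂ V} {H K : ℤ → End ℂ V}
    {T : Submodule ℂ V} (hE : ∀ l, ∀ w ∈ T, E l w = 0)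
    (hEF : ∀ l a, E l * F l a = F l a * E l + (H (a + 1) + (l : ℂ) • K (a + 1)))
    (hHF : ∀ (l : ℤ) j a, (H j + (l : ℂ) • K j) * F l a
      = F l a * (H j + (l : ℂ) • K j) - (2 : ℕ) • F l (a + j))
    (hH : ∀ j, ∀ w ∈ T, H j w ∈ T) (hK : ∀ j, ∀ w ∈ T, K j w ∈ T) {M : ℕ} {w : V} (hw : w ∈ T)
    (hF : ∀ l, (F l 0 ^ M) w = 0) : (K 1 ^ M) w = 0 := by
  -- The ring is that of functions of l, with X the function l ↦ l · 1 and T' the constant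
  -- functions, so that one identity covers all l.
  let X : ℤ → End ℂ V := fun l => (l : ℂ) • 1
  let T' : AddSubgroup (ℤ → V) :=
    { carrier := {φ | ∃ w ∈ T, φ = fun _ => w}
      zero_mem' := ⟨0, zero_mem T, rfl⟩
      add_mem' := by
        rintro _ _ ⟨v, hv, rfl⟩ ⟨w, hw, rfl⟩
        exact ⟨v + w, add_mem hv hw, rfl⟩
      neg_mem' := by
        rintro _ ⟨v, hv, rfl⟩
        exact ⟨-v, neg_mem hv, rfl⟩ }
  have hX : ∀ A : ℤ → End ℂ V, Commute X A := fun A => funext fun l => by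
    change ((l : ℂ) • (1 : End ℂ V)) * A l = A l * ((l : ℂ) • 1)
    rw [smul_mul_assoc, mul_smul_comm, one_mul, mul_one]
  have key := pow_raise_smul_pow_sub_mem (X := X) (E := E) (F := fun a l => F l a)
    (G := fun j l => H j + (l : ℂ) • K j) (K := fun j _ => K j) (H := fun j _ => H j) (T := T')
    (hX E)
    (by rintro _ ⟨w, hw, rfl⟩; exact funext fun l => hE l w hw)
    (fun a => funext fun l => hEF l a) (fun j => hX _) (fun j => hX _)
    (fun j => funext fun l => by
      change _ = H j + ((l : ℂ) • (1 : End ℂ V)) * K j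
      rw [smul_mul_assoc, one_mul])
    (fun j a => funext fun l => hHF l j a)
    (by rintro j _ ⟨w, hw, rfl⟩; exact ⟨H j w, hH j w hw, rfl⟩)
    (by rintro j _ ⟨w, hw, rfl⟩; exact ⟨K j w, hK j w hw, rfl⟩)
    M 0 ⟨w, hw, rfl⟩
  have hXpow : ∀ (i : ℕ) (φ : ℤ → V) (l : ℤ), (X ^ i • φ) l = (l : ℂ) ^ i • φ l := by
    intro i φ l
    change (((l : ℂ) • (1 : End ℂ V)) ^ i) (φ l) = _
    rw [smul_pow, one_pow]
    rfl
  -- Seen through a linear functional, the error term is a polynomial in l of degree less than d.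
  have hpoly : ∀ (f : Module.Dual ℂ V) (d : ℕ), ∀ φ ∈ wordSpan X (fun a l => F l a) T' 0 d,
      ∃ P : Polynomial ℂ, P.degree < d ∧ ∀ l : ℤ, f (φ l) = P.eval (l : ℂ) := by
    intro f d φ hφ
    induction hφ using AddSubgroup.closure_induction with
    | mem φ h =>
      obtain ⟨i, hi, _, ⟨w, hw, rfl⟩, rfl⟩ := h
      refine ⟨Polynomial.C (f w) * Polynomial.X ^ i,
        (Polynomial.degree_C_mul_X_pow_le _ _).trans_lt (by exact_mod_cast hi), fun l => ?_⟩
      change f ((X ^ i • (fun _ : ℤ => w)) l) = _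
      rw [hXpow, map_smul, Polynomial.eval_mul, Polynomial.eval_C, Polynomial.eval_pow,
        Polynomial.eval_X, smul_eq_mul, mul_comm]
    | zero => exact ⟨0, by simp, fun l => by simp⟩
    | add φ ψ _ _ h h' =>
      obtain ⟨P, hP, hP'⟩ := h
      obtain ⟨Q, hQ, hQ'⟩ := h'
      refine ⟨P + Q, (Polynomial.degree_add_le _ _).trans_lt (max_lt hP hQ), fun l => ?_⟩
      simp [hP', hQ']
    | neg φ _ h =>
      obtain ⟨P, hP, hP'⟩ := h
      exact ⟨-P, by rwa [Polynomial.degree_neg], fun l => by simp [hP']⟩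
  by_contra hne
  obtain ⟨f, hf⟩ : ∃ f : Module.Dual ℂ V, f ((K 1 ^ M) w) ≠ 0 := by
    by_contra! h
    exact hne ((Module.forall_dual_apply_eq_zero_iff ℂ _).1 h)
  obtain ⟨P, hP, hP'⟩ := hpoly f _ _ key
  have h1 : ∀ l : ℤ, P.eval (l : ℂ) = -(M.factorial * (l : ℂ) ^ M * f ((K 1 ^ M) w)) := by
    intro l
    rw [← hP']
    have h2 : (E ^ M • (fun l => F l 0) ^ M • X ^ 0 • (fun _ : ℤ => w)) l = 0 := by
      change (E l ^ M) ((F l 0 ^ M) ((X ^ 0 • (fun _ : ℤ => w)) l)) = 0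
      rw [hXpow, pow_zero, one_smul, hF, map_zero]
    have h3 : (M.factorial • X ^ (M + 0) • (fun _ : ℤ => K 1) ^ M • (fun _ : ℤ => w)) l
        = M.factorial • (l : ℂ) ^ M • (K 1 ^ M) w := by
      rw [Pi.smul_apply, hXpow]
      rfl
    rw [Pi.sub_apply, h2, h3, zero_sub, map_neg, map_nsmul, map_smul, nsmul_eq_mul, smul_eq_mul]
    ring
  -- The two polynomials agree at every integer, but the right one has degree M while P has degree
  -- less than M.
  have h2 : P = -(Polynomial.C (M.factorial * f ((K 1 ^ M) w)) * Polynomial.X ^ M) := by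
    refine Polynomial.eq_of_infinite_eval_eq _ _ ?_
    refine (Set.infinite_range_of_injective (f := fun l : ℤ => (l : ℂ)) Int.cast_injective).mono ?_
    rintro _ ⟨l, rfl⟩
    rw [Set.mem_ofPred_eq, h1, Polynomial.eval_neg, Polynomial.eval_mul, Polynomial.eval_C,
      Polynomial.eval_pow, Polynomial.eval_X]
    ring
  have h3 := Polynomial.coeff_eq_zero_of_degree_lt (n := M) (by simpa using hP)
  rw [h2, Polynomial.coeff_neg, Polynomial.coeff_C_mul_X_pow, if_pos rfl, neg_eq_zero] at h3
  exact mul_ne_zero (Nat.cast_ne_zero.2 M.factorial_ne_zero) hf h3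

end Specialisation
end MapToroidal
end

noncomputable section
namespace MapToroidal

/-! ### Vanishing of 𝒦 ⊗ B on the highest space -/

section CentralNilpotency

open Module (End)
open LieAlgebra LieAlgebra.IsKilling

section Linear

variable {V : Type*} [AddCommGroup V] [Module ℂ V]

theorem raise_pow_lower_apply {e f h : End ℂ V} (hef : e * f = f * e + h)
    (hhf : h * f = f * h - (2 : ℕ) • f) {w : V} {N : ℂ} (he : e w = 0) (hw : h w = N • w) (n : ℕ) :
    e ((f ^ (n + 1)) w) = ((n + 1) * (N - n)) • (f ^ n) w := by
  have hh : ∀ n : ℕ, h ((f ^ n) w) = (N - 2 * n) • (f ^ n) w := by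
    intro n
    induction n with
    | zero => simpa using hw
    | succ n ih =>
      have h1 := LinearMap.congr_fun hhf ((f ^ n) w)
      simp only [Module.End.mul_apply, LinearMap.sub_apply, LinearMap.smul_apply] at h1
      rw [pow_succ', Module.End.mul_apply, h1, ih, map_smul, ← Nat.cast_smul_eq_nsmul ℂ, ← sub_smul]
      push_cast
      ring_nf
  induction n with
  | zero =>
    have h1 := LinearMap.congr_fun hef w
    simp only [Module.End.mul_apply, LinearMap.add_apply, he, map_zero, zero_add] at h1
    simp [h1, hw]
  | succ n ih =>
    have h1 := LinearMap.congr_fun hef ((f ^ (n + 1)) w)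
    simp only [Module.End.mul_apply, LinearMap.add_apply] at h1
    rw [pow_succ' f (n + 1), Module.End.mul_apply, h1, ih, map_smul, ← Module.End.mul_apply f,
      ← pow_succ', hh, ← add_smul]
    push_cast
    ring_nf

/-- At the last nonzero f^n w, raising f^(n+1) w = 0 gives (n + 1)(N - n) = 0. -/
theorem exists_natCast_eq_of_locallyNilpotent {e f h : End ℂ V} (hef : e * f = f * e + h)
    (hhf : h * f = f * h - (2 : ℕ) • f) {w : V} {N : ℂ} (hw0 : w ≠ 0) (he : e w = 0)
    (hw : h w = N • w) (hf : ∃ n, (f ^ n) w = 0) : ∃ n : ℕ, (n : ℂ) = N ∧ (f ^ (n + 1)) w = 0 := by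
  classical
  obtain ⟨n, hn⟩ : ∃ n, Nat.find hf = n + 1 := by
    refine Nat.exists_eq_succ_of_ne_zero fun h0 => hw0 ?_
    have := Nat.find_spec hf
    rw [h0] at this
    simpa using this
  have h1 : (f ^ (n + 1)) w = 0 := hn ▸ Nat.find_spec hf
  have h2 : (f ^ n) w ≠ 0 := Nat.find_min hf (by omega)
  refine ⟨n, ?_, h1⟩
  have h3 := raise_pow_lower_apply hef hhf he hw n
  rw [h1, map_zero, eq_comm, smul_eq_zero, or_iff_left h2, mul_eq_zero,
    or_iff_right (Nat.cast_add_one_ne_zero n), sub_eq_zero] at h3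
  exact h3.symm

variable {A : Type*} [Ring A] [Algebra ℂ A] [Module A V] [IsScalarTower ℂ A V]

/-- A nonzero vector in the image of the last power of S that does not vanish on W is killed by S.
-/
theorem exists_ne_zero_forall_apply_eq_zero {S : Submodule ℂ A} {W : Submodule ℂ V}
    (hW : W ≠ ⊥) (hS : ∀ s ∈ S, ∀ v ∈ W, s • v ∈ W) {M : ℕ}
    (hM : ∀ s ∈ S ^ M, ∀ v ∈ W, s • v = 0) : ∃ v ∈ W, v ≠ 0 ∧ ∀ s ∈ S, s • v = 0 := by
  have hSM : ∀ M : ℕ, ∀ s ∈ S ^ M, ∀ v ∈ W, s • v ∈ W := by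
    intro M
    induction M with
    | zero =>
      intro s hs v hv
      rw [pow_zero, Submodule.mem_one] at hs
      obtain ⟨a, rfl⟩ := hs
      rw [algebraMap_smul]
      exact W.smul_mem a hv
    | succ M ih =>
      intro s hs v hv
      rw [pow_succ'] at hs
      induction hs using Submodule.mul_induction_on' with
      | mem_mul_mem a ha b hb => rw [mul_smul]; exact hS a ha _ (ih b hb v hv)
      | add a _ b _ h h' => rw [add_smul]; exact W.add_mem h h'
  induction M with
  | zero =>
    obtain ⟨v, hv, hv0⟩ := Submodule.exists_mem_ne_zero_of_ne_bot hW
    have := hM 1 (by rw [pow_zero]; exact Submodule.one_le.1 le_rfl) v hv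
    exact absurd (by rwa [one_smul] at this) hv0
  | succ M ih =>
    by_cases h : ∀ s ∈ S ^ M, ∀ v ∈ W, s • v = 0
    · exact ih h
    push Not at h
    obtain ⟨s, hs, v, hv, hsv⟩ := h
    refine ⟨s • v, hSM M s hs v hv, hsv, fun t ht => ?_⟩
    have := hM (t * s) (by rw [pow_succ']; exact Submodule.mul_mem_mul ht hs) v hv
    rwa [mul_smul] at this

theorem commutator_mem_pow {S : Submodule ℂ A} {D : A}
    (hD : ∀ s ∈ S, D * s - s * D ∈ S) (j : ℕ) : ∀ s ∈ S ^ j, D * s - s * D ∈ S ^ j := by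
  induction j with
  | zero =>
    intro s hs
    rw [pow_zero, Submodule.mem_one] at hs
    obtain ⟨a, rfl⟩ := hs
    rw [Algebra.commutes a D, sub_self]
    exact zero_mem _
  | succ j ih =>
    intro s hs
    rw [pow_succ'] at hs ⊢
    induction hs using Submodule.mul_induction_on' with
    | mem_mul_mem a ha b hb =>
      have : D * (a * b) - a * b * D = (D * a - a * D) * b + a * (D * b - b * D) := by noncomm_ring
      rw [this]
      exact add_mem (Submodule.mul_mem_mul (hD a ha) hb) (Submodule.mul_mem_mul ha (ih b hb))
    | add a _ b _ h h' =>
      have : D * (a + b) - (a + b) * D = (D * a - a * D) + (D * b - b * D) := by noncomm_ring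
      rw [this]
      exact add_mem h h'

/-- Polarisation by derivations: starting from x^M = 0, the factors x are exchanged one by one for
arbitrary elements of S, each obtained as a commutator of x with some D. -/
theorem mul_apply_eq_zero_of_pow {S : Submodule ℂ A} {𝒟 : Set A} {x : A}
    {T : Submodule ℂ V} {M : ℕ} (hx : ∀ s ∈ S, s * x = x * s)
    (h𝒟S : ∀ D ∈ 𝒟, ∀ s ∈ S, D * s - s * D ∈ S) (h𝒟T : ∀ D ∈ 𝒟, ∀ v ∈ T, D • v ∈ T)
    (hS : S ≤ Submodule.span ℂ {y | y ∈ S ∧ ∃ D ∈ 𝒟, D * x = x * D + y})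
    (hM : ∀ v ∈ T, (x ^ M) • v = 0) : ∀ s ∈ S ^ M, ∀ v ∈ T, s • v = 0 := by
  suffices h : ∀ k j, k + j = M → ∀ s ∈ S ^ j, ∀ v ∈ T, x ^ k • s • v = 0 by
    simpa using h 0 M (zero_add M)
  intro k j hkj
  induction j generalizing k with
  | zero =>
    intro s hs v hv
    rw [pow_zero, Submodule.mem_one] at hs
    obtain ⟨a, rfl⟩ := hs
    obtain rfl : k = M := hkj
    rw [algebraMap_smul, smul_algebra_smul_comm, hM v hv, smul_zero]
  | succ j ih =>
    intro s hs v hv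
    rw [pow_succ'] at hs
    induction hs using Submodule.mul_induction_on' with
    | add a _ b _ h h' => rw [add_smul, smul_add, h, h', add_zero]
    | mem_mul_mem y hy s hs =>
      have hyspan := hS hy
      clear hy
      induction hyspan using Submodule.span_induction with
      | zero => simp
      | add a b _ _ h h' => rw [add_mul, add_smul, smul_add, h, h', add_zero]
      | smul c a _ h => rw [smul_mul_assoc, smul_assoc, smul_algebra_smul_comm, h, smul_zero]
      | mem y hy =>
        obtain ⟨hyS, D, hD, hDx⟩ := hy
        -- D is applied to x^(k+1) s v = 0. The terms in which D passes x^(k+1) vanish by induction,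
        -- because T and S^j are stable under D; what is left is (k + 1) y x^k s v.
        have h1 := congrArg (· • s • v) (mul_pow_succ_of_commutator hDx (hx y hyS) k)
        have h2 : D • s • v = s • D • v + (D * s - s * D) • v := by
          rw [sub_smul, mul_smul, mul_smul, add_sub_cancel]
        have h3 := ih (k + 1) (by omega)
        rw [← Nat.cast_smul_eq_nsmul ℂ] at h1
        simp only [mul_smul, add_smul, smul_assoc] at h1
        rw [h3 s hs v hv, smul_zero, h2, smul_add, h3 s hs _ (h𝒟T D hD v hv),
          h3 _ (commutator_mem_pow (h𝒟S D hD) j s hs) v hv, zero_add, zero_add, eq_comm,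
          smul_eq_zero,
          or_iff_right (Nat.cast_ne_zero.2 k.succ_ne_zero)] at h1
        have h4 : y * x ^ k = x ^ k * y := Commute.pow_right (hx y hyS) k
        rw [mul_smul, smul_smul, ← h4, mul_smul]
        exact h1

end Linear

variable {g : Type*} [LieRing g] [LieAlgebra ℂ g]
  {H : LieSubalgebra ℂ g} {κ : InvForm g} {c₁ c₂ : ℂ} {ν : ℕ}
  {B : Type*} [CommRing B] [Algebra ℂ B]
  {V : Type*} [AddCommGroup V] [Module ℂ V] [LieRingModule (MapFullToroidal κ c₁ c₂ ν B) V]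
  [LieModule ℂ (MapFullToroidal κ c₁ c₂ ν B) V]

local notation "𝐋" => loopOp κ c₁ c₂ ν V
local notation "𝐊" => cenOp κ c₁ c₂ (ν := ν) V
local notation "𝐃" => derOp κ c₁ c₂ (ν := ν) V

theorem ZeroCentralCharge.cenOp_eq_zero (hc : ZeroCentralCharge κ c₁ c₂ ν B V)
    (k : Fin (ν + 1) → ℂ) : 𝐊 0 k (1 : B) = 0 := by
  rw [cenOp_eq_sum]
  refine Finset.sum_eq_zero fun p _ => ?_
  rw [show 𝐊 0 (Pi.single p 1) (1 : B) = 0 from LinearMap.ext fun v => hc p v, smul_zero]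

theorem loopOp_triple_opposite (hc : ZeroCentralCharge κ c₁ c₂ ν B V) {h e f : g}
    (ht : IsFormTriple κ h e f) {m n : Exponent ν} (hmn : m + n = 0) :
    𝐋 e m (1 : B) * 𝐋 f n (1 : B) = 𝐋 f n (1 : B) * 𝐋 e m (1 : B) + 𝐋 h 0 (1 : B) := by
  rw [loopOp_mul_loopOp, ht.triple.lie_e_f, hmn, one_mul, hc.cenOp_eq_zero, smul_zero, add_zero]

theorem loopOp_triple_h_f {h e f : g} (ht : IsFormTriple κ h e f) (m n : Exponent ν) (b c : B) :
    𝐋 h m b * 𝐋 f n c = 𝐋 f n c * 𝐋 h m b - (2 : ℕ) • 𝐋 f (m + n) (b * c) := by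
  rw [loopOp_mul_loopOp, ht.triple.lie_h_f_nsmul, ht.form_h_f, zero_smul, add_zero,
    show -(2 • f) = (-2 : ℂ) • f by
      rw [neg_smul, ofNat_smul_eq_nsmul ℂ], loopOp_smul,
    neg_smul, ofNat_smul_eq_nsmul ℂ, ← sub_eq_add_neg]

/-- For a ≠ 0 this is the relation ∑ nₚ t^n kₚ = 0 at n = a e_q; for a = 0 it is the vanishing of
the central charge. -/
theorem cenOp_basisExp (hc : ZeroCentralCharge κ c₁ c₂ ν B V) (q : Fin (ν + 1)) (a : ℤ) :
    𝐊 (a • basisExp q) (vec (basisExp q)) (1 : B) = 0 := by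
  by_cases ha : a = 0
  · rw [ha, zero_smul, hc.cenOp_eq_zero]
  · have h1 : vec (a • basisExp q : Exponent ν) = (a : ℂ) • vec (basisExp q) := by
      ext i; simp [vec]
    have h2 := cenOp_vec κ c₁ c₂ (V := V) (a • basisExp q) (1 : B)
    rw [h1, cenOp_smul, smul_eq_zero] at h2
    exact h2.resolve_left (Int.cast_ne_zero.2 ha)

/-- The translation by ±l in direction p cancels in e(l) f(l) except in the central term, which is
linear in l; the contribution of direction q to that term vanishes by `cenOp_basisExp`. -/
theorem cenOp_pow_apply_eq_zero (hc : ZeroCentralCharge κ c₁ c₂ ν B V) {h e f : g}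
    (ht : IsFormTriple κ h e f) {T : Submodule ℂ V} (he : ∀ n, ∀ w ∈ T, 𝐋 e n (1 : B) w = 0)
    (hh : ∀ n, ∀ w ∈ T, 𝐋 h n (1 : B) w ∈ T) (hK : ∀ n k, ∀ w ∈ T, 𝐊 n k (1 : B) w ∈ T) {M : ℕ}
    (hf : ∀ n, ∀ w ∈ T, (𝐋 f n (1 : B) ^ M) w = 0) {p q : Fin (ν + 1)} {w : V}
    (hw : w ∈ T) : (𝐊 (basisExp q) (vec (basisExp p)) (1 : B) ^ M) w = 0 := by
  have key := pow_apply_eq_zero_of_family (T := T) (M := M) (w := w)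
    (E := fun l => 𝐋 e (l • basisExp p + basisExp q) (1 : B))
    (F := fun l a => 𝐋 f (-(l • basisExp p) + a • basisExp q) (1 : B))
    (H := fun j => 𝐋 h (j • basisExp q) (1 : B))
    (K := fun j => κ.form e f • 𝐊 (j • basisExp q) (vec (basisExp p)) (1 : B))
    (fun l w hw => he _ w hw) ?_ ?_ (fun j w hw => hh _ w hw)
    (fun j w hw => T.smul_mem _ (hK _ _ w hw)) hw (fun l => hf _ w hw)
  · rw [smul_pow, LinearMap.smul_apply, smul_eq_zero, one_smul] at key
    exact key.resolve_left (pow_ne_zero _ ht.form_e_f)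
  · intro l a
    have h1 : (l • basisExp p + basisExp q) + (-(l • basisExp p) + a • basisExp q)
        = (a + 1) • (basisExp q : Exponent ν) := by module
    have h2 : vec (l • basisExp p : Exponent ν) = (l : ℂ) • vec (basisExp p) := by
      ext i; simp [vec]
    rw [loopOp_mul_loopOp, h1, ht.triple.lie_e_f, mul_one, vec_add, cenOp_add, cenOp_basisExp hc,
      add_zero, h2, cenOp_smul, add_assoc, smul_comm (l : ℂ)]
  · intro l j a
    rw [add_mul, mul_add, loopOp_triple_h_f ht, smul_mul_assoc, smul_mul_assoc, mul_smul_comm,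
      mul_smul_comm, cenOp_mul_loopOp, mul_one, show j • basisExp q + (-(l • basisExp p)
        + a • basisExp q) = -(l • basisExp p) + (a + j) • (basisExp q : Exponent ν) by module]
    abel

variable [FiniteDimensional ℂ g] [LieAlgebra.IsSimple ℂ g] [H.IsCartanSubalgebra]
  {base : (rootSystem H).Base}

local notation "𝐓" => highestSpace κ c₁ c₂ ν H B V base

/-- The exponent is read off from the h-eigenvalue N, hence is the same for every m and every vector
of T. -/
theorem exists_loopOp_pow_eq_zero (hV : IsIntegrable κ c₁ c₂ ν H B V)
    (hc : ZeroCentralCharge κ c₁ c₂ ν B V) {α : H.root} (hα : base.IsPos α) {h e f : g}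
    (ht : IsFormTriple κ h e f) (he : e ∈ rootSpace H (α : LieModule.Weight ℂ H g))
    (hf : f ∈ rootSpace H (-(α : LieModule.Weight ℂ H g))) {N : ℂ} (hT : 𝐓 ≠ ⊥)
    (hN : ∀ w ∈ 𝐓, 𝐋 h 0 (1 : B) w = N • w) :
    ∃ n : ℕ, (n : ℂ) = N ∧ ∀ m, ∀ w ∈ 𝐓, (𝐋 f m (1 : B) ^ (n + 1)) w = 0 := by
  have hnil : ∀ (m : Exponent ν) (w : V), ∃ n, (𝐋 f m (1 : B) ^ n) w = 0 := by
    intro m w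
    have hmem : -(α : LieModule.Weight ℂ H g) ∈ H.root := by
      have := H.isNonZero_coe_root α
      simpa using this
    exact hV.locallyNilpotent ⟨_, hmem⟩ f hf m 1 w
  have key : ∀ m, ∀ w ∈ 𝐓, w ≠ 0 → ∃ n : ℕ, (n : ℂ) = N ∧ (𝐋 f m (1 : B) ^ (n + 1)) w = 0 := by
    intro m w hw hw0
    refine exists_natCast_eq_of_locallyNilpotent (loopOp_triple_opposite hc ht (neg_add_cancel m))
      ?_ hw0 (mem_highestSpace.1 hw α hα e he _ _) (hN w hw) (hnil m w)
    simpa using loopOp_triple_h_f (V := V) ht 0 m (1 : B) 1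
  obtain ⟨w, hw, hw0⟩ := Submodule.exists_mem_ne_zero_of_ne_bot hT
  obtain ⟨n, hn, -⟩ := key 0 w hw hw0
  refine ⟨n, hn, fun m v hv => ?_⟩
  by_cases hv0 : v = 0
  · rw [hv0, map_zero]
  · obtain ⟨n', hn', h⟩ := key m v hv hv0
    obtain rfl : n' = n := Nat.cast_injective (R := ℂ) (hn'.trans hn.symm)
    exact h

/-- For each p, the operators t^n k_p ⊗ c have all M-fold products zero on T. Treating the indices p
successively gives a nonzero vector killed by all of them, and the vectors of T killed by 𝒦 ⊗ B form
a stable subspace. -/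
theorem cenOp_apply_eq_zero (hν : 1 ≤ ν)
    (hirr : ∀ U ≤ 𝐓, U ≠ ⊥ → CartanStable H κ c₁ c₂ ν B U → U = 𝐓) (hT : 𝐓 ≠ ⊥) {M : ℕ}
    (hM : ∀ p q : Fin (ν + 1), ∀ w ∈ 𝐓,
      (𝐊 (basisExp q) (vec (basisExp p)) (1 : B) ^ M) w = 0) (n : Exponent ν)
    (k : Fin (ν + 1) → ℂ) (b : B) {v : V} (hv : v ∈ 𝐓) : 𝐊 n k b v = 0 := by
  have hvec : ∀ p : Fin (ν + 1), vec (basisExp p) = Pi.single p 1 := by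
    intro p
    ext i
    simp only [vec, basisExp, Pi.single_apply]
    split_ifs <;> simp
  have hst := cartanStable_highestSpace (H := H) (κ := κ) (c₁ := c₁) (c₂ := c₂) (ν := ν) (B := B)
    (V := V) (base := base)
  let S : Fin (ν + 1) → Submodule ℂ (End ℂ V) := fun p =>
    Submodule.span ℂ {y | ∃ (n : Exponent ν) (c : B), y = 𝐊 n (Pi.single p 1) c}
  have hSM : ∀ p, ∀ s ∈ S p ^ M, ∀ w ∈ 𝐓, s w = 0 := by
    intro p
    -- A second coordinate q ≠ p exists because ν ≥ 1; for it [t^m d_q, t^n k_p] has no δ-term.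
    have : Nontrivial (Fin (ν + 1)) := Fin.nontrivial_iff_two_le.2 (by omega)
    obtain ⟨q, hq⟩ := exists_ne p
    have hq' : (Pi.single p 1 : Fin (ν + 1) → ℂ) q = 0 := by simp [hq]
    refine mul_apply_eq_zero_of_pow (𝒟 := {D | ∃ (m : Exponent ν) (b : B), D = 𝐃 m q b})
      (x := 𝐊 (basisExp q) (Pi.single p 1) (1 : B)) ?_ ?_ ?_ ?_ ?_
    · intro s hs
      induction hs using Submodule.span_induction with
      | mem y hy =>
        obtain ⟨n, c, rfl⟩ := hy
        exact cenOp_mul_cenOp κ c₁ c₂ _ _ _ _ _ _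
      | zero => simp
      | add a b _ _ h h' => rw [add_mul, mul_add, h, h']
      | smul c a _ h => rw [smul_mul_assoc, mul_smul_comm, h]
    · rintro _ ⟨m, b, rfl⟩ s hs
      induction hs using Submodule.span_induction with
      | mem y hy =>
        obtain ⟨n, c, rfl⟩ := hy
        rw [derOp_mul_cenOp, hq', zero_smul, add_zero, add_sub_cancel_left]
        exact Submodule.smul_mem _ _ (Submodule.subset_span ⟨_, _, rfl⟩)
      | zero => simp
      | add a b _ _ h h' =>
        rw [mul_add, add_mul, add_sub_add_comm]
        exact add_mem h h'
      | smul c a _ h =>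
        rw [smul_mul_assoc, mul_smul_comm, ← smul_sub]
        exact Submodule.smul_mem _ _ h
    · rintro _ ⟨m, b, rfl⟩ w hw
      exact hst.der m q b w hw
    · refine Submodule.span_mono ?_
      rintro _ ⟨n, c, rfl⟩
      -- Since the exponent e_q has q-th coordinate 1, D at n - e_q turns x into exactly the
      -- operator at n.
      refine ⟨Submodule.subset_span ⟨n, c, rfl⟩, 𝐃 (n - basisExp q) q c, ⟨_, _, rfl⟩, ?_⟩
      rw [derOp_mul_cenOp, hq', zero_smul, add_zero, mul_one, sub_add_cancel]
      simp [basisExp]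
    · intro w hw
      rw [← hvec]
      exact hM p q w hw
  have hex : ∀ P : Finset (Fin (ν + 1)), ∃ w ∈ 𝐓, w ≠ 0 ∧
      ∀ p ∈ P, ∀ (n : Exponent ν) (c : B), 𝐊 n (Pi.single p 1) c w = 0 := by
    intro P
    induction P using Finset.induction_on with
    | empty =>
      obtain ⟨w, hw, hw0⟩ := Submodule.exists_mem_ne_zero_of_ne_bot hT
      exact ⟨w, hw, hw0, by simp⟩
    | insert p P _ ih =>
      obtain ⟨w, hw, hw0, hwP⟩ := ih
      let W : Submodule ℂ V := 𝐓 ⊓ ⨅ p ∈ P, ⨅ (n : Exponent ν) (c : B),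
        LinearMap.ker (𝐊 n (Pi.single p 1) c)
      have hmem : ∀ v, v ∈ W ↔ v ∈ 𝐓 ∧ ∀ p ∈ P, ∀ (n : Exponent ν) (c : B),
          𝐊 n (Pi.single p 1) c v = 0 := by
        intro v
        simp [W, Submodule.mem_iInf]
      obtain ⟨u, hu, hu0, huS⟩ := exists_ne_zero_forall_apply_eq_zero (S := S p) (W := W) (M := M)
        ((Submodule.ne_bot_iff _).2 ⟨w, (hmem w).2 ⟨hw, hwP⟩, hw0⟩) (by
          intro s hs v hv
          induction hs using Submodule.span_induction with
          | mem y hy =>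
            obtain ⟨n, c, rfl⟩ := hy
            rw [hmem] at hv ⊢
            refine ⟨hst.cen _ _ _ v hv.1, fun p' hp' n' c' => ?_⟩
            change (𝐊 n' (Pi.single p' 1) c' * 𝐊 n (Pi.single p 1) c) v = 0
            rw [cenOp_mul_cenOp, Module.End.mul_apply, hv.2 p' hp', map_zero]
          | zero => simp
          | add a b _ _ h h' => exact W.add_mem h h'
          | smul c a _ h => exact W.smul_mem c h)
        (fun s hs v hv => hSM p s hs v ((hmem v).1 hv).1)
      refine ⟨u, ((hmem u).1 hu).1, hu0, fun p' hp' n c => ?_⟩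
      rcases Finset.mem_insert.1 hp' with rfl | hp'
      · exact huS _ (Submodule.subset_span ⟨n, c, rfl⟩)
      · exact ((hmem u).1 hu).2 p' hp' n c
  obtain ⟨w, hw, hw0, hwK⟩ := hex Finset.univ
  let U : Submodule ℂ V := 𝐓 ⊓ ⨅ (n : Exponent ν) (k : Fin (ν + 1) → ℂ) (c : B),
    LinearMap.ker (𝐊 n k c)
  have hmem : ∀ v, v ∈ U ↔ v ∈ 𝐓 ∧ ∀ (n : Exponent ν) (k : Fin (ν + 1) → ℂ) (c : B),
      𝐊 n k c v = 0 := by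
    intro v
    simp [U, Submodule.mem_iInf]
  have hU : U = 𝐓 := by
    refine hirr U inf_le_left ((Submodule.ne_bot_iff _).2 ⟨w, (hmem w).2 ⟨hw, fun n k c => ?_⟩, hw0⟩)
      ⟨fun h m b v hv => ?_, fun n k b v hv => ?_, fun m q b v hv => ?_⟩
    · rw [cenOp_eq_sum, LinearMap.sum_apply]
      refine Finset.sum_eq_zero fun p _ => ?_
      rw [LinearMap.smul_apply, hwK p (Finset.mem_univ p), smul_zero]
    · rw [hmem] at hv ⊢
      refine ⟨hst.loop h m b v hv.1, fun n k c => ?_⟩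
      rw [← Module.End.mul_apply, cenOp_mul_loopOp, Module.End.mul_apply, hv.2, map_zero]
    · rw [((hmem v).1 hv).2 n k b]
      exact zero_mem U
    · rw [hmem] at hv ⊢
      refine ⟨hst.der m q b v hv.1, fun n k c => ?_⟩
      have h1 := LinearMap.congr_fun (derOp_mul_cenOp κ c₁ c₂ (V := V) m q n k b c) v
      simp only [Module.End.mul_apply, LinearMap.add_apply, LinearMap.smul_apply, hv.2, map_zero,
        smul_zero, add_zero] at h1
      exact h1.symm
  rw [← hU, hmem] at hv
  exact hv.2 n k b

end CentralNilpotency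
end MapToroidal
end

noncomputable section
namespace MapToroidal

/-! ### An sl₂ computation with a marked coefficient -/

section Augmented

open Module (End)

variable {V : Type*} [AddCommGroup V] [Module ℂ V]

/-- The span of the pairs `(f j₁ ⋯ f jₘ v, 1)` with `∑ jᵢ = s`, and `(f j₁ ⋯ f jₘ x, 0)` with
`x ∈ Q r` and `r + ∑ jᵢ = s`. -/
def markedSpan (f : ℤ → End ℂ V) (v : V) (Q : ℕ → Set V) : ℕ → ℕ → Submodule ℂ (V × ℂ)
  | 0, s => Submodule.span ℂ ({y | s = 0 ∧ y = (v, 1)} ∪ {y | ∃ x ∈ Q s, y = (x, 0)})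
  | M + 1, s => Submodule.span ℂ
      {y | ∃ j s' : ℕ, j + s' = s ∧ ∃ z ∈ markedSpan f v Q M s', y = (f j z.1, z.2)}

variable {e f h : ℤ → End ℂ V} {v : V} {Q : ℕ → Set V}

theorem mem_markedSpan_succ {M s : ℕ} (j : ℕ) {z : V × ℂ} (hz : z ∈ markedSpan f v Q M s) :
    (f j z.1, z.2) ∈ markedSpan f v Q (M + 1) (s + j) :=
  Submodule.subset_span ⟨j, s, add_comm j s, z, hz, rfl⟩

theorem mem_of_mem_span_of_forall {A : End ℂ V} {c : ℂ} {S : Set (V × ℂ)}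
    {U : Submodule ℂ (V × ℂ)} (hS : ∀ y ∈ S, (A y.1, c * y.2) ∈ U) {y : V × ℂ}
    (hy : y ∈ Submodule.span ℂ S) : (A y.1, c * y.2) ∈ U := by
  have h1 : Submodule.span ℂ S ≤ U.comap (A.prodMap (c • LinearMap.id)) := Submodule.span_le.2 hS
  exact h1 hy

/-- Each of the M letters f contributes -2 to the mark, while h a v falls into the unmarked set Q.
-/
theorem cartan_mem_markedSpan (hhf : ∀ i j, h i * f j = f j * h i - (2 : ℕ) • f (i + j))
    (hv : ∀ a : ℕ, 0 < a → h a v ∈ Q a)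
    (hQ : ∀ s, ∀ x ∈ Q s, ∀ a : ℕ, 0 < a → h a x ∈ Q (s + a)) {a : ℕ} (ha : 0 < a) {M s : ℕ}
    {y : V × ℂ} (hy : y ∈ markedSpan f v Q M s) :
    (h a y.1, (-2 * M : ℂ) * y.2) ∈ markedSpan f v Q M (s + a) := by
  induction M generalizing s y with
  | zero =>
    refine mem_of_mem_span_of_forall ?_ hy
    rintro _ (⟨rfl, rfl⟩ | ⟨x, hx, rfl⟩)
    · refine Submodule.subset_span (Or.inr ⟨h a v, ?_, by simp⟩)
      rw [zero_add]
      exact hv a ha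
    · exact Submodule.subset_span (Or.inr ⟨h a x, hQ s x hx a ha, by simp⟩)
  | succ M ih =>
    refine mem_of_mem_span_of_forall ?_ hy
    rintro _ ⟨j, s', rfl, z, hz, rfl⟩
    have h1 := mem_markedSpan_succ j (ih hz)
    have h2 := mem_markedSpan_succ (a + j) hz
    have h3 := sub_mem h1 (Submodule.smul_mem _ (2 : ℂ) (by rwa [← add_assoc] at h2))
    have h4 : h a (f j z.1) = f j (h a z.1) - (2 : ℂ) • f ((a + j : ℕ) : ℤ) z.1 := by
      have := LinearMap.congr_fun (hhf a j) z.1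
      rw [ofNat_smul_eq_nsmul]
      simpa using this
    rw [show j + s' + a = s' + a + j by ring]
    convert h3 using 1
    refine Prod.ext h4 ?_
    simp only [Prod.snd_sub, Prod.smul_snd, smul_eq_mul]
    push_cast
    ring

/-- The mark is multiplied by -(0 + 2 + ⋯ + 2M) = -(M + 1) M, the sum of the `cartan_mem_markedSpan`
factors over the positions at which e 1 is absorbed. -/
theorem raise_mem_markedSpan (hef : ∀ i j, e i * f j = f j * e i + h (i + j))
    (hhf : ∀ i j, h i * f j = f j * h i - (2 : ℕ) • f (i + j)) (hev : ∀ i, e i v = 0)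
    (heQ : ∀ i s, ∀ x ∈ Q s, e i x = 0) (hv : ∀ a : ℕ, 0 < a → h a v ∈ Q a)
    (hQ : ∀ s, ∀ x ∈ Q s, ∀ a : ℕ, 0 < a → h a x ∈ Q (s + a)) {M s : ℕ}
    {y : V × ℂ} (hy : y ∈ markedSpan f v Q (M + 1) s) :
    (e 1 y.1, (-((M + 1) * M) : ℂ) * y.2) ∈ markedSpan f v Q M (s + 1) := by
  induction M generalizing s y with
  | zero =>
    refine mem_of_mem_span_of_forall ?_ hy
    rintro _ ⟨j, s', rfl, z, hz, rfl⟩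
    have h1 : e 1 z.1 = 0 := by
      have := mem_of_mem_span_of_forall (A := e 1) (c := 0) (U := ⊥) (by
        rintro _ (⟨rfl, rfl⟩ | ⟨x, hx, rfl⟩)
        · simp [hev]
        · simp [heQ 1 s' x hx]) hz
      simpa using this
    have h2 := cartan_mem_markedSpan hhf hv hQ (Nat.succ_pos j) hz
    have h3 := LinearMap.congr_fun (hef 1 j) z.1
    rw [Module.End.mul_apply, LinearMap.add_apply, Module.End.mul_apply, h1, map_zero, zero_add,
      add_comm 1] at h3
    rw [show j + s' + 1 = s' + (j + 1) by ring]
    convert h2 using 1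
    refine Prod.ext ?_ (by simp)
    rw [h3]
    push_cast
    rfl
  | succ M ih =>
    refine mem_of_mem_span_of_forall ?_ hy
    rintro _ ⟨j, s', rfl, z, hz, rfl⟩
    have h1 := mem_markedSpan_succ j (ih hz)
    have h2 := cartan_mem_markedSpan hhf hv hQ (Nat.succ_pos j) hz
    have h3 := LinearMap.congr_fun (hef 1 j) z.1
    rw [Module.End.mul_apply, LinearMap.add_apply, Module.End.mul_apply, add_comm 1] at h3
    rw [show j + s' + 1 = s' + 1 + j by ring]
    rw [show s' + j.succ = s' + 1 + j by omega, Nat.cast_succ] at h2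
    convert add_mem h1 h2 using 1
    refine Prod.ext h3 ?_
    simp only [Prod.snd_add]
    push_cast
    ring

/-- Applying e 1 N times to f(0)^(N+1) v = 0 yields a combination of single letters with vector 0
and nonzero mark. Then e(-N) turns the marked term into h 0 v = N v and kills all unmarked ones. -/
theorem eq_zero_of_markedSpan (hef : ∀ i j, e i * f j = f j * e i + h (i + j))
    (hhf : ∀ i j, h i * f j = f j * h i - (2 : ℕ) • f (i + j)) (hev : ∀ i, e i v = 0)
    (heQ : ∀ i s, ∀ x ∈ Q s, e i x = 0) (hv : ∀ a : ℕ, 0 < a → h a v ∈ Q a)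
    (hQ : ∀ s, ∀ x ∈ Q s, ∀ a : ℕ, 0 < a → h a x ∈ Q (s + a))
    (hQ0 : ∀ s : ℕ, ∀ x ∈ Q s, h (-s) x = 0) {N : ℕ} (hN : N ≠ 0) (hhv : h 0 v = (N : ℂ) • v)
    (hf : (f 0 ^ (N + 1)) v = 0) : v = 0 := by
  have hstart : ∀ M, ((f 0 ^ M) v, (1 : ℂ)) ∈ markedSpan f v Q M 0 := by
    intro M
    induction M with
    | zero => exact Submodule.subset_span (Or.inl ⟨rfl, by simp⟩)
    | succ M ih =>
      have := mem_markedSpan_succ 0 ih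
      rwa [pow_succ']
  -- The descent stops at length 1, since the next factor (M + 1) M would be 0.
  have hdesc : ∀ i ≤ N, ∃ c : ℂ, c ≠ 0 ∧ ((0 : V), c) ∈ markedSpan f v Q (N + 1 - i) i := by
    intro i
    induction i with
    | zero => exact fun _ => ⟨1, one_ne_zero, by simpa [hf] using hstart (N + 1)⟩
    | succ i ih =>
      intro hi
      obtain ⟨c, hc, hmem⟩ := ih (by omega)
      obtain ⟨M, hM⟩ : ∃ M, N = M + 1 + i := ⟨N - 1 - i, by omega⟩
      rw [show N + 1 - i = M + 1 + 1 by omega] at hmem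
      have := raise_mem_markedSpan hef hhf hev heQ hv hQ hmem
      rw [map_zero] at this
      refine ⟨_, mul_ne_zero (neg_ne_zero.2 (mul_ne_zero ?_ ?_)) hc,
        by rwa [show N + 1 - (i + 1) = M + 1 by omega]⟩
      · exact_mod_cast Nat.succ_ne_zero (M + 1)
      · exact_mod_cast Nat.succ_ne_zero M
  obtain ⟨c, hc, hmem⟩ := hdesc N le_rfl
  rw [Nat.add_sub_cancel_left] at hmem
  have hle : markedSpan f v Q 1 N
      ≤ LinearMap.ker ((e (-N)).coprod (LinearMap.toSpanSingleton ℂ V (-((N : ℂ) • v)))) := by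
    refine Submodule.span_le.2 ?_
    rintro _ ⟨j, s, hjs, z, hz, rfl⟩
    have h0 : markedSpan f v Q 0 s
        ≤ LinearMap.ker ((e (-N) * f j).coprod
          (LinearMap.toSpanSingleton ℂ V (-((N : ℂ) • v)))) := by
      refine Submodule.span_le.2 ?_
      rintro _ (⟨rfl, rfl⟩ | ⟨x, hx, rfl⟩)
      · obtain rfl : j = N := hjs
        simp [hef, hev, hhv]
      -- Degrees add up to N, so e(-N) f j x = h(-s) x, which is zero for x in Q s.
      · have h1 : (-(N : ℤ) + j) = -(s : ℤ) := by omega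
        simp [hef, heQ _ s x hx, h1, hQ0 s x hx]
    have := h0 hz
    simpa using this
  have h1 := hle hmem
  rw [LinearMap.mem_ker, LinearMap.coprod_apply, map_zero, zero_add,
    LinearMap.toSpanSingleton_apply, smul_neg, neg_eq_zero, smul_smul] at h1
  exact (smul_eq_zero.1 h1).resolve_left (mul_ne_zero hc (Nat.cast_ne_zero.2 hN))

end Augmented
end MapToroidal
end

noncomputable section
namespace MapToroidal

/-! ### The loop system on the highest space -/

section HighestSystem

open Module (End)
open LieAlgebra LieAlgebra.IsKilling

variable {g : Type*} [LieRing g] [LieAlgebra ℂ g]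
  {H : LieSubalgebra ℂ g} (κ : InvForm g) (c₁ c₂ : ℂ) {ν : ℕ}
  {B : Type*} [CommRing B] [Algebra ℂ B]
  (V : Type*) [AddCommGroup V] [Module ℂ V] [LieRingModule (MapFullToroidal κ c₁ c₂ ν B) V]
  [LieModule ℂ (MapFullToroidal κ c₁ c₂ ν B) V]
  [FiniteDimensional ℂ g] [LieAlgebra.IsSimple ℂ g] [H.IsCartanSubalgebra]
  (base : (rootSystem H).Base)

local notation "𝐋" => loopOp κ c₁ c₂ ν V
local notation "𝐊" => cenOp κ c₁ c₂ (ν := ν) V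
local notation "𝐃" => derOp κ c₁ c₂ (ν := ν) V
local notation "𝐓" => highestSpace κ c₁ c₂ ν H B V base

/-- The action of `h ⊗ t^𝐦 ⊗ b` on the highest weight space. -/
def highestLoop (h : H) (m : Exponent ν) (b : B) : End ℂ 𝐓 :=
  (𝐋 (h : g) m b).restrict (cartanStable_highestSpace.loop h m b)

/-- The action of `t^𝐦 d_q ⊗ b` on the highest weight space. -/
def highestDer (m : Exponent ν) (q : Fin (ν + 1)) (b : B) : End ℂ 𝐓 :=
  (𝐃 m q b).restrict (cartanStable_highestSpace.der m q b)

/-- The weight spaces for the weights `μ + 𝐧`, inside the highest weight space. -/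
def highestGrading (B : Type*) [CommRing B] [Algebra ℂ B]
    [LieRingModule (MapFullToroidal κ c₁ c₂ ν B) V]
    [LieModule ℂ (MapFullToroidal κ c₁ c₂ ν B) V]
    (μ : Module.Dual ℂ (H × (Fin (ν + 1) → ℂ) × (Fin (ν + 1) → ℂ)))
    (n : Exponent ν) : Submodule ℂ 𝐓 :=
  (weightSpace κ c₁ c₂ ν H B V (μ + degreeShift H n)).comap 𝐓.subtype

variable {κ c₁ c₂ V base}

local notation "𝐇" => highestLoop (B := B) κ c₁ c₂ V base
local notation "𝐇𝐃" => highestDer (B := B) κ c₁ c₂ V base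
local notation "𝐆" => highestGrading κ c₁ c₂ V base B

theorem cenOp_eq_zero_of_highestSpace
    (hirr : LieModule.IsIrreducible ℂ (MapFullToroidal κ c₁ c₂ ν B) V) (hT : 𝐓 ≠ ⊥)
    (hK : ∀ (n : Exponent ν) k (b : B), ∀ v ∈ 𝐓, 𝐊 n k b v = 0) (n : Exponent ν)
    (k : Fin (ν + 1) → ℂ) (b : B) : 𝐊 n k b = 0 := by
  let W : Submodule ℂ V := ⨅ (n : Exponent ν) (k : Fin (ν + 1) → ℂ) (c : B),
    LinearMap.ker (𝐊 n k c)
  have hmem : ∀ v, v ∈ W ↔ ∀ (n : Exponent ν) (k : Fin (ν + 1) → ℂ) (c : B), 𝐊 n k c v = 0 := by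
    intro v
    simp [W, Submodule.mem_iInf]
  let N : LieSubmodule ℂ (MapFullToroidal κ c₁ c₂ ν B) V :=
    { W with
      lie_mem := by
        intro X v hv
        replace hv := (hmem v).1 hv
        refine lie_mem_of_forall κ c₁ c₂ (W := W) (fun x m b => ?_) (fun n k b => ?_)
          (fun m q b => ?_) X
        · refine (hmem _).2 fun n k c => ?_
          rw [← Module.End.mul_apply, cenOp_mul_loopOp, Module.End.mul_apply, hv, map_zero]
        · rw [hv]
          exact zero_mem W
        · refine (hmem _).2 fun n k c => ?_
          have h1 := LinearMap.congr_fun (derOp_mul_cenOp κ c₁ c₂ (V := V) m q n k b c) v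
          simp only [Module.End.mul_apply, LinearMap.add_apply, LinearMap.smul_apply, hv, map_zero,
            smul_zero, add_zero] at h1
          exact h1.symm }
  have hN : N = ⊤ := by
    refine (hirr.eq_bot_or_eq_top N).resolve_left fun h => ?_
    obtain ⟨u, hu, hu0⟩ := Submodule.exists_mem_ne_zero_of_ne_bot hT
    have : u ∈ N := (hmem u).2 fun n k b => hK n k b u hu
    rw [h, LieSubmodule.mem_bot] at this
    exact hu0 this
  refine LinearMap.ext fun v => ?_
  have : v ∈ N := hN ▸ LieSubmodule.mem_top v
  exact (hmem v).1 this n k b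

theorem loopSystem_highestSpace (hK : ∀ (n : Exponent ν) k (b : B), 𝐊 n k b = 0)
    (hirr : ∀ U ≤ 𝐓, U ≠ ⊥ → CartanStable H κ c₁ c₂ ν B U → U = 𝐓)
    (hfin : ∀ μ, FiniteDimensional ℂ (weightSpace κ c₁ c₂ ν H B V μ)) {Λ : H → ℂ}
    (hΛ : ∀ h : H, ∀ v ∈ 𝐓, 𝐋 (h : g) 0 (1 : B) v = Λ h • v)
    {μ : Module.Dual ℂ (H × (Fin (ν + 1) → ℂ) × (Fin (ν + 1) → ℂ))}
    (hμ : weightSpace κ c₁ c₂ ν H B V μ ≠ ⊥)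
    (hμT : ∀ n, weightSpace κ c₁ c₂ ν H B V (μ + degreeShift H n) ≤ 𝐓) :
    LoopSystem (𝐆 μ) 𝐇 𝐇𝐃 Λ where
  comm h m b h' n c := by
    ext v
    have := LinearMap.congr_fun (loopOp_mul_loopOp κ c₁ c₂ (V := V) (h : g) h' m n b c) v
    rw [lie_cartan_eq_zero, loopOp_zero, hK, smul_zero, add_zero, add_zero] at this
    exact this
  der m q b h n c := by
    ext v
    have := LinearMap.congr_fun (derOp_mul_loopOp κ c₁ c₂ (V := V) m q (h : g) n b c) v
    exact sub_eq_of_eq_add' this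
  irr W hW hWH hWD := by
    have h1 : W.map 𝐓.subtype = 𝐓 := by
      refine hirr _ (Submodule.map_subtype_le _ _) ?_ ⟨?_, ?_, ?_⟩
      · exact fun h => hW (Submodule.map_injective_of_injective (Submodule.injective_subtype _)
          (h.trans (Submodule.map_bot _).symm))
      · rintro h m b _ ⟨v, hv, rfl⟩
        exact ⟨_, hWH h m b v hv, rfl⟩
      · rintro n k b _ ⟨v, hv, rfl⟩
        rw [hK]
        exact zero_mem _
      · rintro m q b _ ⟨v, hv, rfl⟩
        exact ⟨_, hWD m q b v hv, rfl⟩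
    refine eq_top_iff.2 fun v _ => ?_
    obtain ⟨w, hw, hwv⟩ := h1.ge v.2
    rwa [← Subtype.ext hwv]
  fin n := by
    have := hfin (μ + degreeShift H n)
    exact Module.Finite.of_injective
      ((𝐓.subtype.comp (𝐆 μ n).subtype).codRestrict (weightSpace κ c₁ c₂ ν H B V
        (μ + degreeShift H n)) fun v => v.2)
      (fun v w h => by
        have h' : ((v : 𝐓) : V) = (w : 𝐓) := congrArg (fun u : weightSpace κ c₁ c₂ ν H B V
          (μ + degreeShift H n) => (u : V)) h
        exact Subtype.ext (Subtype.ext h'))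
  ne_bot := by
    have h0 : degreeShift H (0 : Exponent ν) = 0 := by
      ext u <;> simp [degreeShift_apply, vec]
    obtain ⟨v, hv, hv0⟩ := Submodule.exists_mem_ne_zero_of_ne_bot hμ
    rw [← add_zero μ, ← h0] at hv
    refine (Submodule.ne_bot_iff _).2 ⟨⟨v, hμT 0 hv⟩, hv, fun h => hv0 (congrArg Subtype.val h)⟩
  homog_H h n c j v hv := by
    have := loopOp_cartan_mem_weightSpace h n c hv
    rwa [add_assoc, ← degreeShift_add] at this
  homog_D m q b j v hv := by
    have := derOp_mem_weightSpace m q b hv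
    rwa [add_assoc, ← degreeShift_add] at this
  weight h := by
    ext v
    exact hΛ h v v.2

/-- If all these products vanished, the vectors h(a e_l) r v with a > 0 would serve as unmarked set
in `eq_zero_of_markedSpan`, and v would be 0. -/
theorem exists_highestLoop_apply_ne_zero {μ : Module.Dual ℂ (H × (Fin (ν + 1) → ℂ) × _)}
    (hK : ∀ (n : Exponent ν) k (b : B), 𝐊 n k b = 0) {Λ : H → ℂ}
    (hH : LoopSystem (𝐆 μ) 𝐇 𝐇𝐃 Λ) {α : H.root} (hα : base.IsPos α) {h : H} {e f : g}
    (ht : IsFormTriple κ (h : g) e f) (he : e ∈ rootSpace H (α : LieModule.Weight ℂ H g))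
    {N : ℕ} (hN : N ≠ 0) (hΛ : Λ h = N) (hf : ∀ v ∈ 𝐓, (𝐋 f 0 (1 : B) ^ (N + 1)) v = 0)
    (l : Fin (ν + 1)) {v : 𝐓} (hv0 : v ≠ 0) :
    ∃ a : ℕ, 0 < a ∧ ∃ s ∈ loopAlgebra 𝐇, IsHomog (𝐆 μ) s (-(a • basisExp l)) ∧
      𝐇 h (a • basisExp l) (1 : B) (s v) ≠ 0 := by
  by_contra! hcon
  -- Q s collects the vectors of degree s above v that carry at least one factor h(a e_l), a > 0.
  -- Applying h(-s e_l) brings the degree back to zero, where `hcon` applies.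
  let Q : ℕ → Set V := fun s => {x | ∃ a : ℕ, 0 < a ∧ ∃ r ∈ loopAlgebra 𝐇,
    IsHomog (𝐆 μ) r ((s : ℤ) • basisExp l - a • basisExp l) ∧
      x = 𝐇 h (a • basisExp l) (1 : B) (r v)}
  have hev : ∀ (n : Exponent ν) (w : 𝐓), 𝐋 e n (1 : B) w = 0 := fun n w =>
    mem_highestSpace.1 w.2 α hα e he n 1
  have hcomm : ∀ (m n : Exponent ν) (w : 𝐓),
      𝐇 h m (1 : B) (𝐇 h n (1 : B) w) = 𝐇 h n (1 : B) (𝐇 h m (1 : B) w) := fun m n w =>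
    LinearMap.congr_fun (hH.comm h m 1 h n 1) w
  refine hv0 (Subtype.ext (eq_zero_of_markedSpan (e := fun i => 𝐋 e (i • basisExp l) (1 : B))
    (f := fun i => 𝐋 f (i • basisExp l) (1 : B))
    (h := fun i => 𝐋 (h : g) (i • basisExp l) (1 : B)) (v := (v : V)) (Q := Q)
    ?_ ?_ (fun i => hev _ v) ?_ ?_ ?_ ?_ hN ?_ ?_))
  · intro i j
    rw [loopOp_mul_loopOp, ht.triple.lie_e_f, hK, smul_zero, add_zero, ← add_smul, one_mul]
  · intro i j
    rw [loopOp_triple_h_f ht, ← add_smul, one_mul]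
  · rintro i s _ ⟨a, -, r, -, -, rfl⟩
    exact hev _ _
  · intro a ha
    refine ⟨a, ha, 1, one_mem _, ?_, ?_⟩
    · rw [natCast_zsmul, sub_self]
      exact IsHomog.one
    · rw [natCast_zsmul]
      rfl
  · rintro s _ ⟨b, hb, r, hr, hdeg, rfl⟩ a ha
    refine ⟨b, hb, 𝐇 h ((a : ℤ) • basisExp l) (1 : B) * r,
      mul_mem (mem_loopAlgebra _ _ _ _) hr, ?_, ?_⟩
    · convert (hH.homog_H h ((a : ℤ) • basisExp l) 1).mul hdeg using 1
      push_cast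
      module
    · exact congrArg Subtype.val (hcomm _ _ _)
  · rintro s _ ⟨b, hb, r, hr, hdeg, rfl⟩
    have h1 := hcon b hb (𝐇 h ((-s : ℤ) • basisExp l) (1 : B) * r)
      (mul_mem (mem_loopAlgebra _ _ _ _) hr) (by
        convert (hH.homog_H h ((-s : ℤ) • basisExp l) 1).mul hdeg using 1
        module)
    exact congrArg Subtype.val ((hcomm _ _ _).trans h1)
  · have := LinearMap.congr_fun (hH.weight h) v
    rw [hΛ] at this
    rw [zero_smul]
    exact congrArg Subtype.val this
  · rw [zero_smul]
    exact hf v v.2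

/-- ψ is the scalar of L 0 b divided by N; the product formula makes it multiplicative and, with one
exponent 0, gives the evaluation property. -/
theorem exists_algHom_of_evaluation {T : Type*} [AddCommGroup T] [Module ℂ T] [Nontrivial T]
    {L : Exponent ν → B → End ℂ T} {N : ℂ} (hN : N ≠ 0) (h1 : L 0 1 = N • 1)
    (hadd : ∀ b c, L 0 (b + c) = L 0 b + L 0 c) (hsmul : ∀ (a : ℂ) b, L 0 (a • b) = a • L 0 b)
    (hmul : ∀ m b n c, L m b * L n c = N • L (m + n) (b * c))
    (hscal : ∀ b, ∃ e : ℂ, L 0 b = e • (1 : End ℂ T)) :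
    ∃ ψ : B →ₐ[ℂ] ℂ, ∀ m b, L m b = ψ b • L m 1 := by
  choose ε hε using hscal
  have hinj : ∀ {a b : ℂ}, a • (1 : End ℂ T) = b • 1 → a = b := fun h =>
    smul_left_injective ℂ (one_ne_zero (α := End ℂ T)) h
  have hε1 : ε 1 = N := hinj ((hε 1).symm.trans h1)
  have hεm : ∀ b c, ε b * ε c = N * ε (b * c) := fun b c => hinj (by
    have := hmul 0 b 0 c
    rw [add_zero, hε, hε, hε, smul_mul_smul_comm, one_mul, smul_smul] at this
    exact this)
  let φ : B →ₗ[ℂ] ℂ :=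
    { toFun := fun b => N⁻¹ * ε b
      map_add' := fun b c => by
        rw [← mul_add]
        congr 1
        exact hinj (by rw [← hε, hadd, hε, hε, add_smul])
      map_smul' := fun a b => by
        rw [RingHom.id_apply, smul_eq_mul, mul_left_comm]
        congr 1
        exact hinj (by rw [← hε, hsmul, hε, smul_smul]) }
  refine ⟨AlgHom.ofLinearMap φ (by change N⁻¹ * ε 1 = 1; rw [hε1, inv_mul_cancel₀ hN])
    (fun b c => ?_), fun m b => ?_⟩
  · change N⁻¹ * ε (b * c) = N⁻¹ * ε b * (N⁻¹ * ε c)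
    rw [mul_mul_mul_comm, hεm, mul_assoc, inv_mul_cancel_left₀ hN]
  · change L m b = (N⁻¹ * ε b) • L m 1
    have := hmul 0 b m 1
    rw [zero_add, mul_one, hε, smul_one_mul] at this
    rw [mul_smul, this, inv_smul_smul₀ hN]

end HighestSystem
end MapToroidal
end

/-! ### The main theorem -/

theorem theorem5p7
    {g : Type*} [LieRing g] [LieAlgebra ℂ g] [FiniteDimensional ℂ g] [LieAlgebra.IsSimple ℂ g]
    (H : LieSubalgebra ℂ g) [H.IsCartanSubalgebra]
    (base : (LieAlgebra.IsKilling.rootSystem H).Base)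
    (κ : MapToroidal.InvForm g) (c₁ c₂ : ℂ) (ν : ℕ) (hν : 1 ≤ ν)
    {B : Type*} [CommRing B] [Algebra ℂ B] [Algebra.FiniteType ℂ B]
    {V : Type*} [AddCommGroup V] [Module ℂ V]
    [LieRingModule (MapToroidal.MapFullToroidal κ c₁ c₂ ν B) V]
    [LieModule ℂ (MapToroidal.MapFullToroidal κ c₁ c₂ ν B) V]
    (hirr : LieModule.IsIrreducible ℂ (MapToroidal.MapFullToroidal κ c₁ c₂ ν B) V)
    (hV : MapToroidal.InCfin κ c₁ c₂ ν H B V)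
    (hcharge : MapToroidal.ZeroCentralCharge κ c₁ c₂ ν B V)
    (Λ : Module.Dual ℂ H)
    (hΛ : ∃ w ∈ MapToroidal.highestSpace κ c₁ c₂ ν H B V base, w ≠ 0 ∧
      ∀ h : H, MapToroidal.loopOp κ c₁ c₂ ν V (h : g) 0 (1 : B) w = Λ h • w)
    (h₀ : H) (hh₀ : Λ h₀ ≠ 0) :
    (∃ ψ : B →ₐ[ℂ] ℂ, ∀ (m : MapToroidal.Exponent ν) (b : B),
      ∀ v ∈ MapToroidal.highestSpace κ c₁ c₂ ν H B V base,
        MapToroidal.loopOp κ c₁ c₂ ν V (h₀ : g) m b v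
          = ψ b • MapToroidal.loopOp κ c₁ c₂ ν V (h₀ : g) m (1 : B) v) ∧
    (∀ (m n : MapToroidal.Exponent ν) (b₁ b₂ : B),
      ∀ v ∈ MapToroidal.highestSpace κ c₁ c₂ ν H B V base,
        MapToroidal.loopOp κ c₁ c₂ ν V (h₀ : g) m b₁
            (MapToroidal.loopOp κ c₁ c₂ ν V (h₀ : g) n b₂ v)
          = Λ h₀ • MapToroidal.loopOp κ c₁ c₂ ν V (h₀ : g) (m + n) (b₁ * b₂) v) := by
  obtain ⟨w, hw, hw0, -⟩ := id hΛ
  have hT : MapToroidal.highestSpace κ c₁ c₂ ν H B V base ≠ ⊥ :=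
    (Submodule.ne_bot_iff _).2 ⟨w, hw, hw0⟩
  have hTnt : Nontrivial (MapToroidal.highestSpace κ c₁ c₂ ν H B V base) :=
    Submodule.nontrivial_iff_ne_bot.2 hT
  have hirrT := fun U => MapToroidal.eq_highestSpace_of_cartanStable hirr hΛ (U := U)
  have hΛT := fun h v => MapToroidal.loopOp_cartan_apply_of_mem hirr hΛ h (v := v)
  have hΛ0 : Λ ≠ 0 := fun h => hh₀ (by rw [h, LinearMap.zero_apply])
  -- The element h₀ need not belong to an sl₂-triple. The invertible loops come from a coroot on
  -- which Λ is nonzero, and the product formula, valid for all Cartan elements, is specialised to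
  -- h₀ at the end.
  obtain ⟨α, hα, hαΛ⟩ := MapToroidal.exists_isPos_apply_coroot_ne_zero base hΛ0
  obtain ⟨e, he, f, hf, ht⟩ := MapToroidal.exists_isFormTriple κ α
  obtain ⟨N, hN, hfN⟩ := MapToroidal.exists_loopOp_pow_eq_zero hV.integrable hcharge hα ht he hf hT
    (hΛT _)
  have hN0 : N ≠ 0 := fun h => hαΛ (by rw [← hN, h, Nat.cast_zero])
  have hst := MapToroidal.cartanStable_highestSpace (H := H) (κ := κ) (c₁ := c₁) (c₂ := c₂)
    (ν := ν) (B := B) (V := V) (base := base)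
  have hKT := MapToroidal.cenOp_apply_eq_zero hν hirrT hT (M := N + 1) fun p q w hw =>
    MapToroidal.cenOp_pow_apply_eq_zero hcharge ht
      (fun n w hw => MapToroidal.mem_highestSpace.1 hw α hα e he n 1)
      (fun n w hw => hst.loop _ n 1 w hw) (fun n k w hw => hst.cen n k 1 w hw) hfN hw
  have hK := MapToroidal.cenOp_eq_zero_of_highestSpace hirr hT fun n k b v hv => hKT n k b hv
  obtain ⟨μ, hμ, hμT⟩ := MapToroidal.exists_weightSpace_le_highestSpace hirr
    hV.integrable.isWeightModule hΛ
  have hH := MapToroidal.loopSystem_highestSpace hK hirrT hV.finite hΛT hμ hμT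
  obtain ⟨hmul, hscal⟩ := hH.exists_evaluation_of_complement hαΛ fun l v _ hv0 _ =>
    MapToroidal.exists_highestLoop_apply_ne_zero hK hH hα ht he hN0 hN.symm (hfN 0) l hv0
  obtain ⟨ψ, hψ⟩ := MapToroidal.exists_algHom_of_evaluation hh₀ (hH.weight h₀)
    (fun b c => LinearMap.ext fun v => Subtype.ext <|
      LinearMap.congr_fun (MapToroidal.loopOp_add_right κ c₁ c₂ (V := V) (h₀ : g) 0 b c) v)
    (fun a b => LinearMap.ext fun v => Subtype.ext <|
      LinearMap.congr_fun (MapToroidal.loopOp_smul_right κ c₁ c₂ (V := V) (h₀ : g) 0 a b) v)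
    (fun m b n c => hmul h₀ m b h₀ n c) (hscal h₀)
  exact ⟨⟨ψ, fun m b v hv => congrArg Subtype.val (LinearMap.congr_fun (hψ m b) ⟨v, hv⟩)⟩,
    fun m n b₁ b₂ v hv =>
      congrArg Subtype.val (LinearMap.congr_fun (hmul h₀ m b₁ h₀ n b₂) ⟨v, hv⟩)⟩
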